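/- Work in the Euclidean plane with the tiling by equilateral triangles (cells) of side $1$. A heptiamond is a figure formed by seven cells joined edge-to-edge; two heptiamonds are the same piece if an isometry of the plane (reflections allowed) carries the cells of one onto the cells of the other. A trisection of a figure $R$ into convex pentagons is a triple of mutually congruent (reflections allowed) solid convex pentagons with pairwise disjoint interiors whose union is $R$. The TH-pentagon is the convex pentagon $ABCDE$ such that $ABD$ and $BCD$ are distinct equilateral triangles of side $1$ and $ADE$ is an isosceles triangle with base $AD$, lying on the opposite side of $AD$ from $B$, whose area is one third of that of $ABD$ (so its angles at $A,B,C,D,E$ are $90^\circ,120^\circ,60^\circ,150^\circ,120^\circ$). The windmill is the heptiamond formed by a central cell, its three neighbours, and one further cell attached to each neighbour, such that the figure has a threefold rotational symmetry; the ship is obtained from the windmill by moving one of the three outer cells to the other free edge of the neighbour that carries it. There are exactly $24$ heptiamonds up to being the same piece. In every trisection of a heptiamond into convex pentagons, the three pentagons are congruent to the TH-pentagon. The windmill and the ship are two different heptiamonds, and a heptiamond admits a trisection into convex pentagons if and only if it is the same piece as the windmill or the ship. -/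

import Mathlib

noncomputable section

namespace Polyiamond

/-- The Euclidean plane. -/
abbrev Plane : Type := EuclideanSpace ℝ (Fin 2)

/-! ### The tiling of the plane by equilateral triangles of side 1 -/

/-- The lattice point `i • (1, 0) + j • (1/2, √3/2)`. -/
def latticePoint (p : ℤ × ℤ) : Plane :=
  !₂[(p.1 : ℝ) + (p.2 : ℝ) / 2, (p.2 : ℝ) * (√3 / 2)]

/-- A cell of the triangular tiling: `(i, j, false)` is the triangle pointing up whose lower left
corner is `(i, j)`, and `(i, j, true)` is the triangle pointing down that completes it to a
unit rhombus. -/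
abbrev Cell : Type := ℤ × ℤ × Bool

/-- The three corners of a cell, in lattice coordinates. -/
def Cell.corners : Cell → Finset (ℤ × ℤ)
  | (i, j, false) => {(i, j), (i + 1, j), (i, j + 1)}
  | (i, j, true) => {(i + 1, j), (i, j + 1), (i + 1, j + 1)}

/-- The closed equilateral triangle of side 1 represented by a cell. -/
def Cell.triangle (c : Cell) : Set Plane :=
  convexHull ℝ (latticePoint '' (Cell.corners c : Set (ℤ × ℤ)))

/-- Two cells are adjacent if they are distinct and have an edge (two corners) in common. -/
def cellGraph : SimpleGraph Cell where
  Adj c d := c ≠ d ∧ (Cell.corners c ∩ Cell.corners d).card = 2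
  symm := ⟨fun c d h => ⟨h.1.symm, by rw [Finset.inter_comm]; exact h.2⟩⟩
  loopless := ⟨fun _ h => h.1 rfl⟩

/-! ### Heptiamonds -/

/-- A polyiamond with seven cells: seven cells of the triangular tiling joined edge-to-edge. -/
def IsHeptiamond (T : Finset Cell) : Prop :=
  T.card = 7 ∧ (cellGraph.induce (T : Set Cell)).Connected

/-- The plane figure covered by a finite set of cells. -/
def region (T : Finset Cell) : Set Plane :=
  ⋃ c ∈ T, Cell.triangle c

/-- Two polyiamonds are the same piece if an isometry of the plane (reflections allowed)
carries the cells of the first exactly onto the cells of the second. -/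
def SamePiece (T T' : Finset Cell) : Prop :=
  ∃ e : Plane ≃ᵢ Plane,
    (fun c => e '' Cell.triangle c) '' (T : Set Cell) = Cell.triangle '' (T' : Set Cell)

theorem samePiece_iff {T T' : Finset Cell} :
    SamePiece T T' ↔ ∃ e : Plane ≃ᵢ Plane,
      (fun S : Set Plane => e '' S) '' (Cell.triangle '' (T : Set Cell)) =
        Cell.triangle '' (T' : Set Cell) := by
  simp only [SamePiece, Set.image_image]

theorem SamePiece.refl (T : Finset Cell) : SamePiece T T :=
  samePiece_iff.2 ⟨IsometryEquiv.refl Plane, by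
    have h : ⇑(IsometryEquiv.refl Plane) = id := rfl
    simp [h]⟩

theorem SamePiece.symm {T T' : Finset Cell} (h : SamePiece T T') : SamePiece T' T := by
  obtain ⟨e, he⟩ := samePiece_iff.1 h
  refine samePiece_iff.2 ⟨e.symm, ?_⟩
  rw [← he, Set.image_image]
  simp only [Set.image_image, IsometryEquiv.symm_apply_apply, Set.image_id']

theorem SamePiece.trans {T T' T'' : Finset Cell} (h : SamePiece T T') (h' : SamePiece T' T'') :
    SamePiece T T'' := by
  obtain ⟨e, he⟩ := samePiece_iff.1 h
  obtain ⟨f, hf⟩ := samePiece_iff.1 h'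
  refine samePiece_iff.2 ⟨e.trans f, ?_⟩
  rw [← hf, ← he]
  have h : ⇑(e.trans f) = fun x => f (e x) := rfl
  simp only [Set.image_image, h]

/-- The equivalence relation of being the same piece, on heptiamonds. -/
def heptiamondSetoid : Setoid {T : Finset Cell // IsHeptiamond T} where
  r T T' := SamePiece T.1 T'.1
  iseqv := ⟨fun T => SamePiece.refl T.1, SamePiece.symm, SamePiece.trans⟩

/-- The free heptiamonds: heptiamonds up to isometries of the plane. -/
def FreeHeptiamond : Type := Quotient heptiamondSetoid

/-- The windmill: a central triangle, its three neighbours, and one further triangle attached to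
each of these neighbours, such that the figure has a threefold rotational symmetry. -/
def windmill : Finset Cell :=
  {(0, 0, false), (0, 0, true), (-1, 0, true), (0, -1, true),
    (1, 0, false), (-1, 1, false), (0, -1, false)}

/-- The ship: the windmill with one of the three attached triangles moved to the other
free edge of the neighbour that carries it. -/
def ship : Finset Cell :=
  {(0, 0, false), (0, 0, true), (-1, 0, true), (0, -1, true),
    (0, 1, false), (-1, 1, false), (0, -1, false)}

/-! ### Trisections into convex pentagons -/

/-- Congruence of plane figures (reflections allowed). -/
def FigureCongruent (S S' : Set Plane) : Prop :=
  ∃ e : Plane ≃ᵢ Plane, e '' S = S'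

/-- A (solid, closed) convex pentagon: the convex hull of five points in strictly convex position,
that is, none of them lies in the convex hull of the other four. -/
def IsConvexPentagon (S : Set Plane) : Prop :=
  ∃ v : Fin 5 → Plane, ConvexIndependent ℝ v ∧ S = convexHull ℝ (Set.range v)

/-- `P` is a dissection of the figure `R` into three mutually congruent convex pentagons. -/
structure IsPentagonTrisection (R : Set Plane) (P : Fin 3 → Set Plane) : Prop where
  pentagon : ∀ i, IsConvexPentagon (P i)
  congruent : ∀ i j, FigureCongruent (P i) (P j)
  disjoint : ∀ i j, i ≠ j → Disjoint (interior (P i)) (interior (P j))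
  cover : ⋃ i, P i = R

/-- The TH-pentagon `ABCDE` with `AB = 1`. Here `ABD` and `BCD` are equilateral triangles of
side 1, and `ADE` is an isosceles triangle with base `AD`, lying on the other side of `AD` than
`B`, whose height `√3/6` is a third of the height `√3/2` of `ABD`. -/
def thPentagon : Set Plane :=
  convexHull ℝ {
    !₂[(1 : ℝ), 0],            -- A
    !₂[(1 / 2 : ℝ), √3 / 2],   -- B
    !₂[(-1 / 2 : ℝ), √3 / 2],  -- C
    !₂[(0 : ℝ), 0],            -- D
    !₂[(1 / 2 : ℝ), -√3 / 6]   -- E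
  }

end Polyiamond

end

open Polyiamond

/-!
**Counting.** Removing a suitable cell from a polyiamond leaves a polyiamond. Hence the heptiamonds
are found by adding cells one at a time, and up to symmetries of the tiling each of them is one of
24 representatives (`exists_rep`). An isometry carrying cells to cells preserves the distances
between the centres of the cells, even if it is not known to be a symmetry of the tiling; the
invariant `pieceInv` formed from these distances distinguishes the representatives.

**Trisections.** Each pentagon has the area of `7 / 3` cells, and any two are separated by a line.
The argument studies which edges lie on lines of the tiling.

An edge that does not lie on such a line passes through the interior of the region, so it is covered
by collinear edges of the other pentagons (`Config.exists_contact`). It lies on a separating line,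
and therefore each pentagon has at most two such edges. Then any two pentagons have corresponding
edges that both lie on lines of the tiling, and as the pentagons are congruent, whether an edge is
parallel to the tiling depends on its index only (`Config.lat_of_lat`).

Each pentagon in fact has two edges off the lines of the tiling (`Config.exists_two`). There is at
least one, because otherwise the vertices would be lattice points and the area an integer. If there
were only one, then all edges would be parallel to the tiling; the pentagon would be an equilateral
triangle with two corners cut off, and its area would determine the lengths of its edges
(`IsCyclic.lengths_of_one`), which do not allow the exceptional edges to cover each other
(`Config.not_one`).

It follows that any two pentagons share a whole edge (`Config.exists_shared`). Three compact convex
sets that meet pairwise and whose union has no holes have a common point (`exists_common_point`),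
and heptiamonds have no holes (`IsHeptiamond.fillsTriangles`). So the three pentagons have a common
vertex, at which the shared edges meet (`Config.exists_apex`), and it has the same index in all of
them (`Config.exists_fan`).

By congruence the far ends of the shared edges form an equilateral triangle with the common vertex
as its centre, so the angles at this vertex are 120 degrees (`Fan.ip_apex`). The other three edges
have directions of the tiling, and their lengths are integers, or two of them have an integral sum
(`Fan.shape`); the area leaves only the length `1` (`lengths_eq_one`).
Hence each pentagon is the image of the TH-pentagon under a symmetry of the tiling
(`Fan.exists_latticeSym`). It consists of two adjacent cells and a third of a cell whose centre is
the common vertex. So the heptiamond consists of this cell, its neighbours, and a further cell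
attached to each of these, which makes it the windmill or the ship (`samePiece_of_arms`).

Conversely, dividing the central cell of the windmill or the ship into three equal parts and joining
these to the arms gives a trisection (`isPentagonTrisection_of_arms`).

All computations use the lattice coordinates `X` and `Y`, in which the lines of the tiling are those
where `X`, `Y` or `X + Y` is an integer.
-/

noncomputable section

namespace Polyiamond

open MeasureTheory

/-! ### Lattice coordinates -/

/-- First coordinate with respect to the lattice basis `(1, 0)`, `(1/2, √3/2)`. -/
def X (z : Plane) : ℝ := z 0 - z 1 / √3

/-- Second coordinate with respect to the lattice basis `(1, 0)`, `(1/2, √3/2)`. -/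
def Y (z : Plane) : ℝ := 2 * z 1 / √3

/-- The point with given lattice coordinates. -/
def pt (x y : ℝ) : Plane := !₂[x + y / 2, y * (√3 / 2)]

theorem sqrt3_ne : √(3 : ℝ) ≠ 0 := by positivity

@[simp] theorem X_pt (x y : ℝ) : X (pt x y) = x := by
  have := sqrt3_ne
  simp [X, pt]; field_simp; ring

@[simp] theorem Y_pt (x y : ℝ) : Y (pt x y) = y := by
  have := sqrt3_ne
  simp [Y, pt]; field_simp

@[simp] theorem pt_X_Y (z : Plane) : pt (X z) (Y z) = z := by
  have := sqrt3_ne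
  ext i
  fin_cases i
  · simp [X, Y, pt]; field_simp; ring
  · simp [X, Y, pt]; field_simp

theorem ext_XY {z w : Plane} (h1 : X z = X w) (h2 : Y z = Y w) : z = w := by
  rw [← pt_X_Y z, h1, h2, pt_X_Y]

@[simp] theorem X_add (z w : Plane) : X (z + w) = X z + X w := by simp [X]; ring
@[simp] theorem Y_add (z w : Plane) : Y (z + w) = Y z + Y w := by simp [Y]; ring
@[simp] theorem X_sub (z w : Plane) : X (z - w) = X z - X w := by simp [X]; ring
@[simp] theorem Y_sub (z w : Plane) : Y (z - w) = Y z - Y w := by simp [Y]; ring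
@[simp] theorem X_smul (t : ℝ) (z : Plane) : X (t • z) = t * X z := by simp [X]; ring
@[simp] theorem Y_smul (t : ℝ) (z : Plane) : Y (t • z) = t * Y z := by simp [Y]; ring
@[simp] theorem X_zero : X 0 = 0 := by simp [X]
@[simp] theorem Y_zero : Y 0 = 0 := by simp [Y]

@[fun_prop] theorem continuous_X : Continuous X := by unfold X; fun_prop
@[fun_prop] theorem continuous_Y : Continuous Y := by unfold Y; fun_prop
theorem latticePoint_eq (p : ℤ × ℤ) : latticePoint p = pt p.1 p.2 := rfl

/-- The lattice coordinates as a linear equivalence. -/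
def coordEquiv : Plane ≃ₗ[ℝ] (Fin 2 → ℝ) where
  toFun z := ![X z, Y z]
  invFun f := pt (f 0) (f 1)
  map_add' z w := by ext i; fin_cases i <;> simp
  map_smul' t z := by ext i; fin_cases i <;> simp
  left_inv z := by simp
  right_inv f := by ext i; fin_cases i <;> simp

theorem dual_apply (φ : Plane →L[ℝ] ℝ) (z : Plane) :
    φ z = φ (pt 1 0) * X z + φ (pt 0 1) * Y z := by
  have : z = X z • pt 1 0 + Y z • pt 0 1 := ext_XY (by simp) (by simp)
  conv_lhs => rw [this]
  rw [map_add, map_smul, map_smul, smul_eq_mul, smul_eq_mul]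
  ring

/-- The polar form of the squared Euclidean norm, in lattice coordinates. -/
def ip (z w : Plane) : ℝ := X z * X w + (X z * Y w + X w * Y z) / 2 + Y z * Y w

/-- The squared Euclidean norm, in lattice coordinates. -/
def nsq (z : Plane) : ℝ := X z ^ 2 + X z * Y z + Y z ^ 2

theorem norm_sq_eq (z : Plane) : ‖z‖ ^ 2 = nsq z := by
  rw [EuclideanSpace.norm_sq_eq]
  have h3 : √(3 : ℝ) ^ 2 = 3 := Real.sq_sqrt (by norm_num)
  have := sqrt3_ne
  simp only [Fin.sum_univ_two, nsq, X, Y, Real.norm_eq_abs, sq_abs]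
  field_simp
  ring_nf
  rw [h3]

theorem dist_sq_eq (z w : Plane) : dist z w ^ 2 = nsq (z - w) := by
  rw [dist_eq_norm, norm_sq_eq]

theorem nsq_nonneg (z : Plane) : 0 ≤ nsq z := by
  rw [← norm_sq_eq]; positivity

theorem nsq_eq_zero {z : Plane} (h : nsq z = 0) : z = 0 := by
  rw [← norm_sq_eq] at h
  simpa using h

theorem nsq_pos {z : Plane} (h : z ≠ 0) : 0 < nsq z :=
  lt_of_le_of_ne (nsq_nonneg z) fun h' => h (nsq_eq_zero h'.symm)

theorem nsq_eq_iff_dist {a b c d : Plane} : nsq (a - b) = nsq (c - d) ↔ dist a b = dist c d := by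
  rw [← dist_sq_eq, ← dist_sq_eq]
  exact ⟨fun h => by simpa using (sq_eq_sq₀ dist_nonneg dist_nonneg).1 h, fun h => by rw [h]⟩

theorem ip_eq (a b c : Plane) :
    ip (a - b) (c - b) = (nsq (a - b) + nsq (c - b) - nsq (a - c)) / 2 := by
  simp only [ip, nsq, X_sub, Y_sub]; ring

/-- The signed area of the triangle `a b c`, in units of the area of a cell. -/
def cr (a b c : Plane) : ℝ := (X b - X a) * (Y c - Y a) - (X c - X a) * (Y b - Y a)

theorem cr_rot (a b c : Plane) : cr b c a = cr a b c := by unfold cr; ring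
theorem cr_swap (a b c : Plane) : cr b a c = -cr a b c := by unfold cr; ring
theorem cr_swap' (a b c : Plane) : cr a c b = -cr a b c := by unfold cr; ring
@[simp] theorem cr_self_left (a b : Plane) : cr a a b = 0 := by unfold cr; ring
@[simp] theorem cr_self_right (a b : Plane) : cr a b b = 0 := by unfold cr; ring
@[simp] theorem cr_self_mid (a b : Plane) : cr a b a = 0 := by unfold cr; ring

/-- The Lagrange identity; the factor is the square of the area `√3 / 2` of a unit rhombus. -/
theorem cr_sq (a b c : Plane) :
    3 / 4 * cr a b c ^ 2 = nsq (b - a) * nsq (c - a) - ip (b - a) (c - a) ^ 2 := by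
  simp only [ip, nsq, cr, X_sub, Y_sub]; ring

@[fun_prop] theorem continuous_cr (a b : Plane) : Continuous fun z => cr a b z := by
  unfold cr; fun_prop

/-! ### Affine functionals -/

/-- Nonconstant affine functionals on the plane. -/
def IsAff (h : Plane → ℝ) : Prop :=
  ∃ α β γ : ℝ, (α ≠ 0 ∨ β ≠ 0) ∧ ∀ z, h z = α * X z + β * Y z + γ

theorem IsAff.neg {h : Plane → ℝ} (hh : IsAff h) : IsAff (fun z => -h z) := by
  obtain ⟨α, β, γ, h0, hf⟩ := hh
  exact ⟨-α, -β, -γ, by simpa using h0, fun z => by simp only [hf]; ring⟩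

theorem IsAff.const_mul {h : Plane → ℝ} (hh : IsAff h) {r : ℝ} (hr : r ≠ 0) :
    IsAff (fun z => r * h z) := by
  obtain ⟨α, β, γ, h0, hf⟩ := hh
  exact ⟨r * α, r * β, r * γ, h0.imp (mul_ne_zero hr) (mul_ne_zero hr), fun z => by
    simp only [hf]; ring⟩

theorem isAff_cr {a b : Plane} (hab : a ≠ b) : IsAff (fun z => cr a b z) := by
  refine ⟨-(Y b - Y a), X b - X a, X a * (Y b - Y a) - Y a * (X b - X a), ?_, fun z => by
    unfold cr; ring⟩
  by_contra! h
  exact hab (ext_XY (by linarith [h.2]) (by linarith [h.1]))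

/-- An affine functional commutes with affine combinations. -/
theorem IsAff.sum {h : Plane → ℝ} (hh : IsAff h) {ι : Type*} [Fintype ι] (l : ι → ℝ)
    (hl : ∑ i, l i = 1) (v : ι → Plane) {z : Plane} (hX : X z = ∑ i, l i * X (v i))
    (hY : Y z = ∑ i, l i * Y (v i)) : h z = ∑ i, l i * h (v i) := by
  obtain ⟨α, β, γ, h0, hf⟩ := hh
  simp only [hf]
  rw [hX, hY, Finset.mul_sum, Finset.mul_sum, ← Finset.sum_add_distrib]
  have : γ = ∑ i, l i * γ := by rw [← Finset.sum_mul, hl, one_mul]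
  conv_lhs => rw [this]
  rw [← Finset.sum_add_distrib]
  exact Finset.sum_congr rfl fun i _ => by ring

theorem IsAff.combo {h : Plane → ℝ} (hh : IsAff h) (x y : Plane) {a b : ℝ} (hab : a + b = 1) :
    h (a • x + b • y) = a * h x + b * h y := by
  obtain ⟨α, β, γ, h0, hf⟩ := hh
  simp only [hf, X_add, Y_add, X_smul, Y_smul]
  linear_combination (-γ) * hab

theorem IsAff.convex_le {h : Plane → ℝ} (hh : IsAff h) (c : ℝ) : Convex ℝ {z | c ≤ h z} := by
  intro x hx y hy a b ha hb hab
  simp only [Set.mem_ofPred_eq] at *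
  rw [hh.combo x y hab]
  calc c = a * c + b * c := by rw [← add_mul, hab, one_mul]
    _ ≤ _ := by gcongr

theorem IsAff.nonneg_of_mem_convexHull {h : Plane → ℝ} (hh : IsAff h) {s : Set Plane}
    (hs : ∀ z ∈ s, 0 ≤ h z) {z : Plane} (hz : z ∈ convexHull ℝ s) : 0 ≤ h z :=
  convexHull_min (t := {z | 0 ≤ h z}) hs (hh.convex_le 0) hz

/-- An affine functional vanishing at two distinct points is a multiple of `cr`. -/
theorem IsAff.eq_cr {h : Plane → ℝ} (hh : IsAff h) {a b : Plane} (hab : a ≠ b) (ha : h a = 0)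
    (hb : h b = 0) : ∃ c : ℝ, c ≠ 0 ∧ ∀ z, h z = c * cr a b z := by
  obtain ⟨α, β, γ, h0, hf⟩ := hh
  rw [hf] at ha hb
  have key : α * (X b - X a) + β * (Y b - Y a) = 0 := by linarith
  have hne : X b - X a ≠ 0 ∨ Y b - Y a ≠ 0 := by
    by_contra! h'
    exact hab (ext_XY (by linarith [h'.1]) (by linarith [h'.2]))
  have hD : (X b - X a) ^ 2 + (Y b - Y a) ^ 2 ≠ 0 := by
    rcases hne with h' | h' <;> positivity
  refine ⟨(β * (X b - X a) - α * (Y b - Y a)) / ((X b - X a) ^ 2 + (Y b - Y a) ^ 2), ?_, ?_⟩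
  · refine div_ne_zero (fun h' => ?_) hD
    have e1 : α * ((X b - X a) ^ 2 + (Y b - Y a) ^ 2) = 0 := by
      linear_combination (X b - X a) * key - (Y b - Y a) * h'
    have e2 : β * ((X b - X a) ^ 2 + (Y b - Y a) ^ 2) = 0 := by
      linear_combination (Y b - Y a) * key + (X b - X a) * h'
    rcases h0 with h0 | h0
    · exact (mul_ne_zero h0 hD) e1
    · exact (mul_ne_zero h0 hD) e2
  · intro z
    rw [hf]
    field_simp
    unfold cr
    linear_combination ((X b - X a) * (X z - X a) + (Y b - Y a) * (Y z - Y a)) * key +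
      ((X b - X a) ^ 2 + (Y b - Y a) ^ 2) * ha

/-- Three points on the zero line of an affine functional are collinear. -/
theorem IsAff.cr_eq_zero {h : Plane → ℝ} (hh : IsAff h) {a b c : Plane} (ha : h a = 0)
    (hb : h b = 0) (hc : h c = 0) : cr a b c = 0 := by
  by_cases hab : a = b
  · subst hab; simp
  obtain ⟨r, hr, hr'⟩ := hh.eq_cr hab ha hb
  rw [hr'] at hc
  exact (mul_eq_zero.1 hc).resolve_left hr

theorem eq_lineMap_of_cr_eq_zero {a b c : Plane} (hab : a ≠ b) (h : cr a b c = 0) :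
    ∃ t : ℝ, c = a + t • (b - a) := by
  have hne : X b - X a ≠ 0 ∨ Y b - Y a ≠ 0 := by
    by_contra! h'
    exact hab (ext_XY (by linarith [h'.1]) (by linarith [h'.2]))
  unfold cr at h
  rcases hne with h' | h'
  · refine ⟨(X c - X a) / (X b - X a), ext_XY ?_ ?_⟩
    · simp; field_simp; ring
    · simp; field_simp; linarith
  · refine ⟨(Y c - Y a) / (Y b - Y a), ext_XY ?_ ?_⟩
    · simp; field_simp; linarith
    · simp; field_simp; ring

/-! ### Convex hulls -/

theorem mem_convexHull_range {ι : Type*} [Fintype ι] {v : ι → Plane} {z : Plane}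
    (hz : z ∈ convexHull ℝ (Set.range v)) :
    ∃ l : ι → ℝ, (∀ i, 0 ≤ l i) ∧ ∑ i, l i = 1 ∧ z = ∑ i, l i • v i := by
  classical
  refine convexHull_min (t := {z | ∃ l : ι → ℝ, (∀ i, 0 ≤ l i) ∧ ∑ i, l i = 1 ∧
    z = ∑ i, l i • v i}) ?_ ?_ hz
  · rintro _ ⟨i, rfl⟩
    exact ⟨fun j => if j = i then 1 else 0, fun j => by dsimp only; split_ifs <;> norm_num,
      by simp, by simp⟩
  · rintro x ⟨l, hl, hl1, rfl⟩ y ⟨m, hm, hm1, rfl⟩ a b ha hb hab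
    refine ⟨fun i => a * l i + b * m i, fun i => by have := hl i; have := hm i; positivity, ?_, ?_⟩
    · rw [Finset.sum_add_distrib, ← Finset.mul_sum, ← Finset.mul_sum, hl1, hm1]; linarith
    · simp only [add_smul, Finset.sum_add_distrib, Finset.smul_sum, mul_smul]

theorem X_sum {ι : Type*} [Fintype ι] (l : ι → ℝ) (v : ι → Plane) :
    X (∑ i, l i • v i) = ∑ i, l i * X (v i) := by
  let f : Plane →ₗ[ℝ] ℝ := ⟨⟨X, X_add⟩, X_smul⟩
  exact (map_sum f (fun i => l i • v i) Finset.univ).trans (by simp [f])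

theorem Y_sum {ι : Type*} [Fintype ι] (l : ι → ℝ) (v : ι → Plane) :
    Y (∑ i, l i • v i) = ∑ i, l i * Y (v i) := by
  let f : Plane →ₗ[ℝ] ℝ := ⟨⟨Y, Y_add⟩, Y_smul⟩
  exact (map_sum f (fun i => l i • v i) Finset.univ).trans (by simp [f])

theorem mem_segment_iff_XY {a b z : Plane} : z ∈ segment ℝ a b ↔
    ∃ t : ℝ, 0 ≤ t ∧ t ≤ 1 ∧ X z = X a + t * (X b - X a) ∧ Y z = Y a + t * (Y b - Y a) := by
  rw [segment_eq_image']
  constructor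
  · rintro ⟨t, ⟨h0, h1⟩, rfl⟩
    exact ⟨t, h0, h1, by simp, by simp⟩
  · rintro ⟨t, h0, h1, hX, hY⟩
    exact ⟨t, ⟨h0, h1⟩, ext_XY (by simp [hX]) (by simp [hY])⟩

/-- A triangle is described by the three half-planes bounded by its sides. -/
theorem mem_triangle_iff {a b c : Plane} (h : 0 < cr a b c) {z : Plane} :
    z ∈ convexHull ℝ {a, b, c} ↔ 0 ≤ cr a b z ∧ 0 ≤ cr b c z ∧ 0 ≤ cr c a z := by
  have hab : a ≠ b := by rintro rfl; simp at h
  have hbc : b ≠ c := by rintro rfl; simp at h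
  have hca : c ≠ a := by rintro rfl; simp at h
  constructor
  · intro hz
    have h1 := cr_rot a b c
    have h2 := cr_rot b c a
    refine ⟨(isAff_cr hab).nonneg_of_mem_convexHull ?_ hz,
      (isAff_cr hbc).nonneg_of_mem_convexHull ?_ hz,
      (isAff_cr hca).nonneg_of_mem_convexHull ?_ hz⟩ <;>
    · intro w hw
      rcases hw with hw | hw | hw <;> rw [hw] <;>
        linarith [cr_self_right a b, cr_self_mid a b, cr_self_right b c, cr_self_mid b c,
          cr_self_right c a, cr_self_mid c a]
  · rintro ⟨h1, h2, h3⟩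
    -- the barycentric coordinates are ratios of areas
    have e : z = (cr b c z / cr a b c) • a + ((cr c a z / cr a b c) • b +
        (cr a b z / cr a b c) • c) := by
      refine ext_XY ?_ ?_
      · simp; field_simp; unfold cr; ring
      · simp; field_simp; unfold cr; ring
    have hs : cr b c z / cr a b c + (cr c a z / cr a b c + cr a b z / cr a b c) = 1 := by
      field_simp; unfold cr; ring
    have := (convex_convexHull ℝ ({a, b, c} : Set Plane)).sum_mem (t := Finset.univ)
      (w := ![cr b c z / cr a b c, cr c a z / cr a b c, cr a b z / cr a b c])
      (z := ![a, b, c]) ?_ ?_ ?_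
    · rw [e]; simpa [Fin.sum_univ_three, add_assoc] using this
    · intro i _; fin_cases i <;> simp <;> positivity
    · simpa [Fin.sum_univ_three, add_assoc] using hs
    · intro i _
      apply subset_convexHull
      fin_cases i <;> simp

/-! ### Lebesgue measure -/

/-- The area of a cell. -/
def cellVol : ENNReal := volume (convexHull ℝ {pt 0 0, pt 1 0, pt 0 1})

theorem null_line {h : Plane → ℝ} (hh : IsAff h) : volume {z | h z = 0} = 0 := by
  obtain ⟨α, β, γ, h0, hf⟩ := hh
  let S : AffineSubspace ℝ Plane :=
    { carrier := {z | α * X z + β * Y z + γ = 0}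
      smul_vsub_vadd_mem' := by
        intro c p q r hp hq hr
        simp only [Set.mem_ofPred_eq, vsub_eq_sub, vadd_eq_add, X_add, Y_add, X_smul, Y_smul,
          X_sub, Y_sub] at *
        linear_combination c * hp - c * hq + hr }
  have hS : S ≠ ⊤ := by
    intro hS
    have hm : ∀ z : Plane, α * X z + β * Y z + γ = 0 := fun z => by
      have : z ∈ S := by rw [hS]; trivial
      exact this
    have h1 := hm (pt 0 0)
    have h2 := hm (pt 1 0)
    have h3 := hm (pt 0 1)
    simp at h1 h2 h3
    rcases h0 with h0 | h0 <;> apply h0 <;> linarith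
  have := Measure.addHaar_affineSubspace volume S hS
  convert this using 2
  ext z
  simp only [Set.mem_ofPred_eq, hf]
  rfl

theorem volume_triangle (a b c : Plane) :
    volume (convexHull ℝ {a, b, c}) = ENNReal.ofReal |cr a b c| * cellVol := by
  let L : Plane →ₗ[ℝ] Plane :=
    { toFun := fun z => X z • (b - a) + Y z • (c - a)
      map_add' := fun z w => by simp [add_smul]; abel
      map_smul' := fun t z => by simp [mul_smul] }
  let B := Module.Basis.ofEquivFun coordEquiv
  have hB0 : B 0 = pt 1 0 := by simp [B, coordEquiv]
  have hB1 : B 1 = pt 0 1 := by simp [B, coordEquiv]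
  have hdet : LinearMap.det L = cr a b c := by
    rw [← LinearMap.det_toMatrix B, Matrix.det_fin_two]
    simp only [LinearMap.toMatrix_apply, hB0, hB1]
    simp [B, coordEquiv, L, cr]
  -- the triangle is the image of a cell under a linear map and a translation
  have himg : convexHull ℝ {a, b, c} = (fun z => a + z) '' (L '' convexHull ℝ
      {pt 0 0, pt 1 0, pt 0 1}) := by
    rw [L.image_convexHull, Set.image_insert_eq, Set.image_insert_eq, Set.image_singleton]
    have : (fun z => a + z) = (AffineEquiv.constVAdd ℝ Plane a).toAffineMap := by
      ext z; simp
    rw [this, AffineMap.image_convexHull, Set.image_insert_eq, Set.image_insert_eq,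
      Set.image_singleton]
    simp [L]
  rw [himg, Set.image_add_left, measure_preimage_add, Measure.addHaar_image_linearMap, hdet,
    cellVol]

theorem cellVol_ne_zero : cellVol ≠ 0 := by
  have h1 : (interior (convexHull ℝ {pt 0 0, pt 1 0, pt 0 1})).Nonempty := by
    refine ⟨pt (1/4) (1/4), mem_interior.2 ⟨{z | 0 < X z ∧ 0 < Y z ∧ X z + Y z < 1}, ?_, ?_, ?_⟩⟩
    · intro z hz
      rw [mem_triangle_iff (by simp [cr])]
      simp [cr]
      obtain ⟨h1, h2, h3⟩ := hz
      exact ⟨h2.le, by linarith, h1.le⟩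
    · exact (isOpen_lt continuous_const continuous_X).inter
        ((isOpen_lt continuous_const continuous_Y).inter
          (isOpen_lt (continuous_X.add continuous_Y) continuous_const))
    · norm_num
  exact (Measure.measure_pos_of_nonempty_interior volume h1).ne'

theorem cellVol_ne_top : cellVol ≠ ⊤ :=
  ((Set.toFinite {pt 0 0, pt 1 0, pt 0 1}).isCompact_convexHull (𝕜 := ℝ)).measure_lt_top.ne

/-! ### Cells in lattice coordinates -/

/-- The integer part of `X + Y` on the interior of a cell. -/
def Cell.diag (c : Cell) : ℤ := c.1 + c.2.1 + if c.2.2 then 1 else 0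

theorem Cell.triangle_up (i j : ℤ) :
    Cell.triangle (i, j, false) = convexHull ℝ {pt i j, pt (i + 1) j, pt i (j + 1)} := by
  simp [Cell.triangle, Cell.corners, Set.image_insert_eq, latticePoint_eq]

theorem Cell.triangle_down (i j : ℤ) :
    Cell.triangle (i, j, true) =
      convexHull ℝ {pt i (j + 1), pt (i + 1) j, pt (i + 1) (j + 1)} := by
  simp [Cell.triangle, Cell.corners, Set.image_insert_eq, latticePoint_eq, Set.insert_comm]

/-- Each cell is the intersection of one strip of unit width of each of the three directions. -/
theorem Cell.mem_triangle {c : Cell} {z : Plane} : z ∈ c.triangle ↔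
    ((c.1 : ℝ) ≤ X z ∧ X z ≤ c.1 + 1) ∧ ((c.2.1 : ℝ) ≤ Y z ∧ Y z ≤ c.2.1 + 1) ∧
      ((c.diag : ℝ) ≤ X z + Y z ∧ X z + Y z ≤ c.diag + 1) := by
  obtain ⟨i, j, b⟩ := c
  cases b
  · rw [Cell.triangle_up, mem_triangle_iff (by simp [cr])]
    simp only [cr, X_pt, Y_pt, Cell.diag]
    push_cast
    constructor
    · rintro ⟨h1, h2, h3⟩
      simp
      refine ⟨⟨?_, ?_⟩, ⟨?_, ?_⟩, ⟨?_, ?_⟩⟩ <;> linarith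
    · simp
      rintro h1 h2 h3 h4 h5 h6
      refine ⟨?_, ?_, ?_⟩ <;> linarith
  · rw [Cell.triangle_down, mem_triangle_iff (by simp [cr])]
    simp only [cr, X_pt, Y_pt, Cell.diag]
    push_cast
    constructor
    · rintro ⟨h1, h2, h3⟩
      refine ⟨⟨?_, ?_⟩, ⟨?_, ?_⟩, ⟨?_, ?_⟩⟩ <;> linarith
    · simp
      rintro h1 h2 h3 h4 h5 h6
      refine ⟨?_, ?_, ?_⟩ <;> linarith

/-- The points lying on a line of the tiling. -/
def OnGrid (z : Plane) : Prop := ∃ n : ℤ, X z = n ∨ Y z = n ∨ X z + Y z = n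

/-- The cells overlap only on the lines of the tiling. -/
theorem Cell.eq_of_mem {c d : Cell} {z : Plane} (hz : ¬ OnGrid z) (hc : z ∈ c.triangle)
    (hd : z ∈ d.triangle) : c = d := by
  rw [Cell.mem_triangle] at hc hd
  obtain ⟨⟨a1, a2⟩, ⟨a3, a4⟩, a5, a6⟩ := hc
  obtain ⟨⟨b1, b2⟩, ⟨b3, b4⟩, b5, b6⟩ := hd
  simp only [OnGrid, not_exists, not_or] at hz
  have key : ∀ (m n : ℤ) (x : ℝ), (∀ k : ℤ, x ≠ k) → (m : ℝ) ≤ x → x ≤ m + 1 → (n : ℝ) ≤ x →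
      x ≤ n + 1 → m = n := by
    intro m n x hx h1 h2 h3 h4
    have h2' : x < m + 1 := lt_of_le_of_ne h2 (by exact_mod_cast hx (m + 1))
    have h4' : x < n + 1 := lt_of_le_of_ne h4 (by exact_mod_cast hx (n + 1))
    rw [← Int.floor_eq_iff.2 ⟨h1, h2'⟩, Int.floor_eq_iff.2 ⟨h3, h4'⟩]
  have e1 := key _ _ _ (fun k => (hz k).1) a1 a2 b1 b2
  have e2 := key _ _ _ (fun k => (hz k).2.1) a3 a4 b3 b4
  have e3 := key _ _ _ (fun k => (hz k).2.2) a5 a6 b5 b6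
  obtain ⟨i, j, b⟩ := c
  obtain ⟨i', j', b'⟩ := d
  simp only [Cell.diag] at e1 e2 e3 ⊢
  subst e1 e2
  cases b <;> cases b' <;> simp_all

theorem Cell.exists_mem (z : Plane) : ∃ c : Cell, z ∈ c.triangle := by
  have h1 := Int.floor_le (X z)
  have h2 := Int.lt_floor_add_one (X z)
  have h3 := Int.floor_le (Y z)
  have h4 := Int.lt_floor_add_one (Y z)
  by_cases h : X z + Y z ≤ ⌊X z⌋ + ⌊Y z⌋ + 1
  · refine ⟨(⌊X z⌋, ⌊Y z⌋, false), ?_⟩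
    rw [Cell.mem_triangle]
    simp [Cell.diag]
    refine ⟨⟨?_, ?_⟩, ⟨?_, ?_⟩, ⟨?_, ?_⟩⟩ <;> linarith
  · refine ⟨(⌊X z⌋, ⌊Y z⌋, true), ?_⟩
    rw [Cell.mem_triangle]
    simp [Cell.diag]
    refine ⟨⟨?_, ?_⟩, ⟨?_, ?_⟩, ⟨?_, ?_⟩⟩ <;> linarith

theorem Cell.mem_interior {c : Cell} {z : Plane} (hz : ¬ OnGrid z) (hc : z ∈ c.triangle) :
    z ∈ interior c.triangle := by
  have hz' := hz
  rw [Cell.mem_triangle] at hc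
  obtain ⟨⟨a1, a2⟩, ⟨a3, a4⟩, a5, a6⟩ := hc
  simp only [OnGrid, not_exists, not_or] at hz
  refine _root_.mem_interior.2 ⟨{z | ((c.1 : ℝ) < X z ∧ X z < c.1 + 1) ∧
    ((c.2.1 : ℝ) < Y z ∧ Y z < c.2.1 + 1) ∧
      ((c.diag : ℝ) < X z + Y z ∧ X z + Y z < c.diag + 1)}, ?_, ?_, ?_⟩
  · rintro w ⟨⟨b1, b2⟩, ⟨b3, b4⟩, b5, b6⟩
    exact Cell.mem_triangle.2 ⟨⟨b1.le, b2.le⟩, ⟨b3.le, b4.le⟩, b5.le, b6.le⟩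
  · have hs := continuous_X.add continuous_Y
    exact ((isOpen_lt continuous_const continuous_X).inter
      (isOpen_lt continuous_X continuous_const)).inter
      (((isOpen_lt continuous_const continuous_Y).inter
      (isOpen_lt continuous_Y continuous_const)).inter
      ((isOpen_lt continuous_const hs).inter (isOpen_lt hs continuous_const)))
  · refine ⟨⟨lt_of_le_of_ne a1 (Ne.symm (hz _).1), lt_of_le_of_ne a2 ?_⟩,
      ⟨lt_of_le_of_ne a3 (Ne.symm (hz _).2.1), lt_of_le_of_ne a4 ?_⟩,
      lt_of_le_of_ne a5 (Ne.symm (hz _).2.2), lt_of_le_of_ne a6 ?_⟩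
    · exact_mod_cast (hz (c.1 + 1)).1
    · exact_mod_cast (hz (c.2.1 + 1)).2.1
    · exact_mod_cast (hz (c.diag + 1)).2.2

/-- The centre of a cell. -/
def Cell.center (c : Cell) : Plane :=
  pt (c.1 + if c.2.2 then 2 / 3 else 1 / 3) (c.2.1 + if c.2.2 then 2 / 3 else 1 / 3)

theorem Cell.center_mem (c : Cell) : c.center ∈ c.triangle := by
  obtain ⟨i, j, b⟩ := c
  rw [Cell.mem_triangle]
  cases b <;> simp [Cell.center, Cell.diag] <;> norm_num <;> constructor <;> linarith

theorem Cell.center_not_onGrid (c : Cell) : ¬ OnGrid c.center := by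
  obtain ⟨i, j, b⟩ := c
  rintro ⟨n, h⟩
  have key : ∀ p q : ℤ, (p : ℝ) = 3 * q + 1 ∨ (p : ℝ) = 3 * q + 2 → p % 3 ≠ 0 := by
    rintro p q (h | h)
    · have : p = 3 * q + 1 := by exact_mod_cast h
      omega
    · have : p = 3 * q + 2 := by exact_mod_cast h
      omega
  cases b <;> simp only [Cell.center, X_pt, Y_pt, if_true, if_false, Bool.false_eq_true] at h
  · rcases h with h | h | h
    · exact key (3 * n) i (Or.inl (by push_cast; linarith)) (by omega)
    · exact key (3 * n) j (Or.inl (by push_cast; linarith)) (by omega)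
    · exact key (3 * n) (i + j) (Or.inr (by push_cast; linarith)) (by omega)
  · rcases h with h | h | h
    · exact key (3 * n) i (Or.inr (by push_cast; linarith)) (by omega)
    · exact key (3 * n) j (Or.inr (by push_cast; linarith)) (by omega)
    · exact key (3 * n) (i + j + 1) (Or.inl (by push_cast; linarith)) (by omega)

theorem Cell.center_mem_iff {c d : Cell} :
    c.center ∈ d.triangle ↔ c = d :=
  ⟨fun h => Cell.eq_of_mem c.center_not_onGrid c.center_mem h, fun h => by
    subst h; exact c.center_mem⟩

theorem Cell.triangle_injective : Function.Injective Cell.triangle := fun c _ h =>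
  Cell.center_mem_iff.1 (h ▸ c.center_mem)

theorem Cell.center_mem_region {c : Cell} {T : Finset Cell} : c.center ∈ region T ↔ c ∈ T := by
  simp [region, Cell.center_mem_iff]

theorem Cell.triangle_convex (c : Cell) : Convex ℝ c.triangle := convex_convexHull ℝ _

theorem Cell.isCompact_triangle (c : Cell) : IsCompact c.triangle :=
  ((Finset.finite_toSet _).image _).isCompact_convexHull ℝ

/-! ### Area of a region -/

theorem null_onGrid : volume {z : Plane | OnGrid z} = 0 := by
  have : {z : Plane | OnGrid z} = ⋃ n : ℤ, ({z | X z - n = 0} ∪ ({z | Y z - n = 0} ∪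
      {z | X z + Y z - n = 0})) := by
    ext z
    simp [OnGrid, sub_eq_zero]
  rw [this, measure_iUnion_null_iff]
  intro n
  refine measure_union_null (null_line ⟨1, 0, -n, by simp, fun z => by ring⟩)
    (measure_union_null (null_line ⟨0, 1, -n, by simp, fun z => by ring⟩)
      (null_line ⟨1, 1, -n, by simp, fun z => by ring⟩))

theorem Cell.volume_triangle (c : Cell) : volume c.triangle = cellVol := by
  obtain ⟨i, j, b⟩ := c
  cases b
  · rw [Cell.triangle_up, Polyiamond.volume_triangle]
    simp [cr]
  · rw [Cell.triangle_down, Polyiamond.volume_triangle]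
    simp [cr]

theorem volume_region (T : Finset Cell) : volume (region T) = T.card * cellVol := by
  rw [region, measure_biUnion_finset₀]
  · simp [Cell.volume_triangle]
  · intro c _ d _ hcd
    refine measure_mono_null ?_ null_onGrid
    rintro z ⟨h1, h2⟩
    by_contra h
    exact hcd (Cell.eq_of_mem h h1 h2)
  · intro c _
    exact c.isCompact_triangle.measurableSet.nullMeasurableSet

theorem mem_interior_region {T : Finset Cell} {z : Plane} (hz : z ∈ region T) (h : ¬ OnGrid z) :
    z ∈ interior (region T) := by
  simp only [region, Set.mem_iUnion] at hz
  obtain ⟨c, hc, hz⟩ := hz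
  exact interior_mono (Set.subset_biUnion_of_mem (u := fun c : Cell => c.triangle)
    (Finset.mem_coe.2 hc)) (Cell.mem_interior h hz)

/-! ### Symmetries of the tiling -/

/-- A symmetry of the tiling: an isometry of the plane, together with the permutations of the
lattice points and of the cells that it induces. -/
structure LatticeSym where
  /-- The isometry of the plane. -/
  iso : Plane ≃ᵢ Plane
  /-- The permutation of the lattice points. -/
  latt : ℤ × ℤ ≃ ℤ × ℤ
  /-- The permutation of the cells. -/
  cell : Cell ≃ Cell
  iso_latticePoint : ∀ p, iso (latticePoint p) = latticePoint (latt p)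
  corners_cell : ∀ c, (cell c).corners = c.corners.image latt

namespace LatticeSym

/-- The identity. -/
def refl : LatticeSym where
  iso := IsometryEquiv.refl _
  latt := Equiv.refl _
  cell := Equiv.refl _
  iso_latticePoint _ := rfl
  corners_cell c := by simp

/-- The composition of two symmetries; the first argument is applied first. -/
def trans (g h : LatticeSym) : LatticeSym where
  iso := g.iso.trans h.iso
  latt := g.latt.trans h.latt
  cell := g.cell.trans h.cell
  iso_latticePoint p := by
    simp [IsometryEquiv.trans_apply, g.iso_latticePoint, h.iso_latticePoint]
  corners_cell c := by simp [g.corners_cell, h.corners_cell, Finset.image_image]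

/-- The inverse symmetry. -/
def symm (g : LatticeSym) : LatticeSym where
  iso := g.iso.symm
  latt := g.latt.symm
  cell := g.cell.symm
  iso_latticePoint p := by
    rw [← g.iso.injective.eq_iff, IsometryEquiv.apply_symm_apply, g.iso_latticePoint,
      Equiv.apply_symm_apply]
  corners_cell c := by
    have := g.corners_cell (g.cell.symm c)
    rw [Equiv.apply_symm_apply] at this
    rw [this, Finset.image_image]
    simp

@[simp] theorem trans_cell (g h : LatticeSym) (c : Cell) :
    (g.trans h).cell c = h.cell (g.cell c) := rfl

@[simp] theorem trans_iso (g h : LatticeSym) (z : Plane) :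
    (g.trans h).iso z = h.iso (g.iso z) := rfl

@[simp] theorem refl_cell (c : Cell) : refl.cell c = c := rfl

end LatticeSym

theorem IsometryEquiv.image_convexHull (e : Plane ≃ᵢ Plane) (s : Set Plane) :
    e '' convexHull ℝ s = convexHull ℝ (e '' s) := by
  have h : ⇑e = e.toRealAffineIsometryEquiv.toAffineEquiv.toAffineMap := by
    ext z; simp
  rw [h, AffineMap.image_convexHull]

namespace LatticeSym

theorem image_triangle (g : LatticeSym) (c : Cell) :
    g.iso '' c.triangle = (g.cell c).triangle := by
  rw [Cell.triangle, IsometryEquiv.image_convexHull, Cell.triangle, g.corners_cell,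
    Finset.coe_image, Set.image_image, Set.image_image]
  simp only [g.iso_latticePoint]

theorem samePiece (g : LatticeSym) (T : Finset Cell) : SamePiece T (T.map g.cell.toEmbedding) := by
  refine ⟨g.iso, ?_⟩
  simp only [g.image_triangle, Finset.coe_map, Set.image_image, Equiv.coe_toEmbedding]

theorem adj_iff (g : LatticeSym) (c d : Cell) :
    cellGraph.Adj (g.cell c) (g.cell d) ↔ cellGraph.Adj c d := by
  simp only [cellGraph, ne_eq, g.cell.injective.eq_iff, g.corners_cell]
  rw [← Finset.image_inter _ _ g.latt.injective, Finset.card_image_of_injective _ g.latt.injective]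

end LatticeSym

/-- The isometry given by a surjective self-map `f` of the plane that preserves the norm form; `g`
is a right inverse of `f`. -/
def isoOfCoords (f g : Plane → Plane) (hfg : ∀ z, f (g z) = z)
    (hf : ∀ z w, nsq (f z - f w) = nsq (z - w)) : Plane ≃ᵢ Plane :=
  IsometryEquiv.mk' f g hfg (Isometry.of_dist_eq fun z w => nsq_eq_iff_dist.1 (hf z w))

@[simp] theorem isoOfCoords_apply (f g : Plane → Plane) (hfg : ∀ z, f (g z) = z)
    (hf : ∀ z w, nsq (f z - f w) = nsq (z - w)) (z : Plane) :
    isoOfCoords f g hfg hf z = f z := rfl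

/-- Rotation by 60 degrees about the origin, on cells. -/
def rotCell : Cell → Cell
  | (i, j, false) => (-j - 1, i + j, true)
  | (i, j, true) => (-j - 1, i + j + 1, false)

/-- Rotation by -60 degrees about the origin, on cells. -/
def rotCellInv : Cell → Cell
  | (i, j, false) => (i + j, -i - 1, true)
  | (i, j, true) => (i + j + 1, -i - 1, false)

/-- The reflection exchanging the two lattice coordinates, on cells. -/
def swapCell : Cell → Cell
  | (i, j, b) => (j, i, b)

/-- Translations, on cells. -/
def shiftCell (a b : ℤ) (c : Cell) : Cell := (c.1 + a, c.2.1 + b, c.2.2)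

namespace LatticeSym

/-- Rotation by 60 degrees about the origin. -/
def rot : LatticeSym where
  iso := isoOfCoords (fun z => pt (-Y z) (X z + Y z)) (fun z => pt (X z + Y z) (-X z))
    (fun z => ext_XY (by simp) (by simp)) (fun z w => by
      simp only [nsq, X_sub, Y_sub, X_pt, Y_pt]; ring)
  latt := ⟨fun p => (-p.2, p.1 + p.2), fun p => (p.1 + p.2, -p.1), fun p => by simp,
    fun p => by simp⟩
  cell := ⟨rotCell, rotCellInv, fun c => by
    obtain ⟨i, j, b⟩ := c
    cases b
    · simp [rotCell, rotCellInv]; ring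
    · simp [rotCell, rotCellInv], fun c => by
    obtain ⟨i, j, b⟩ := c
    cases b
    · simp [rotCell, rotCellInv]; ring
    · simp [rotCell, rotCellInv]⟩
  iso_latticePoint p := by
    simp [latticePoint_eq]
  corners_cell c := by
    obtain ⟨i, j, b⟩ := c
    cases b <;>
    · ext ⟨x, y⟩
      simp [Cell.corners, rotCell]
      omega

/-- The reflection exchanging the two lattice coordinates. -/
def swap : LatticeSym where
  iso := isoOfCoords (fun z => pt (Y z) (X z)) (fun z => pt (Y z) (X z))
    (fun z => ext_XY (by simp) (by simp)) (fun z w => by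
      simp only [nsq, X_sub, Y_sub, X_pt, Y_pt]; ring)
  latt := ⟨fun p => (p.2, p.1), fun p => (p.2, p.1), fun _ => rfl, fun _ => rfl⟩
  cell := ⟨swapCell, swapCell, fun c => rfl, fun c => rfl⟩
  iso_latticePoint p := by
    simp [latticePoint_eq]
  corners_cell c := by
    obtain ⟨i, j, b⟩ := c
    cases b <;>
    · ext ⟨x, y⟩
      change (x, y) ∈ Cell.corners (j, i, _) ↔ _
      simp [Cell.corners]
      omega

/-- Translation by a lattice vector. -/
def shift (a b : ℤ) : LatticeSym where
  iso := isoOfCoords (fun z => pt (X z + a) (Y z + b)) (fun z => pt (X z - a) (Y z - b))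
    (fun z => ext_XY (by simp) (by simp)) (fun z w => by
      simp only [nsq, X_sub, Y_sub, X_pt, Y_pt]; ring)
  latt := ⟨fun p => (p.1 + a, p.2 + b), fun p => (p.1 - a, p.2 - b), fun p => by simp,
    fun p => by simp⟩
  cell := ⟨shiftCell a b, shiftCell (-a) (-b), fun c => by simp [shiftCell],
    fun c => by simp [shiftCell]⟩
  iso_latticePoint p := by
    simp [latticePoint_eq]
  corners_cell c := by
    obtain ⟨i, j, b⟩ := c
    cases b <;>
    · ext ⟨x, y⟩
      simp [Cell.corners, shiftCell]
      omega

theorem rot_iso (z : Plane) : rot.iso z = pt (-Y z) (X z + Y z) := rfl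
theorem swap_iso (z : Plane) : swap.iso z = pt (Y z) (X z) := rfl
theorem shift_iso (a b : ℤ) (z : Plane) : (shift a b).iso z = pt (X z + a) (Y z + b) := rfl
@[simp] theorem rot_cell (c : Cell) : rot.cell c = rotCell c := rfl
@[simp] theorem swap_cell (c : Cell) : swap.cell c = swapCell c := rfl
@[simp] theorem shift_cell (a b : ℤ) (c : Cell) : (shift a b).cell c = shiftCell a b c := rfl

end LatticeSym

/-! ### Adjacency -/

/-- The three cells sharing an edge with a given cell. -/
def nbrs : Cell → List Cell
  | (i, j, false) => [(i, j, true), (i - 1, j, true), (i, j - 1, true)]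
  | (i, j, true) => [(i, j, false), (i + 1, j, false), (i, j + 1, false)]

theorem adj_iff_mem_nbrs {c d : Cell} : cellGraph.Adj c d ↔ d ∈ nbrs c := by
  constructor
  · rintro ⟨hne, h⟩
    obtain ⟨p, q, hpq, hs⟩ := Finset.card_eq_two.1 h
    have hp : p ∈ c.corners ∩ d.corners := by rw [hs]; simp
    have hq : q ∈ c.corners ∩ d.corners := by rw [hs]; simp
    obtain ⟨i, j, b⟩ := c
    obtain ⟨i', j', b'⟩ := d
    obtain ⟨p1, p2⟩ := p
    obtain ⟨q1, q2⟩ := q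
    cases b <;> cases b' <;> simp [Cell.corners, nbrs] at hp hq hne hpq ⊢ <;> omega
  · intro h
    obtain ⟨i, j, b⟩ := c
    cases b <;> simp only [nbrs, List.mem_cons, List.not_mem_nil, or_false] at h <;>
      rcases h with rfl | rfl | rfl <;> refine ⟨by simp, ?_⟩
    · rw [show Cell.corners (i, j, false) ∩ Cell.corners (i, j, true) = {(i + 1, j), (i, j + 1)} by
        ext ⟨x, y⟩; simp [Cell.corners]]
      exact Finset.card_pair (by simp)
    · rw [show Cell.corners (i, j, false) ∩ Cell.corners (i - 1, j, true) = {(i, j), (i, j + 1)} by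
        ext ⟨x, y⟩; simp [Cell.corners]]
      exact Finset.card_pair (by simp)
    · rw [show Cell.corners (i, j, false) ∩ Cell.corners (i, j - 1, true) = {(i, j), (i + 1, j)} by
        ext ⟨x, y⟩; simp [Cell.corners]]
      exact Finset.card_pair (by simp)
    · rw [show Cell.corners (i, j, true) ∩ Cell.corners (i, j, false) = {(i + 1, j), (i, j + 1)} by
        ext ⟨x, y⟩; simp [Cell.corners]]
      exact Finset.card_pair (by simp)
    · rw [show Cell.corners (i, j, true) ∩ Cell.corners (i + 1, j, false) =
        {(i + 1, j), (i + 1, j + 1)} by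
        ext ⟨x, y⟩; simp [Cell.corners]]
      exact Finset.card_pair (by simp)
    · rw [show Cell.corners (i, j, true) ∩ Cell.corners (i, j + 1, false) =
        {(i, j + 1), (i + 1, j + 1)} by
        ext ⟨x, y⟩; simp [Cell.corners]]
      exact Finset.card_pair (by simp)

/-! ### Connected sets of cells -/

/-- Polyiamonds with a given number of cells. -/
def IsPolyiamond (n : ℕ) (T : Finset Cell) : Prop :=
  T.card = n ∧ (cellGraph.induce (T : Set Cell)).Connected

theorem isPolyiamond_singleton (c : Cell) : IsPolyiamond 1 {c} := by
  refine ⟨Finset.card_singleton c, ?_⟩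
  rw [Finset.coe_singleton]
  have : Subsingleton ({c} : Set Cell) := Set.subsingleton_coe _ |>.2 Set.subsingleton_singleton
  have : Nonempty ({c} : Set Cell) := ⟨⟨c, rfl⟩⟩
  exact ⟨SimpleGraph.Preconnected.of_subsingleton⟩

theorem IsPolyiamond.insert {n : ℕ} {T : Finset Cell} (hT : IsPolyiamond n T) {c d : Cell}
    (hc : c ∉ T) (hd : d ∈ T) (hcd : cellGraph.Adj d c) : IsPolyiamond (n + 1) (insert c T) := by
  refine ⟨by rw [Finset.card_insert_of_notMem hc, hT.1], ?_⟩
  have h2 : (cellGraph.induce ({d, c} : Set Cell)).Connected :=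
    SimpleGraph.induce_pair_connected_of_adj hcd
  have e : ((Insert.insert c T : Finset Cell) : Set Cell) = (T : Set Cell) ∪ {d, c} := by
    ext x
    simp only [Finset.coe_insert, Set.mem_insert_iff, Finset.mem_coe, Set.mem_union,
      Set.mem_singleton_iff]
    constructor
    · rintro (h | h) <;> simp [h]
    · rintro (h | h | h)
      · exact Or.inr h
      · exact Or.inr (h ▸ hd)
      · exact Or.inl h
  rw [e]
  exact SimpleGraph.induce_union_connected hT.2.preconnected h2.preconnected
    ⟨d, Finset.mem_coe.2 hd, Set.mem_insert _ _⟩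

/-- A polyiamond with at least two cells arises from a smaller one by adding a cell, because a
finite connected graph has a vertex whose removal leaves it connected. -/
theorem IsPolyiamond.exists_erase {n : ℕ} {T : Finset Cell} (hT : IsPolyiamond (n + 2) T) :
    ∃ c ∈ T, IsPolyiamond (n + 1) (T.erase c) ∧ ∃ d ∈ T.erase c, cellGraph.Adj d c := by
  classical
  have : Nontrivial (T : Set Cell) := by
    rw [Set.nontrivial_coe_sort]
    exact Finset.one_lt_card_iff_nontrivial.1 (by rw [hT.1]; omega)
  obtain ⟨c, hc⟩ := hT.2.exists_connected_induce_compl_singleton_of_finite_nontrivial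
  obtain ⟨d, hd⟩ := hT.2.preconnected.exists_adj_of_nontrivial c
  refine ⟨c, c.2, ⟨by rw [Finset.card_erase_of_mem c.2, hT.1]; rfl, ?_⟩, d, ?_, ?_⟩
  · let φ : (cellGraph.induce (T : Set Cell)).induce ({c}ᶜ : Set (T : Set Cell)) ≃g
        cellGraph.induce ((T.erase c : Finset Cell) : Set Cell) :=
      { toFun := fun x => ⟨x.1.1, by
          have h1 := x.1.2
          have h2 : x.1 ≠ c := x.2
          simp only [Finset.coe_erase, Set.mem_sdiff, Set.mem_singleton_iff]
          exact ⟨h1, fun h => h2 (Subtype.ext h)⟩⟩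
        invFun := fun x => ⟨⟨x.1, Finset.mem_of_mem_erase x.2⟩, fun h =>
          Finset.ne_of_mem_erase x.2 (congrArg Subtype.val h)⟩
        left_inv := fun x => rfl
        right_inv := fun x => rfl
        map_rel_iff' := Iff.rfl }
    exact (SimpleGraph.Iso.connected_iff φ).1 hc
  · exact Finset.mem_erase.2 ⟨fun h => hd.ne (Subtype.ext h.symm), d.2⟩
  · exact hd.symm

/-! ### A metric invariant of pieces -/

/-- Nine times the squared distance between the centres of two cells. -/
def cellDist (c d : Cell) : ℤ :=
  let x := 3 * (c.1 - d.1) + (if c.2.2 then 1 else 0) - (if d.2.2 then 1 else 0)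
  let y := 3 * (c.2.1 - d.2.1) + (if c.2.2 then 1 else 0) - (if d.2.2 then 1 else 0)
  x * x + x * y + y * y

theorem cellDist_eq (c d : Cell) : (cellDist c d : ℝ) = 9 * nsq (c.center - d.center) := by
  obtain ⟨i, j, b⟩ := c
  obtain ⟨i', j', b'⟩ := d
  cases b <;> cases b' <;> simp [cellDist, nsq, Cell.center] <;> ring

/-- The centre of a cell is the only point whose distance to all points of the cell is at most
`1 / √3`. -/
theorem Cell.center_unique {c : Cell} {z : Plane} :
    (∀ w ∈ c.triangle, nsq (w - z) ≤ 1 / 3) ↔ z = c.center := by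
  have hcor : ∀ p ∈ c.corners, latticePoint p ∈ c.triangle := fun p hp =>
    subset_convexHull ℝ _ ⟨p, hp, rfl⟩
  constructor
  · intro h
    rw [← sub_eq_zero]
    apply nsq_eq_zero
    apply le_antisymm _ (nsq_nonneg _)
    obtain ⟨i, j, b⟩ := c
    -- the sum of the squared distances to the corners is least at the centre
    cases b
    · have h1 := h _ (hcor (i, j) (by simp [Cell.corners]))
      have h2 := h _ (hcor (i + 1, j) (by simp [Cell.corners]))
      have h3 := h _ (hcor (i, j + 1) (by simp [Cell.corners]))
      simp [nsq, latticePoint_eq, Cell.center] at h1 h2 h3 ⊢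
      linarith
    · have h1 := h _ (hcor (i + 1, j) (by simp [Cell.corners]))
      have h2 := h _ (hcor (i, j + 1) (by simp [Cell.corners]))
      have h3 := h _ (hcor (i + 1, j + 1) (by simp [Cell.corners]))
      simp [nsq, latticePoint_eq, Cell.center] at h1 h2 h3 ⊢
      linarith
  · rintro rfl w hw
    have hball : c.triangle ⊆ Metric.closedBall c.center (√(1 / 3)) := by
      refine convexHull_min ?_ (convex_closedBall _ _)
      rintro _ ⟨p, hp, rfl⟩
      rw [Metric.mem_closedBall]
      apply Real.le_sqrt_of_sq_le
      rw [dist_sq_eq]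
      obtain ⟨i, j, b⟩ := c
      cases b <;> simp only [Cell.corners, Finset.coe_insert, Finset.coe_singleton,
        Set.mem_insert_iff, Set.mem_singleton_iff] at hp <;> rcases hp with rfl | rfl | rfl <;>
        simp [nsq, latticePoint_eq, Cell.center] <;> ring_nf <;> rfl
    have := Metric.mem_closedBall.1 (hball hw)
    rw [← dist_sq_eq]
    calc dist w c.center ^ 2 ≤ √(1 / 3) ^ 2 := by gcongr
      _ = 1 / 3 := Real.sq_sqrt (by norm_num)

/-- An isometry carrying a cell to a cell carries the centre to the centre, since the centre is
determined by distances. The isometry is not assumed to preserve the tiling. -/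
theorem iso_center (e : Plane ≃ᵢ Plane) {c d : Cell} (h : e '' c.triangle = d.triangle) :
    e c.center = d.center := by
  rw [← Cell.center_unique, ← h]
  rintro _ ⟨w, hw, rfl⟩
  rw [← dist_sq_eq, e.dist_eq, dist_sq_eq]
  exact Cell.center_unique.2 rfl w hw

/-- A numerical invariant of pieces, formed from the distances between the centres of the cells.
The exponents are such that it distinguishes the heptiamonds, see `pieceInv_reps`. -/
def pieceInv (T : Finset Cell) : ℤ := ∑ c ∈ T, (∑ d ∈ T, cellDist c d ^ 2) ^ 2

theorem pieceInv_eq {T T' : Finset Cell} (h : SamePiece T T') : pieceInv T = pieceInv T' := by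
  classical
  obtain ⟨e, he⟩ := h
  have h1 : ∀ c ∈ T, ∃ d ∈ T', e '' c.triangle = d.triangle := fun c hc => by
    have : e '' c.triangle ∈ Cell.triangle '' (T' : Set Cell) := he ▸ ⟨c, hc, rfl⟩
    obtain ⟨d, hd, hd'⟩ := this
    exact ⟨d, hd, hd'.symm⟩
  -- the bijection between the cells that the isometry induces
  choose! φ hφ hφ' using h1
  have hinj : Set.InjOn φ T := fun c hc d hd hcd => by
    apply Cell.triangle_injective
    apply e.injective.image_injective
    rw [hφ' c hc, hφ' d hd, hcd]
  have hT' : T' = T.image φ := by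
    ext d
    constructor
    · intro hd
      have : d.triangle ∈ (fun c => e '' Cell.triangle c) '' (T : Set Cell) := he ▸ ⟨d, hd, rfl⟩
      obtain ⟨c, hc, hcd⟩ := this
      refine Finset.mem_image.2 ⟨c, hc, Cell.triangle_injective ?_⟩
      rw [← hφ' c hc, ← hcd]
    · intro hd
      obtain ⟨c, hc, rfl⟩ := Finset.mem_image.1 hd
      exact hφ c hc
  have hD : ∀ c ∈ T, ∀ d ∈ T, cellDist (φ c) (φ d) = cellDist c d := fun c hc d hd => by
    have : (cellDist (φ c) (φ d) : ℝ) = cellDist c d := by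
      rw [cellDist_eq, cellDist_eq, ← iso_center e (hφ' c hc), ← iso_center e (hφ' d hd),
        ← dist_sq_eq, ← dist_sq_eq, e.dist_eq]
    exact_mod_cast this
  rw [pieceInv, pieceInv, hT', Finset.sum_image hinj]
  refine Finset.sum_congr rfl fun c hc => ?_
  rw [Finset.sum_image hinj]
  congr 1
  exact Finset.sum_congr rfl fun d hd => by rw [hD c hc d hd]

/-! ### Enumeration of the heptiamonds -/

/-- Representatives of the polyiamonds with at most seven cells, one from each congruence class.
Each representative lists its cells in such an order that all but the first are adjacent to an
earlier one. -/
def reps : ℕ → List (List Cell)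
  | 1 => [
    [(0, 0, false)]]
  | 2 => [
    [(0, 0, false), (0, 0, true)]]
  | 3 => [
    [(0, 0, false), (0, 0, true), (0, 1, false)]]
  | 4 => [
    [(0, 0, false), (0, 0, true), (0, 1, false), (0, 1, true)],
    [(0, 0, false), (0, 0, true), (0, 1, false), (1, 0, false)],
    [(0, 0, true), (0, 1, false), (0, 1, true), (1, 0, false)]]
  | 5 => [
    [(0, 0, false), (0, 0, true), (0, 1, false), (0, 1, true), (0, 2, false)],
    [(0, 0, false), (0, 0, true), (0, 1, false), (0, 1, true), (1, 0, false)],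
    [(0, 0, false), (0, 0, true), (0, 1, false), (0, 1, true), (1, 1, false)],
    [(0, 0, true), (0, 1, false), (0, 1, true), (1, 0, false), (1, 0, true)]]
  | 6 => [
    [(0, 0, false), (0, 0, true), (0, 1, false), (0, 1, true), (0, 2, false), (0, 2, true)],
    [(0, 0, false), (0, 0, true), (0, 1, false), (0, 1, true), (0, 2, false), (1, 0, false)],
    [(0, 0, false), (0, 0, true), (0, 1, false), (0, 1, true), (1, 0, false), (1, 0, true)],
    [(0, 0, false), (0, 0, true), (0, 1, false), (0, 1, true), (1, 0, false), (1, 1, false)],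
    [(0, 0, false), (0, 0, true), (0, 1, false), (0, 1, true), (1, 1, false), (1, 0, true)],
    [(0, 0, false), (0, 0, true), (0, 1, false), (0, 1, true), (1, 1, false), (1, 1, true)],
    [(0, 0, true), (0, 1, false), (0, 1, true), (0, 2, false), (0, 2, true), (1, 0, false)],
    [(0, 0, true), (0, 1, false), (0, 1, true), (0, 2, false), (0, 2, true), (1, 1, false)],
    [(0, 0, true), (0, 1, false), (0, 1, true), (0, 2, false), (1, 1, false), (1, 1, true)],
    [(0, 0, true), (0, 1, false), (0, 1, true), (1, 0, false), (1, 0, true), (1, 1, false)],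
    [(0, 0, true), (0, 1, false), (0, 1, true), (1, 1, false), (1, 1, true), (1, 2, false)],
    [(0, 1, false), (0, 1, true), (0, 2, false), (1, 1, false), (1, 0, true), (1, 1, true)]]
  | 7 => [
    [(0, 0, false), (0, 0, true), (0, 1, false), (0, 1, true), (0, 2, false), (0, 2, true), (0, 3, false)],
    [(0, 0, false), (0, 0, true), (0, 1, false), (0, 1, true), (0, 2, false), (0, 2, true), (1, 0, false)],
    [(0, 0, false), (0, 0, true), (0, 1, false), (0, 1, true), (0, 2, false), (0, 2, true), (1, 1, false)],
    [(0, 0, false), (0, 0, true), (0, 1, false), (0, 1, true), (0, 2, false), (0, 2, true), (1, 2, false)],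
    [(0, 0, false), (0, 0, true), (0, 1, false), (0, 1, true), (0, 2, false), (1, 0, false), (1, 0, true)],
    [(0, 0, false), (0, 0, true), (0, 1, false), (0, 1, true), (0, 2, false), (1, 0, false), (1, 1, false)],
    [(0, 0, false), (0, 0, true), (0, 1, false), (0, 1, true), (0, 2, false), (1, 1, false), (1, 1, true)],
    [(0, 0, false), (0, 0, true), (0, 1, false), (0, 1, true), (1, 0, false), (1, 0, true), (1, 1, false)],
    [(0, 0, false), (0, 0, true), (0, 1, false), (0, 1, true), (1, 0, false), (1, 1, false), (1, 1, true)],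
    [(0, 0, false), (0, 0, true), (0, 1, false), (0, 1, true), (1, 1, false), (1, 0, true), (2, 0, false)],
    [(0, 0, false), (0, 0, true), (0, 1, false), (0, 1, true), (1, 1, false), (1, 1, true), (1, 2, false)],
    [(0, 0, false), (0, 0, true), (0, 1, false), (0, 1, true), (1, 1, false), (1, 1, true), (2, 1, false)],
    [(0, 0, true), (0, 1, false), (0, 1, true), (0, 2, false), (0, 2, true), (1, 0, false), (1, 0, true)],
    [(0, 0, true), (0, 1, false), (0, 1, true), (0, 2, false), (0, 2, true), (1, 0, false), (1, 1, false)],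
    [(0, 0, true), (0, 1, false), (0, 1, true), (0, 2, false), (0, 2, true), (1, 0, false), (1, 2, false)],
    [(0, 0, true), (0, 1, false), (0, 1, true), (0, 2, false), (0, 2, true), (1, 1, false), (1, 0, true)],
    [(0, 0, true), (0, 1, false), (0, 1, true), (0, 2, false), (1, 0, false), (1, 1, false), (1, 1, true)],
    [(0, 0, true), (0, 1, false), (0, 1, true), (0, 2, false), (1, 1, false), (1, 0, true), (1, 1, true)],
    [(0, 0, true), (0, 1, false), (0, 1, true), (0, 2, false), (1, 1, false), (1, 1, true), (1, 2, false)],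
    [(0, 0, true), (0, 1, false), (0, 1, true), (0, 2, false), (1, 1, false), (1, 1, true), (2, 1, false)],
    [(0, 0, true), (0, 1, false), (0, 1, true), (1, 1, false), (1, 1, true), (1, 2, false), (0, 2, true)],
    [(0, 0, true), (0, 1, false), (0, 1, true), (1, 1, false), (1, 1, true), (1, 2, false), (2, 1, false)],
    [(0, 1, false), (0, 1, true), (0, 2, false), (1, 1, false), (1, 0, true), (1, 1, true), (2, 0, false)],
    [(0, 1, false), (0, 1, true), (1, 1, false), (1, 0, true), (1, 1, true), (1, 2, false), (2, 0, false)]]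
  | _ => []

/-- The images of a list of cells under the twelve symmetries of the tiling fixing the origin. -/
def orientations (A : List Cell) : List (List Cell) :=
  let rots := fun (A : List Cell) =>
    [A, A.map rotCell, A.map (rotCell^[2]), A.map (rotCell^[3]), A.map (rotCell^[4]),
      A.map (rotCell^[5])]
  rots A ++ rots (A.map swapCell)

/-- The least first and second coordinates of the cells of a list. The initial value `(100, 100)`
exceeds all coordinates to which this is applied. -/
def lowerLeft (A : List Cell) : ℤ × ℤ :=
  A.foldr (fun c p => (min c.1 p.1, min c.2.1 p.2)) (100, 100)

/-- Whether the translation aligning the lower left corners of two lists of cells carries the first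
into the second. -/
def shiftEq (A B : List Cell) : Bool :=
  let p := lowerLeft A
  let q := lowerLeft B
  A.all fun c => B.contains (shiftCell (q.1 - p.1) (q.2 - p.2) c)

/-- Whether a list of cells can be moved into a member of `L` by a symmetry of the tiling. -/
def matchesRep (L : List (List Cell)) (A : List Cell) : Bool :=
  (orientations A).any fun A' => L.any fun B => shiftEq A' B

theorem toFinset_map_equiv (e : Cell ≃ Cell) (A : List Cell) :
    (A.map e).toFinset = A.toFinset.map e.toEmbedding := by
  ext c
  simp only [List.mem_toFinset, List.mem_map, Finset.mem_map, Equiv.coe_toEmbedding]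

/-- Whether every one-cell extension of a member of `L` can be moved onto a member of `L'`. -/
def extendsTo (L L' : List (List Cell)) : Bool :=
  L.all fun r => (r.flatMap nbrs).all fun d => r.contains d || matchesRep L' (d :: r)

/-- The finite computation behind `exists_rep`: adding a cell to a representative with `n` cells
gives, up to a symmetry of the tiling, a representative with `n + 1` cells. -/
theorem extendsTo_reps : ∀ n < 6, extendsTo (reps (n + 1)) (reps (n + 2)) = true := by
  decide +kernel

theorem reps_nodup_length : ∀ n < 8, ∀ r ∈ reps n, r.Nodup ∧ r.length = n := by decide +kernel

theorem shiftEq_sound {A B : List Cell} (h : shiftEq A B = true) (hA : A.Nodup)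
    (hAB : B.length = A.length) :
    ∃ g : LatticeSym, A.toFinset.map g.cell.toEmbedding = B.toFinset := by
  simp only [shiftEq, List.all_eq_true, List.contains_iff_mem] at h
  refine ⟨LatticeSym.shift ((lowerLeft B).1 - (lowerLeft A).1) ((lowerLeft B).2 - (lowerLeft A).2),
    Finset.eq_of_subset_of_card_le ?_ ?_⟩
  · intro c hc
    obtain ⟨d, hd, rfl⟩ := Finset.mem_map.1 hc
    exact List.mem_toFinset.2 (h d (List.mem_toFinset.1 hd))
  · rw [Finset.card_map, List.toFinset_card_of_nodup hA, ← hAB]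
    exact List.toFinset_card_le B

theorem orientations_sound {A A' : List Cell} (h : A' ∈ orientations A) :
    ∃ g : LatticeSym, A' = A.map g.cell := by
  have key : ∀ A : List Cell, A' ∈ [A, A.map rotCell, A.map (rotCell^[2]), A.map (rotCell^[3]),
      A.map (rotCell^[4]), A.map (rotCell^[5])] → ∃ g : LatticeSym, A' = A.map g.cell := by
    intro A h
    simp only [List.mem_cons, List.not_mem_nil, or_false] at h
    let r := LatticeSym.rot
    rcases h with h | h | h | h | h | h
    · exact ⟨LatticeSym.refl, by rw [h]; exact (List.map_id A).symm⟩
    · exact ⟨r, h⟩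
    · exact ⟨r.trans r, h⟩
    · exact ⟨(r.trans r).trans r, h⟩
    · exact ⟨((r.trans r).trans r).trans r, h⟩
    · exact ⟨(((r.trans r).trans r).trans r).trans r, h⟩
  rcases List.mem_append.1 h with h | h
  · exact key A h
  · obtain ⟨g, hg⟩ := key _ h
    exact ⟨LatticeSym.swap.trans g, by rw [hg, List.map_map]; rfl⟩

theorem matchesRep_sound {L : List (List Cell)} {A : List Cell} (h : matchesRep L A = true)
    (hA : A.Nodup) (hL : ∀ B ∈ L, B.length = A.length) :
    ∃ B ∈ L, ∃ g : LatticeSym, A.toFinset.map g.cell.toEmbedding = B.toFinset := by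
  simp only [matchesRep, List.any_eq_true] at h
  obtain ⟨A', hA', B, hB, hAB⟩ := h
  obtain ⟨g, rfl⟩ := orientations_sound hA'
  obtain ⟨g', hg'⟩ := shiftEq_sound hAB (hA.map g.cell.injective) (by rw [hL B hB, List.length_map])
  refine ⟨B, hB, g.trans g', ?_⟩
  rw [← hg', ← toFinset_map_equiv, ← toFinset_map_equiv, List.map_map]
  rfl

/-- Every polyiamond with at most seven cells can be moved onto a representative, by induction on
the number of cells: one cell is removed so that the rest stays connected. -/
theorem exists_rep (n : ℕ) (hn : n < 7) (T : Finset Cell) (hT : IsPolyiamond (n + 1) T) :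
    ∃ r ∈ reps (n + 1), ∃ g : LatticeSym, T.map g.cell.toEmbedding = r.toFinset := by
  induction n generalizing T with
  | zero =>
    obtain ⟨⟨i, j, b⟩, rfl⟩ := Finset.card_eq_one.1 hT.1
    refine ⟨[(0, 0, false)], by simp [reps], ?_⟩
    cases b
    · exact ⟨LatticeSym.shift (-i) (-j), by simp [shiftCell]⟩
    · exact ⟨LatticeSym.rot.trans (LatticeSym.shift (j + 1) (-i - j - 1)), by
        simp [shiftCell, rotCell]⟩
  | succ n ih =>
    obtain ⟨c, hc, hT', d, hd, hdc⟩ := hT.exists_erase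
    obtain ⟨r, hr, g, hg⟩ := ih (by omega) _ hT'
    have h1 : g.cell c ∉ r := by
      rw [← List.mem_toFinset, ← hg]
      simp
    have h2 : g.cell d ∈ r := by
      rw [← List.mem_toFinset, ← hg]
      simpa using hd
    have h3 : g.cell c ∈ nbrs (g.cell d) := adj_iff_mem_nbrs.1 ((g.adj_iff d c).2 hdc)
    have hr' := reps_nodup_length (n + 1) (by omega) r hr
    have h4 := extendsTo_reps n (by omega)
    simp only [extendsTo, List.all_eq_true] at h4
    have h5 := h4 r hr (g.cell c) (List.mem_flatMap.2 ⟨_, h2, h3⟩)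
    simp only [Bool.or_eq_true, List.contains_iff_mem, h1, false_or] at h5
    obtain ⟨B, hB, g', hg'⟩ := matchesRep_sound h5 (List.nodup_cons.2 ⟨h1, hr'.1⟩) (fun B hB => by
      rw [(reps_nodup_length (n + 2) (by omega) B hB).2, List.length_cons, hr'.2])
    refine ⟨B, hB, g.trans g', ?_⟩
    rw [← hg', List.toFinset_cons, ← hg]
    ext x
    simp only [Finset.mem_map_equiv, Finset.mem_insert, Finset.mem_erase]
    constructor
    · intro h
      by_cases hx : g'.cell.symm x = g.cell c
      · exact Or.inl hx
      · refine Or.inr ⟨fun h' => hx ?_, h⟩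
        rw [← h', Equiv.apply_symm_apply]
    · rintro (h | h)
      · rw [show (g.trans g').cell.symm x = g.cell.symm (g'.cell.symm x) from rfl, h,
          Equiv.symm_apply_apply]
        exact hc
      · exact h.2

/-- Whether a list of distinct cells arises, from its end, by successively adding adjacent cells. -/
def isGrown : List Cell → Bool
  | [] => false
  | [_] => true
  | c :: d :: A => !(d :: A).contains c && (nbrs c).any (fun x => (d :: A).contains x) &&
      isGrown (d :: A)

theorem isGrown_sound {A : List Cell} (h : isGrown A = true) :
    IsPolyiamond A.length A.toFinset := by
  induction A with
  | nil => simp [isGrown] at h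
  | cons c A ih =>
    cases A with
    | nil => simpa using isPolyiamond_singleton c
    | cons d A =>
      simp only [isGrown, Bool.and_eq_true, List.any_eq_true, Bool.not_eq_true',
        List.contains_iff_mem] at h
      obtain ⟨⟨h1, x, hx, hx'⟩, h2⟩ := h
      rw [List.toFinset_cons, List.length_cons]
      refine (ih h2).insert (d := x) ?_ (List.mem_toFinset.2 hx') (adj_iff_mem_nbrs.2 hx).symm
      rw [List.mem_toFinset]
      intro h
      rw [← List.contains_iff_mem, h1] at h
      exact Bool.noConfusion h

theorem isGrown_reps : ∀ r ∈ reps 7, isGrown r.reverse = true := by decide +kernel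

theorem isHeptiamond_rep {r : List Cell} (hr : r ∈ reps 7) : IsHeptiamond r.toFinset := by
  have := isGrown_sound (isGrown_reps r hr)
  rwa [List.toFinset_reverse, List.length_reverse, (reps_nodup_length 7 (by norm_num) r hr).2]
    at this

/-- The representatives of the heptiamonds are pairwise different pieces, by `pieceInv_eq`. -/
theorem pieceInv_reps : ((reps 7).map fun r => pieceInv r.toFinset).Nodup := by decide +kernel

theorem length_reps : (reps 7).length = 24 := rfl

theorem card_freeHeptiamond : Nat.card FreeHeptiamond = 24 := by
  let f : Fin (reps 7).length → FreeHeptiamond := fun i =>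
    Quotient.mk heptiamondSetoid ⟨((reps 7).get i).toFinset, isHeptiamond_rep (List.get_mem _ i)⟩
  have hf : Function.Bijective f := by
    constructor
    · intro i j hij
      have h : SamePiece ((reps 7).get i).toFinset ((reps 7).get j).toFinset := Quotient.exact hij
      have h := pieceInv_eq h
      have hinj := List.nodup_iff_injective_get.1 pieceInv_reps
      have := @hinj (i.cast (by simp)) (j.cast (by simp)) (by simpa using h)
      simpa [Fin.ext_iff] using this
    · intro q
      induction q using Quotient.inductionOn with
      | h T =>
        obtain ⟨T, hT⟩ := T
        obtain ⟨r, hr, g, hg⟩ := exists_rep 6 (by norm_num) T hT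
        obtain ⟨i, rfl⟩ := List.get_of_mem hr
        refine ⟨i, Quotient.sound ?_⟩
        have := (g.samePiece T).symm
        rw [hg] at this
        exact this
  rw [← Nat.card_eq_of_bijective f hf, Nat.card_eq_fintype_card, Fintype.card_fin, length_reps]

theorem isHeptiamond_windmill : IsHeptiamond windmill := by
  have e : windmill = List.toFinset [(0, -1, false), (-1, 1, false), (1, 0, false), (0, -1, true),
    (-1, 0, true), (0, 0, true), (0, 0, false)] := by decide +kernel
  rw [e]
  exact isGrown_sound (by decide +kernel)

theorem isHeptiamond_ship : IsHeptiamond ship := by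
  have e : ship = List.toFinset [(0, -1, false), (-1, 1, false), (0, 1, false), (0, -1, true),
    (-1, 0, true), (0, 0, true), (0, 0, false)] := by decide +kernel
  rw [e]
  exact isGrown_sound (by decide +kernel)

theorem not_samePiece_windmill_ship : ¬ SamePiece windmill ship := fun h =>
  absurd (pieceInv_eq h) (by decide +kernel)

/-! ### Convex pentagons with cyclically ordered vertices -/

/-- Five points in strictly convex position, listed in cyclic order; the sign `ε` tells whether
the order is counterclockwise. -/
def IsCyclic (ε : ℝ) (v : Fin 5 → Plane) : Prop :=
  ∀ i j k : Fin 5, i < j → j < k → 0 < ε * cr (v i) (v j) (v k)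

/-- Collinear points are ordered on their line as the values of an affine functional at them. -/
theorem mem_segment_of_cr_eq_zero {f : Plane → ℝ} {α β γ : ℝ}
    (hf : ∀ z, f z = α * X z + β * Y z + γ) {a b c : Plane} (h : cr a b c = 0)
    (hb : f a < f b) (hc : f b ≤ f c) : b ∈ segment ℝ a c := by
  rw [mem_segment_iff_XY]
  have hac : 0 < f c - f a := by linarith
  refine ⟨(f b - f a) / (f c - f a), div_nonneg (by linarith) hac.le,
    (div_le_one hac).2 (by linarith), ?_, ?_⟩
  · field_simp
    simp only [hf]
    unfold cr at h
    linear_combination β * h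
  · field_simp
    simp only [hf]
    unfold cr at h
    linear_combination (-α) * h

/-- Convexly independent points can be listed in counterclockwise order. -/
theorem exists_isCyclic {v : Fin 5 → Plane} (hv : ConvexIndependent ℝ v) :
    ∃ σ : Equiv.Perm (Fin 5), IsCyclic 1 (v ∘ σ) := by
  classical
  have hnot : ∀ i (s : Set (Fin 5)), i ∉ s → v i ∉ convexHull ℝ (v '' s) :=
    fun i s hi h => hi (hv s i h)
  -- separate `v 0` from the other points
  have hcomp : IsCompact (convexHull ℝ (v '' {i | i ≠ 0})) :=
    ((Set.toFinite _).image v).isCompact_convexHull ℝ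
  obtain ⟨φ, u, hu1, hu2⟩ := geometric_hahn_banach_point_closed (convex_convexHull ℝ _)
    hcomp.isClosed (hnot 0 {i | i ≠ 0} (by simp))
  set α := φ (pt 1 0) with hα
  set β := φ (pt 0 1) with hβ
  have hφ : ∀ z, φ z = α * X z + β * Y z := dual_apply φ
  have hpos : ∀ i : Fin 4, 0 < φ (v i.succ) - φ (v 0) := fun i => by
    have := hu2 (v i.succ) (subset_convexHull ℝ _ ⟨i.succ, Fin.succ_ne_zero i, rfl⟩)
    linarith
  have hαβ : 0 < α ^ 2 + β ^ 2 := by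
    have h1 : α ≠ 0 ∨ β ≠ 0 := by
      by_contra! h
      have := hpos 0
      rw [hφ, hφ, h.1, h.2] at this
      simp at this
    rcases h1 with h1 | h1 <;> positivity
  -- order the other points by their slope as seen from `v 0`
  let s : Fin 4 → ℝ := fun i =>
    (α * (Y (v i.succ) - Y (v 0)) - β * (X (v i.succ) - X (v 0))) / (φ (v i.succ) - φ (v 0))
  have hs : ∀ i j, (s j - s i) * ((φ (v i.succ) - φ (v 0)) * (φ (v j.succ) - φ (v 0))) =
      (α ^ 2 + β ^ 2) * cr (v 0) (v i.succ) (v j.succ) := fun i j => by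
    have h1 := (hpos i).ne'
    have h2 := (hpos j).ne'
    simp only [s]
    field_simp
    rw [hφ, hφ, hφ]
    unfold cr
    ring
  have hseg : ∀ i j k : Fin 5, j ≠ i → j ≠ k → v j ∉ segment ℝ (v i) (v k) := by
    intro i j k h1 h2 h
    refine hnot j {i, k} (by simp [h1, h2]) ?_
    rw [Set.image_pair, convexHull_pair]
    exact h
  have hinj : Function.Injective s := by
    intro i j hij
    by_contra hne
    have h0 : cr (v 0) (v i.succ) (v j.succ) = 0 := by
      have := hs i j
      rw [hij, sub_self, zero_mul] at this
      exact (mul_eq_zero.1 this.symm).resolve_left hαβ.ne'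
    have hne' : i.succ ≠ j.succ := fun h => hne (Fin.succ_injective _ h)
    rcases le_total (φ (v i.succ)) (φ (v j.succ)) with h | h
    · exact hseg 0 i.succ j.succ (Fin.succ_ne_zero i) hne' (mem_segment_of_cr_eq_zero
        (γ := 0) (fun z => by rw [hφ, add_zero]) h0 (by linarith [hpos i]) h)
    · refine hseg 0 j.succ i.succ (Fin.succ_ne_zero j) hne'.symm (mem_segment_of_cr_eq_zero
        (γ := 0) (fun z => by rw [hφ, add_zero]) ?_ (by linarith [hpos j]) h)
      rw [cr_swap', h0, neg_zero]
  -- sorting by slope makes all triangles with the vertex `v 0` counterclockwise; the others are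
  -- counterclockwise because no point lies in the triangle formed by three others
  let τ := Tuple.sort s
  have hmono : StrictMono (s ∘ τ) :=
    (Tuple.monotone_sort s).strictMono_of_injective (hinj.comp τ.injective)
  have h0 : ∀ i j : Fin 4, i < j → 0 < cr (v 0) (v (τ i).succ) (v (τ j).succ) := by
    intro i j hij
    have h1 : 0 < s (τ j) - s (τ i) := sub_pos.2 (hmono hij)
    have h2 := hs (τ i) (τ j)
    have h3 : 0 < (α ^ 2 + β ^ 2) * cr (v 0) (v (τ i).succ) (v (τ j).succ) := by
      rw [← h2]
      exact mul_pos h1 (mul_pos (hpos _) (hpos _))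
    exact (pos_iff_pos_of_mul_pos h3).1 hαβ
  have h1 : ∀ i j k : Fin 4, i < j → j < k →
      0 < cr (v (τ i).succ) (v (τ j).succ) (v (τ k).succ) := by
    intro i j k hij hjk
    by_contra! hle
    have a1 := h0 i j hij
    have a2 := h0 j k hjk
    have a3 := h0 i k (hij.trans hjk)
    refine hnot (τ j).succ {0, (τ i).succ, (τ k).succ} ?_ ?_
    · simp [hij.ne', hjk.ne]
    · rw [Set.image_insert_eq, Set.image_pair, mem_triangle_iff a3]
      refine ⟨a1.le, ?_, ?_⟩
      · rw [cr_swap']; linarith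
      · rw [cr_rot, cr_rot] at *
        rw [← cr_rot]
        linarith
  refine ⟨Equiv.Perm.decomposeFin.symm (0, τ), ?_⟩
  have e0 : (v ∘ Equiv.Perm.decomposeFin.symm (0, τ)) 0 = v 0 := by simp
  have es : ∀ i : Fin 4, (v ∘ Equiv.Perm.decomposeFin.symm (0, τ)) i.succ = v (τ i).succ :=
    fun i => by simp
  intro i j k hij hjk
  rw [one_mul]
  obtain ⟨j, rfl⟩ := Fin.exists_succ_eq.2 (Fin.ne_zero_of_lt hij)
  obtain ⟨k, rfl⟩ := Fin.exists_succ_eq.2 (Fin.ne_zero_of_lt hjk)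
  rw [es, es]
  rcases Fin.eq_zero_or_eq_succ i with rfl | ⟨i, rfl⟩
  · rw [e0]
    exact h0 j k (Fin.succ_lt_succ_iff.1 hjk)
  · rw [es]
    exact h1 i j k (Fin.succ_lt_succ_iff.1 hij) (Fin.succ_lt_succ_iff.1 hjk)

namespace IsCyclic

variable {ε : ℝ} {v : Fin 5 → Plane}

theorem rotate (h : IsCyclic ε v) (n : Fin 5) : IsCyclic ε (fun k => v (k + n)) := by
  have key : ∀ w : Fin 5 → Plane, IsCyclic ε w → IsCyclic ε (fun k => w (k + 1)) := by
    intro w hw i j k hij hjk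
    by_cases hk : k = 4
    · subst hk
      have e : (4 : Fin 5) + 1 = 0 := rfl
      simp only [e]
      rw [cr_rot]
      refine hw 0 (i + 1) (j + 1) ?_ ?_ <;> revert i j <;> decide
    · refine hw (i + 1) (j + 1) (k + 1) ?_ ?_ <;> revert i j k <;> decide
  have k1 := key _ h
  have k2 := key _ k1
  have k3 := key _ k2
  have k4 := key _ k3
  simp only [add_assoc] at k2 k3 k4
  fin_cases n
  · simpa using h
  · exact k1
  · exact k2
  · exact k3
  · exact k4

/-- All triangles formed by vertices in cyclic order have the orientation of the pentagon; the
cyclic order may start at any vertex `n`. -/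
theorem pos (h : IsCyclic ε v) (n : Fin 5) {i j k : Fin 5} (hij : i < j) (hjk : j < k) :
    0 < ε * cr (v (i + n)) (v (j + n)) (v (k + n)) :=
  h.rotate n i j k hij hjk

theorem eps_ne (h : IsCyclic ε v) : ε ≠ 0 := by
  rintro rfl
  simpa using h 0 1 2 (by decide) (by decide)

theorem cr_ne (h : IsCyclic ε v) {i j k : Fin 5} (hij : i ≠ j) (hjk : j ≠ k) (hik : i ≠ k) :
    cr (v i) (v j) (v k) ≠ 0 := by
  have key : ∀ i j k : Fin 5, i < j → j < k → cr (v i) (v j) (v k) ≠ 0 := fun i j k h1 h2 h3 => by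
    have := h i j k h1 h2
    rw [h3, mul_zero] at this
    exact lt_irrefl _ this
  rcases lt_or_gt_of_ne hij with h1 | h1 <;> rcases lt_or_gt_of_ne hjk with h2 | h2 <;>
    rcases lt_or_gt_of_ne hik with h3 | h3
  · exact key i j k h1 h2
  · exact absurd (h1.trans h2) (not_lt.2 h3.le)
  · rw [cr_swap', neg_ne_zero]; exact key i k j h3 h2
  · rw [← cr_rot, ← cr_rot]; exact key k i j h3 h1
  · rw [cr_swap, neg_ne_zero]; exact key j i k h1 h3
  · rw [← cr_rot]; exact key j k i h2 h3
  · exact absurd (h2.trans h1) (not_lt.2 h3.le)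
  · rw [cr_swap, ← cr_rot, ← cr_rot, neg_ne_zero]; exact key k j i h2 h1

theorem injective (h : IsCyclic ε v) : Function.Injective v := by
  intro i j hij
  by_contra hne
  obtain ⟨k, hk1, hk2⟩ : ∃ k : Fin 5, k ≠ i ∧ k ≠ j :=
    (by decide : ∀ i j : Fin 5, ∃ k : Fin 5, k ≠ i ∧ k ≠ j) i j
  apply h.cr_ne hne hk2.symm hk1.symm
  rw [hij, cr_self_left]

theorem ne_succ (h : IsCyclic ε v) (k : Fin 5) : v k ≠ v (k + 1) := fun e =>
  (by decide : ∀ m : Fin 5, m ≠ m + 1) k (h.injective e)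

/-- All points of the pentagon lie on one side of each of its edges. -/
theorem edge_nonneg (h : IsCyclic ε v) (k : Fin 5) {z : Plane}
    (hz : z ∈ convexHull ℝ (Set.range v)) : 0 ≤ ε * cr (v k) (v (k + 1)) z := by
  have haff : IsAff fun z => ε * cr (v k) (v (k + 1)) z :=
    (isAff_cr (h.ne_succ k)).const_mul h.eps_ne
  refine haff.nonneg_of_mem_convexHull ?_ hz
  rintro _ ⟨m, rfl⟩
  by_cases h1 : m = k
  · simp [h1]
  by_cases h2 : m = k + 1
  · simp [h2]
  have := h.pos k (i := 0) (j := 1) (k := m - k) (by decide)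
    ((by decide : ∀ m k : Fin 5, m ≠ k → m ≠ k + 1 → 1 < m - k) m k h1 h2)
  rw [zero_add, add_comm 1 k, sub_add_cancel] at this
  exact this.le

theorem edge_subset (v : Fin 5 → Plane) (k m : Fin 5) :
    segment ℝ (v k) (v m) ⊆ convexHull ℝ (Set.range v) := by
  rw [← convexHull_pair]
  exact convexHull_mono (by rintro _ (rfl | rfl) <;> simp)

/-- If a line supports the pentagon and meets it in two points, then it meets it in an edge. -/
theorem exists_edge (h : IsCyclic ε v) {f : Plane → ℝ} (hf : IsAff f)
    (hpos : ∀ z ∈ convexHull ℝ (Set.range v), 0 ≤ f z) {a b : Plane} (hab : a ≠ b)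
    (ha : a ∈ convexHull ℝ (Set.range v)) (hb : b ∈ convexHull ℝ (Set.range v))
    (ha0 : f a = 0) (hb0 : f b = 0) :
    ∃ m, f (v m) = 0 ∧ f (v (m + 1)) = 0 ∧
      ∀ z ∈ convexHull ℝ (Set.range v), f z = 0 → z ∈ segment ℝ (v m) (v (m + 1)) := by
  have hv : ∀ m, 0 ≤ f (v m) := fun m => hpos _ (subset_convexHull ℝ _ ⟨m, rfl⟩)
  -- a convex combination on the line involves only vertices on the line
  have key : ∀ z ∈ convexHull ℝ (Set.range v), f z = 0 → ∃ l : Fin 5 → ℝ, (∀ i, 0 ≤ l i) ∧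
      ∑ i, l i = 1 ∧ z = ∑ i, l i • v i ∧ ∀ i, f (v i) ≠ 0 → l i = 0 := by
    intro z hz hz0
    obtain ⟨l, hl, hl1, rfl⟩ := mem_convexHull_range hz
    refine ⟨l, hl, hl1, rfl, fun i hi => ?_⟩
    rw [hf.sum l hl1 v (X_sum l v) (Y_sum l v)] at hz0
    have := (Finset.sum_eq_zero_iff_of_nonneg fun i _ => mul_nonneg (hl i) (hv i)).1 hz0 i
      (Finset.mem_univ i)
    exact (mul_eq_zero.1 this).resolve_right hi
  -- the line contains at most two vertices
  have htwo : ∀ i j k, i ≠ j → j ≠ k → i ≠ k → f (v i) = 0 → f (v j) = 0 → f (v k) ≠ 0 :=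
    fun i j k h1 h2 h3 e1 e2 e3 => h.cr_ne h1 h2 h3 (hf.cr_eq_zero e1 e2 e3)
  -- and at least two
  have hex : ∃ i j, i ≠ j ∧ f (v i) = 0 ∧ f (v j) = 0 := by
    by_contra! hno
    have hone : ∃ i, ∀ j, j ≠ i → f (v j) ≠ 0 := by
      by_cases hi : ∃ i, f (v i) = 0
      · obtain ⟨i, hi⟩ := hi
        exact ⟨i, fun j hj => hno i j hj.symm hi⟩
      · push Not at hi
        exact ⟨0, fun j _ => hi j⟩
    obtain ⟨i, hi⟩ := hone
    have hz : ∀ z ∈ convexHull ℝ (Set.range v), f z = 0 → z = v i := by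
      intro z hz hz0
      obtain ⟨l, hl, hl1, rfl, hl0⟩ := key z hz hz0
      have h0 : ∀ j, j ≠ i → l j = 0 := fun j hj => hl0 j (hi j hj)
      rw [Finset.sum_eq_single i (fun j _ hj => h0 j hj) (by simp)] at hl1
      rw [Finset.sum_eq_single i (fun j _ hj => by rw [h0 j hj, zero_smul]) (by simp), hl1,
        one_smul]
    exact hab ((hz a ha ha0).trans (hz b hb hb0).symm)
  -- they are adjacent, for otherwise there are vertices on both sides of the line
  have hadj : ∃ m, f (v m) = 0 ∧ f (v (m + 1)) = 0 := by
    obtain ⟨i, j, hij, hi, hj⟩ := hex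
    have hdiag : ∀ m, f (v m) = 0 → f (v (m + 2)) = 0 → False := by
      intro m h1 h2
      have hne : v m ≠ v (m + 2) := fun e =>
        (by decide : ∀ m : Fin 5, m ≠ m + 2) m (h.injective e)
      obtain ⟨c, hc, hc'⟩ := hf.eq_cr hne h1 h2
      have e1 := h.pos m (i := 0) (j := 1) (k := 2) (by decide) (by decide)
      have e2 := h.pos m (i := 0) (j := 2) (k := 3) (by decide) (by decide)
      rw [zero_add, add_comm 1 m, add_comm 2 m] at e1
      rw [zero_add, add_comm 2 m, add_comm 3 m] at e2
      have p1 := hv (m + 1)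
      have p2 := hv (m + 3)
      rw [hc'] at p1 p2
      rw [cr_swap'] at p1
      have q1 : c * ε ≤ 0 := by
        by_contra! hlt
        have := mul_pos hlt e1
        nlinarith [mul_nonneg (sq_nonneg ε)
          (by linarith : 0 ≤ c * -cr (v m) (v (m + 1)) (v (m + 2)))]
      have q2 : 0 ≤ c * ε := by
        by_contra! hlt
        have := mul_neg_of_neg_of_pos hlt e2
        nlinarith [mul_nonneg (sq_nonneg ε) p2]
      exact mul_ne_zero hc h.eps_ne (le_antisymm q1 q2)
    have hcase : ∀ i j : Fin 5, i ≠ j → j = i + 1 ∨ j = i + 2 ∨ i = j + 1 ∨ i = j + 2 := by decide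
    rcases hcase i j hij with rfl | rfl | rfl | rfl
    · exact ⟨i, hi, hj⟩
    · exact (hdiag _ hi hj).elim
    · exact ⟨j, hj, hi⟩
    · exact (hdiag _ hj hi).elim
  obtain ⟨m, hm, hm'⟩ := hadj
  refine ⟨m, hm, hm', fun z hz hz0 => ?_⟩
  obtain ⟨l, hl, hl1, rfl, hl0⟩ := key z hz hz0
  have hmm : m ≠ m + 1 := (by decide : ∀ m : Fin 5, m ≠ m + 1) m
  have h0 : ∀ j, j ∉ ({m, m + 1} : Finset (Fin 5)) → l j = 0 := fun j hj => by
    simp only [Finset.mem_insert, Finset.mem_singleton, not_or] at hj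
    exact hl0 j (htwo m (m + 1) j hmm (Ne.symm hj.2) (Ne.symm hj.1) hm hm')
  have e1 : ∑ i, l i • v i = l m • v m + l (m + 1) • v (m + 1) := by
    rw [← Finset.sum_pair (f := fun i => l i • v i) hmm]
    exact (Finset.sum_subset (Finset.subset_univ _) fun j _ hj => by
      rw [h0 j hj, zero_smul]).symm
  have e2 : l m + l (m + 1) = 1 := by
    rw [← Finset.sum_pair hmm, ← hl1]
    exact Finset.sum_subset (Finset.subset_univ _) fun j _ hj => h0 j hj
  rw [e1]
  exact ⟨l m, l (m + 1), hl _, hl _, e2, rfl⟩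

end IsCyclic

/-! ### Area and interior of a pentagon -/

theorem mem_triangle_iff_sign {ε : ℝ} (hε : ε = 1 ∨ ε = -1) {a b c : Plane}
    (h : 0 < ε * cr a b c) {z : Plane} : z ∈ convexHull ℝ {a, b, c} ↔
      0 ≤ ε * cr a b z ∧ 0 ≤ ε * cr b c z ∧ 0 ≤ ε * cr c a z := by
  rcases hε with rfl | rfl
  · simp only [one_mul] at *
    exact mem_triangle_iff h
  · have h' : 0 < cr a c b := by rw [cr_swap']; linarith
    rw [show ({a, b, c} : Set Plane) = {a, c, b} by rw [Set.pair_comm b c], mem_triangle_iff h',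
      cr_swap a c, cr_swap c b, cr_swap b a]
    simp only [neg_one_mul, neg_neg]
    tauto

theorem nonneg_of_mem_triangle {ε : ℝ} {a b p q r : Plane} (hε : ε ≠ 0) (hab : a ≠ b)
    (hp : 0 ≤ ε * cr a b p) (hq : 0 ≤ ε * cr a b q) (hr : 0 ≤ ε * cr a b r) {z : Plane}
    (hz : z ∈ convexHull ℝ {p, q, r}) : 0 ≤ ε * cr a b z := by
  have haff : IsAff fun z => ε * cr a b z := (isAff_cr hab).const_mul hε
  refine haff.nonneg_of_mem_convexHull ?_ hz
  rintro w (rfl | rfl | rfl) <;> assumption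

theorem volume_union_of_line {s t : Set Plane} (hs : IsCompact s) {a b : Plane}
    (hab : a ≠ b) (h : ∀ z ∈ s, z ∈ t → cr a b z = 0) :
    volume (s ∪ t) = volume s + volume t := by
  rw [Set.union_comm, measure_union₀ hs.measurableSet.nullMeasurableSet, add_comm]
  refine measure_mono_null ?_ (null_line (isAff_cr hab))
  rintro z ⟨h1, h2⟩
  exact h z h2 h1

namespace IsCyclic

variable {ε : ℝ} {v : Fin 5 → Plane}

/-- A point on the inner side of all edges lies in one of the triangles cut off by the diagonals
through `v 0`, according to its position relative to these diagonals. -/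
theorem mem_fan (h : IsCyclic ε v) (hε : ε = 1 ∨ ε = -1) {z : Plane}
    (hz : ∀ k, 0 ≤ ε * cr (v k) (v (k + 1)) z) : z ∈ convexHull ℝ {v 0, v 1, v 2} ∪
      (convexHull ℝ {v 0, v 2, v 3} ∪ convexHull ℝ {v 0, v 3, v 4}) := by
  have t1 := mem_triangle_iff_sign hε (h 0 1 2 (by decide) (by decide)) (z := z)
  have t2 := mem_triangle_iff_sign hε (h 0 2 3 (by decide) (by decide)) (z := z)
  have t3 := mem_triangle_iff_sign hε (h 0 3 4 (by decide) (by decide)) (z := z)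
  have z0 := hz 0
  have z1 := hz 1
  have z2 := hz 2
  have z3 := hz 3
  have z4 := hz 4
  simp only [zero_add, show (1 : Fin 5) + 1 = 2 from rfl, show (2 : Fin 5) + 1 = 3 from rfl,
    show (3 : Fin 5) + 1 = 4 from rfl, show (4 : Fin 5) + 1 = 0 from rfl] at z0 z1 z2 z3 z4
  have s2 : cr (v 2) (v 0) z = -cr (v 0) (v 2) z := cr_swap _ _ _
  have s3 : cr (v 3) (v 0) z = -cr (v 0) (v 3) z := cr_swap _ _ _
  rcases le_total 0 (ε * cr (v 0) (v 2) z) with h2 | h2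
  · rcases le_total 0 (ε * cr (v 0) (v 3) z) with h3 | h3
    · exact Or.inr (Or.inr (t3.2 ⟨h3, z3, z4⟩))
    · exact Or.inr (Or.inl (t2.2 ⟨h2, z2, by rw [s3]; linarith⟩))
  · exact Or.inl (t1.2 ⟨z0, z1, by rw [s2]; linarith⟩)

/-- A pentagon is cut into three triangles by the diagonals through its vertex `0`. -/
theorem eq_union (h : IsCyclic ε v) (hε : ε = 1 ∨ ε = -1) : convexHull ℝ (Set.range v) =
    convexHull ℝ {v 0, v 1, v 2} ∪ (convexHull ℝ {v 0, v 2, v 3} ∪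
      convexHull ℝ {v 0, v 3, v 4}) := by
  have sub : ∀ i j k, convexHull ℝ {v i, v j, v k} ⊆ convexHull ℝ (Set.range v) := fun i j k =>
    convexHull_mono (by rintro _ (rfl | rfl | rfl) <;> simp)
  exact Set.Subset.antisymm (fun z hz => h.mem_fan hε fun k => h.edge_nonneg k hz)
    (Set.union_subset (sub _ _ _) (Set.union_subset (sub _ _ _) (sub _ _ _)))

theorem mem_iff (h : IsCyclic ε v) (hε : ε = 1 ∨ ε = -1) {z : Plane} :
    z ∈ convexHull ℝ (Set.range v) ↔ ∀ k, 0 ≤ ε * cr (v k) (v (k + 1)) z :=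
  ⟨fun hz k => h.edge_nonneg k hz, fun hz => by rw [h.eq_union hε]; exact h.mem_fan hε hz⟩

/-- The area of a pentagon in units of the area of a cell, up to orientation. -/
def _root_.Polyiamond.pentArea (v : Fin 5 → Plane) : ℝ :=
  cr (v 0) (v 1) (v 2) + cr (v 0) (v 2) (v 3) + cr (v 0) (v 3) (v 4)

theorem area_pos (h : IsCyclic ε v) : 0 < ε * pentArea v := by
  have h1 := h 0 1 2 (by decide) (by decide)
  have h2 := h 0 2 3 (by decide) (by decide)
  have h3 := h 0 3 4 (by decide) (by decide)
  unfold pentArea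
  linarith

theorem volume_eq (h : IsCyclic ε v) (hε : ε = 1 ∨ ε = -1) :
    volume (convexHull ℝ (Set.range v)) = ENNReal.ofReal (ε * pentArea v) * cellVol := by
  have hc : ∀ a b c : Plane, IsCompact (convexHull ℝ {a, b, c}) := fun a b c =>
    (Set.toFinite _).isCompact_convexHull ℝ
  have h1 := h 0 1 2 (by decide) (by decide)
  have h2 := h 0 2 3 (by decide) (by decide)
  have h3 := h 0 3 4 (by decide) (by decide)
  have h4 := h 0 2 4 (by decide) (by decide)
  have n2 : v 0 ≠ v 2 := fun e => by simpa using h.injective e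
  have n3 : v 0 ≠ v 3 := fun e => by simpa using h.injective e
  have habs : ∀ x : ℝ, 0 < ε * x → |x| = ε * x := by
    intro x hx
    rcases hε with rfl | rfl
    · rw [one_mul] at *; exact abs_of_pos hx
    · rw [neg_one_mul] at *; exact abs_of_neg (by linarith)
  rw [h.eq_union hε, volume_union_of_line (hc _ _ _) n2, volume_union_of_line (hc _ _ _) n3,
    volume_triangle, volume_triangle, volume_triangle, habs _ h1, habs _ h2, habs _ h3,
    ← add_mul, ← ENNReal.ofReal_add h2.le h3.le, ← add_mul,
    ← ENNReal.ofReal_add h1.le (by linarith)]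
  · unfold pentArea
    congr 2
    ring
  · intro z hz1 hz2
    have e1 := ((mem_triangle_iff_sign hε h2).1 hz1).2.2
    have e2 := ((mem_triangle_iff_sign hε h3).1 hz2).1
    rw [cr_swap] at e1
    exact (mul_eq_zero.1 (le_antisymm (by linarith) e2)).resolve_left h.eps_ne
  · intro z hz1 hz2
    have e1 := ((mem_triangle_iff_sign hε h1).1 hz1).2.2
    have e2 : 0 ≤ ε * cr (v 0) (v 2) z := by
      rcases hz2 with hz2 | hz2 <;>
        exact nonneg_of_mem_triangle h.eps_ne n2 (by simp) (by first | exact h2.le | simp)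
          (by first | exact h2.le | exact h4.le) hz2
    rw [cr_swap] at e1
    exact (mul_eq_zero.1 (le_antisymm (by linarith) e2)).resolve_left h.eps_ne

/-- The frontier of a convex set is a null set, so a pentagon with empty interior would have area
zero. -/
theorem interior_nonempty (h : IsCyclic ε v) (hε : ε = 1 ∨ ε = -1) :
    (interior (convexHull ℝ (Set.range v))).Nonempty := by
  by_contra hne
  rw [Set.not_nonempty_iff_eq_empty] at hne
  have h1 : volume (convexHull ℝ (Set.range v)) = 0 := by
    refine measure_mono_null ?_
      ((convex_convexHull ℝ (Set.range v)).addHaar_frontier (μ := volume))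
    rw [frontier, hne, Set.sdiff_empty]
    exact subset_closure
  rw [h.volume_eq hε, mul_eq_zero, ENNReal.ofReal_eq_zero] at h1
  rcases h1 with h1 | h1
  · exact absurd h.area_pos (not_lt.2 h1)
  · exact cellVol_ne_zero h1

end IsCyclic

/-- Convex sets with disjoint interiors are separated by a line. -/
theorem exists_separation {s t : Set Plane} (hs : Convex ℝ s) (ht : Convex ℝ t)
    (hs' : (interior s).Nonempty) (ht' : (interior t).Nonempty)
    (h : Disjoint (interior s) (interior t)) :
    ∃ f, IsAff f ∧ (∀ z ∈ s, 0 ≤ f z) ∧ ∀ z ∈ t, f z ≤ 0 := by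
  obtain ⟨φ, u, h1, h2⟩ := geometric_hahn_banach_open_open hs.interior isOpen_interior
    ht.interior isOpen_interior h
  have hφ := dual_apply φ
  refine ⟨fun z => u - φ z, ⟨-φ (pt 1 0), -φ (pt 0 1), u, ?_, fun z => by
    simp only; rw [hφ]; ring⟩, ?_, ?_⟩
  · obtain ⟨a, ha⟩ := hs'
    obtain ⟨b, hb⟩ := ht'
    by_contra! h0
    have e1 := h1 a ha
    have e2 := h2 b hb
    rw [hφ, neg_eq_zero.1 h0.1, neg_eq_zero.1 h0.2] at e1 e2
    linarith
  · intro z hz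
    have hz' : z ∈ closure (interior s) := by
      rw [hs.closure_interior_eq_closure_of_nonempty_interior hs']
      exact subset_closure hz
    have : closure (interior s) ⊆ {z | φ z ≤ u} := closure_minimal (fun z hz => (h1 z hz).le)
      (isClosed_le φ.continuous continuous_const)
    exact sub_nonneg.2 (this hz')
  · intro z hz
    have hz' : z ∈ closure (interior t) := by
      rw [ht.closure_interior_eq_closure_of_nonempty_interior ht']
      exact subset_closure hz
    have : closure (interior t) ⊆ {z | u ≤ φ z} := closure_minimal (fun z hz => (h2 z hz).le)
      (isClosed_le continuous_const φ.continuous)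
    exact sub_nonpos.2 (this hz')

/-! ### Isometries and orientation -/

/-- An isometry of the plane multiplies all values of `cr` by the same sign. -/
theorem exists_sign (e : Plane ≃ᵢ Plane) :
    ∃ δ : ℝ, (δ = 1 ∨ δ = -1) ∧ ∀ a b c, cr (e a) (e b) (e c) = δ * cr a b c := by
  let L := e.toRealAffineIsometryEquiv
  have hL : ∀ z, e z = e 0 + (X z • L.linearIsometryEquiv (pt 1 0) +
      Y z • L.linearIsometryEquiv (pt 0 1)) := fun z => by
    have h1 : z = X z • pt 1 0 + Y z • pt 0 1 := ext_XY (by simp) (by simp)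
    have h2 := L.map_vadd 0 z
    simp only [vadd_eq_add, add_zero] at h2
    conv_lhs => rw [show e z = L z from rfl, h2]
    rw [show L 0 = e 0 from rfl, add_comm]
    conv_lhs => rw [h1]
    rw [map_add, map_smul, map_smul]
  -- the factor is the determinant of the linear part; its square is computed by `cr_sq` from scalar
  -- products, which the isometry preserves
  set p := L.linearIsometryEquiv (pt 1 0)
  set q := L.linearIsometryEquiv (pt 0 1)
  have key : ∀ a b c, cr (e a) (e b) (e c) = (X p * Y q - X q * Y p) * cr a b c := fun a b c => by
    rw [hL a, hL b, hL c]
    simp only [cr, X_add, Y_add, X_smul, Y_smul]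
    ring
  refine ⟨X p * Y q - X q * Y p, ?_, key⟩
  have h1 := cr_sq (e (pt 0 0)) (e (pt 1 0)) (e (pt 0 1))
  rw [show ip (e (pt 1 0) - e (pt 0 0)) (e (pt 0 1) - e (pt 0 0)) =
    ip (pt 1 0 - pt 0 0) (pt 0 1 - pt 0 0) by
      have hd : ∀ a b, nsq (e a - e b) = nsq (a - b) := fun a b =>
        nsq_eq_iff_dist.2 (e.dist_eq a b)
      rw [ip_eq, ip_eq, hd, hd, hd], nsq_eq_iff_dist.2 (e.dist_eq (pt 1 0) (pt 0 0)),
    nsq_eq_iff_dist.2 (e.dist_eq (pt 0 1) (pt 0 0)), key] at h1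
  simp [cr, nsq, ip] at h1
  have h2 : (X p * Y q - X q * Y p) ^ 2 = 1 := by linarith
  have h3 : (X p * Y q - X q * Y p - 1) * (X p * Y q - X q * Y p + 1) = 0 := by linarith
  rcases mul_eq_zero.1 h3 with h | h
  · exact Or.inl (by linarith)
  · exact Or.inr (by linarith)

/-! ### Trisections with labelled vertices -/

/-- A trisection of a region into three congruent pentagons, with corresponding vertices labelled
cyclically by `Fin 5`, together with lines separating the pentagons: `h i j` is nonnegative on the
pentagon `i` and nonpositive on the pentagon `j`. -/
structure Config (T : Finset Cell) where
  /-- The vertices of the pentagons, in cyclic order. -/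
  w : Fin 3 → Fin 5 → Plane
  /-- The orientations of the pentagons. -/
  ε : Fin 3 → ℝ
  /-- The affine functionals separating the pentagons. -/
  h : Fin 3 → Fin 3 → Plane → ℝ
  sign : ∀ i, ε i = 1 ∨ ε i = -1
  cyc : ∀ i, IsCyclic (ε i) (w i)
  nsq_eq : ∀ i j k l, nsq (w i k - w i l) = nsq (w j k - w j l)
  area_eq : ∀ i j, ε i * pentArea (w i) = ε j * pentArea (w j)
  cover : ⋃ i, convexHull ℝ (Set.range (w i)) = region T
  isAff : ∀ i j, i ≠ j → IsAff (h i j)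
  anti : ∀ i j z, h j i z = -h i j z
  nonneg : ∀ i j, i ≠ j → ∀ z ∈ convexHull ℝ (Set.range (w i)), 0 ≤ h i j z

/-- Every trisection arises from a `Config`: the cyclic labelling of the first pentagon is carried
to the others by congruences. -/
theorem exists_config {T : Finset Cell} {P : Fin 3 → Set Plane}
    (hP : IsPentagonTrisection (region T) P) :
    ∃ C : Config T, ∀ i, P i = convexHull ℝ (Set.range (C.w i)) := by
  classical
  obtain ⟨v₀, hv₀, hP₀⟩ := hP.pentagon 0
  obtain ⟨σ, hσ⟩ := exists_isCyclic hv₀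
  set v := v₀ ∘ σ
  have hPv : P 0 = convexHull ℝ (Set.range v) := by rw [hP₀, σ.surjective.range_comp]
  choose e he using fun i => hP.congruent 0 i
  choose δ hδ hcr using fun i => exists_sign (e i)
  have hPi : ∀ i, P i = convexHull ℝ (Set.range fun k => e i (v k)) := fun i => by
    rw [← he i, hPv, IsometryEquiv.image_convexHull, ← Set.range_comp]
    rfl
  have hδ2 : ∀ i, δ i * δ i = 1 := fun i => by rcases hδ i with h | h <;> rw [h] <;> norm_num
  have hcyc : ∀ i, IsCyclic (δ i) (fun k => e i (v k)) := fun i a b c hab hbc => by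
    rw [hcr, ← mul_assoc, hδ2]
    exact hσ a b c hab hbc
  have hint : ∀ i, (interior (P i)).Nonempty := fun i => by
    rw [hPi]
    exact (hcyc i).interior_nonempty (hδ i)
  have hconv : ∀ i, Convex ℝ (P i) := fun i => by
    rw [hPi]
    exact convex_convexHull ℝ _
  have hsep : ∀ i j, i ≠ j → ∃ f, IsAff f ∧ (∀ z ∈ P i, 0 ≤ f z) ∧ ∀ z ∈ P j, f z ≤ 0 :=
    fun i j hij => exists_separation (hconv i) (hconv j) (hint i) (hint j) (hP.disjoint i j hij)
  choose! f hf using hsep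
  -- choose the functional for `i < j` only, so that it is antisymmetric in `i` and `j`
  let h : Fin 3 → Fin 3 → Plane → ℝ := fun i j z =>
    if i < j then f i j z else if j < i then -f j i z else 0
  refine ⟨⟨fun i k => e i (v k), δ, h, hδ, hcyc, ?_, ?_, ?_, ?_, ?_, ?_⟩, hPi⟩
  · intro i j k l
    rw [nsq_eq_iff_dist, (e i).dist_eq, (e j).dist_eq]
  · intro i j
    have : ∀ i, δ i * pentArea (fun k => e i (v k)) = pentArea v := fun i => by
      unfold pentArea
      simp only [hcr]
      linear_combination
        (cr (v 0) (v 1) (v 2) + cr (v 0) (v 2) (v 3) + cr (v 0) (v 3) (v 4)) * hδ2 i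
    rw [this, this]
  · rw [← hP.cover]
    exact Set.iUnion_congr fun i => (hPi i).symm
  · intro i j hij
    rcases lt_or_gt_of_ne hij with h1 | h1
    · simpa only [h, h1, if_true] using (hf i j hij).1
    · simpa only [h, h1, h1.not_gt, if_true, if_false] using (hf j i hij.symm).1.neg
  · intro i j z
    rcases lt_trichotomy i j with h1 | h1 | h1
    · simp [h, h1, h1.not_gt]
    · simp [h, h1]
    · simp [h, h1, h1.not_gt]
  · intro i j hij z hz
    rw [← hPi] at hz
    rcases lt_or_gt_of_ne hij with h1 | h1
    · simpa only [h, h1, if_true] using (hf i j hij).2.1 z hz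
    · simpa only [h, h1, h1.not_gt, if_true, if_false] using
        neg_nonneg.2 ((hf j i hij.symm).2.2 z hz)

/-- The segment `a b` lies on a line of the tiling. -/
def IntLine (a b : Plane) : Prop :=
  ∃ n : ℤ, (X a = n ∧ X b = n) ∨ (Y a = n ∧ Y b = n) ∨ (X a + Y a = n ∧ X b + Y b = n)

/-- The segment `a b` is parallel to a line of the tiling. -/
def LatDir (a b : Plane) : Prop := X a = X b ∨ Y a = Y b ∨ X a + Y a = X b + Y b

theorem IntLine.latDir {a b : Plane} (h : IntLine a b) : LatDir a b := by
  obtain ⟨n, h | h | h⟩ := h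
  · exact Or.inl (h.1.trans h.2.symm)
  · exact Or.inr (Or.inl (h.1.trans h.2.symm))
  · exact Or.inr (Or.inr (h.1.trans h.2.symm))

/-- An affine functional that is nonnegative on a set is positive in the interior, since it
decreases along the opposite of its gradient. -/
theorem IsAff.pos_of_mem_interior {f : Plane → ℝ} (hf : IsAff f) {s : Set Plane}
    (hs : ∀ z ∈ s, 0 ≤ f z) {z : Plane} (hz : z ∈ interior s) : 0 < f z := by
  obtain ⟨α, β, γ, h0, hf'⟩ := hf
  have hpos : 0 < α ^ 2 + β ^ 2 := by rcases h0 with h | h <;> positivity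
  have hc : Continuous fun t : ℝ => z + t • pt (-α) (-β) := by fun_prop
  have hnhds : ∀ᶠ t in nhds (0 : ℝ), z + t • pt (-α) (-β) ∈ s := by
    have := hc.continuousAt (x := 0)
    refine this.eventually ?_
    simpa using mem_interior_iff_mem_nhds.1 hz
  obtain ⟨t, ht, ht'⟩ := ((hnhds.filter_mono nhdsWithin_le_nhds).and
    (self_mem_nhdsWithin (a := (0 : ℝ)) (s := Set.Ioi 0))).exists
  have h1 := hs _ ht
  rw [hf'] at h1 ⊢
  simp only [X_add, Y_add, X_smul, Y_smul, X_pt, Y_pt] at h1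
  have : 0 < t * (α ^ 2 + β ^ 2) := mul_pos ht' hpos
  linarith

/-- A segment that does not lie on a line of the tiling meets the tiling in countably many
points. -/
theorem countable_onGrid {a b : Plane} (h : ¬ IntLine a b) :
    {t : ℝ | OnGrid (a + t • (b - a))}.Countable := by
  have key : ∀ p q : ℝ, (∀ n : ℤ, ¬ (p = n ∧ q = n)) →
      {t : ℝ | ∃ n : ℤ, p + t * (q - p) = n}.Countable := by
    intro p q hpq
    have : {t : ℝ | ∃ n : ℤ, p + t * (q - p) = n} = ⋃ n : ℤ, {t : ℝ | p + t * (q - p) = n} := by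
      ext t
      simp
    rw [this]
    refine Set.countable_iUnion fun n => Set.Subsingleton.countable ?_
    intro t ht s hs
    simp only [Set.mem_ofPred_eq] at ht hs
    have h1 : (t - s) * (q - p) = 0 := by linarith
    rcases mul_eq_zero.1 h1 with h1 | h1
    · linarith
    · rw [h1] at ht
      exact (hpq n ⟨by linarith, by linarith⟩).elim
  have h1 := key (X a) (X b) fun n hn => h ⟨n, Or.inl hn⟩
  have h2 := key (Y a) (Y b) fun n hn => h ⟨n, Or.inr (Or.inl hn)⟩
  have h3 := key (X a + Y a) (X b + Y b) fun n hn => h ⟨n, Or.inr (Or.inr hn)⟩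
  refine ((h1.union h2).union h3).mono ?_
  rintro t ⟨n, hn⟩
  simp only [X_add, Y_add, X_smul, Y_smul, X_sub, Y_sub] at hn
  rcases hn with hn | hn | hn
  · exact Or.inl (Or.inl ⟨n, hn⟩)
  · exact Or.inl (Or.inr ⟨n, hn⟩)
  · exact Or.inr ⟨n, by linarith⟩

/-- A line contains at most one edge of a pentagon. -/
theorem IsCyclic.edge_unique {v : Fin 5 → Plane} {ε : ℝ} (h : IsCyclic ε v) {f : Plane → ℝ}
    (hf : IsAff f) {k l : Fin 5} (hk : f (v k) = 0) (hk' : f (v (k + 1)) = 0) (hl : f (v l) = 0)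
    (hl' : f (v (l + 1)) = 0) : k = l := by
  by_contra hkl
  have h1 : k ≠ k + 1 := (by decide : ∀ k : Fin 5, k ≠ k + 1) k
  by_cases h2 : l = k + 1
  · have h3 : (k + 1) ≠ l + 1 ∧ k ≠ l + 1 := by
      subst h2
      exact (by decide : ∀ k : Fin 5, k + 1 ≠ k + 1 + 1 ∧ k ≠ k + 1 + 1) k
    exact h.cr_ne h1 h3.1 h3.2 (hf.cr_eq_zero hk hk' hl')
  · exact h.cr_ne h1 (Ne.symm h2) hkl (hf.cr_eq_zero hk hk' hl)

namespace Config

variable {T : Finset Cell} (C : Config T)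

/-- The pentagons of the trisection. -/
def pent (i : Fin 3) : Set Plane := convexHull ℝ (Set.range (C.w i))

/-- The edges of the pentagons. -/
def edge (i : Fin 3) (k : Fin 5) : Set Plane := segment ℝ (C.w i k) (C.w i (k + 1))

/-- The edge `k` of the pentagon `i` lies on the line separating it from the pentagon `j`. -/
def On (i j : Fin 3) (k : Fin 5) : Prop := C.h i j (C.w i k) = 0 ∧ C.h i j (C.w i (k + 1)) = 0

/-- The edge `k` of the pentagon `i` lies on a line of the tiling. -/
def IsInt (i : Fin 3) (k : Fin 5) : Prop := IntLine (C.w i k) (C.w i (k + 1))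

/-- The edge `k` of the pentagon `i` is parallel to a line of the tiling. -/
def Lat (i : Fin 3) (k : Fin 5) : Prop := LatDir (C.w i k) (C.w i (k + 1))

theorem edge_subset (i : Fin 3) (k : Fin 5) : C.edge i k ⊆ C.pent i :=
  IsCyclic.edge_subset _ _ _

theorem isCompact_pent (i : Fin 3) : IsCompact (C.pent i) :=
  (Set.finite_range _).isCompact_convexHull ℝ

theorem pent_subset (i : Fin 3) : C.pent i ⊆ region T := by
  rw [← C.cover]
  exact Set.subset_iUnion (fun i => convexHull ℝ (Set.range (C.w i))) i

theorem h_eq_zero {i j : Fin 3} (hij : i ≠ j) {z : Plane} (hi : z ∈ C.pent i)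
    (hj : z ∈ C.pent j) : C.h i j z = 0 := by
  have h1 := C.nonneg i j hij z hi
  have h2 := C.nonneg j i hij.symm z hj
  rw [C.anti] at h2
  linarith

theorem On.h_eq_zero {C : Config T} {i j : Fin 3} {k : Fin 5} (hij : i ≠ j) (h : C.On i j k)
    {z : Plane} (hz : z ∈ C.edge i k) : C.h i j z = 0 := by
  obtain ⟨a, b, ha, hb, hab, rfl⟩ := hz
  rw [(C.isAff i j hij).combo _ _ hab, h.1, h.2, mul_zero, mul_zero, add_zero]

/-- Two points common to two of the pentagons lie on an edge of either of them. -/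
theorem exists_on {i j : Fin 3} (hij : i ≠ j) {a b : Plane} (hab : a ≠ b) (ha : a ∈ C.pent i)
    (hb : b ∈ C.pent i) (ha' : a ∈ C.pent j) (hb' : b ∈ C.pent j) :
    ∃ m, C.On i j m ∧ ∀ z ∈ C.pent i, z ∈ C.pent j → z ∈ C.edge i m := by
  obtain ⟨m, h1, h2, h3⟩ := (C.cyc i).exists_edge (C.isAff i j hij) (C.nonneg i j hij) hab ha hb
    (C.h_eq_zero hij ha ha') (C.h_eq_zero hij hb hb')
  exact ⟨m, ⟨h1, h2⟩, fun z hz hz' => h3 z hz (C.h_eq_zero hij hz hz')⟩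

/-- At most one edge of a pentagon lies on the line separating it from another one. -/
theorem on_unique {i j : Fin 3} (hij : i ≠ j) {k l : Fin 5} (hk : C.On i j k) (hl : C.On i j l) :
    k = l :=
  (C.cyc i).edge_unique (C.isAff i j hij) hk.1 hk.2 hl.1 hl.2

/-- A point of an edge that is not on the tiling lies in the interior of the region, and hence in
another pentagon. -/
theorem exists_pent_of_not_onGrid {i : Fin 3} {k : Fin 5} {z : Plane} (hz : z ∈ C.edge i k)
    (hg : ¬ OnGrid z) : ∃ j, j ≠ i ∧ z ∈ C.pent j := by
  by_contra! hno
  have hzi := C.edge_subset i k hz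
  have hint := mem_interior_region (C.pent_subset i hzi) hg
  -- otherwise a neighbourhood of `z` is contained in the pentagon `i`
  have hopen : IsOpen (⋂ j : {j // j ≠ i}, (C.pent j)ᶜ) :=
    isOpen_iInter_of_finite fun j => (C.isCompact_pent j).isClosed.isOpen_compl
  have hzint : z ∈ interior (C.pent i) := by
    refine mem_interior.2 ⟨interior (region T) ∩ ⋂ j : {j // j ≠ i}, (C.pent j)ᶜ, ?_,
      isOpen_interior.inter hopen, hint, Set.mem_iInter.2 fun j => hno j j.2⟩
    rintro y ⟨hy1, hy2⟩
    have hy3 : y ∈ ⋃ i, convexHull ℝ (Set.range (C.w i)) := by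
      rw [C.cover]
      exact interior_subset hy1
    obtain ⟨j, hj⟩ := Set.mem_iUnion.1 hy3
    by_cases hji : j = i
    · exact hji ▸ hj
    · exact (Set.mem_iInter.1 hy2 ⟨j, hji⟩ hj).elim
  -- but `z` lies on the line of an edge, which supports the pentagon
  have haff : IsAff fun z => C.ε i * cr (C.w i k) (C.w i (k + 1)) z :=
    (isAff_cr ((C.cyc i).ne_succ k)).const_mul (C.cyc i).eps_ne
  have := haff.pos_of_mem_interior (fun z hz => (C.cyc i).edge_nonneg k hz) hzint
  obtain ⟨a, b, ha, hb, hab, rfl⟩ := hz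
  have e := (isAff_cr ((C.cyc i).ne_succ k)).combo (C.w i k) (C.w i (k + 1)) hab
  simp only [cr_self_right, cr_self_mid, mul_zero, add_zero] at e
  rw [e, mul_zero] at this
  exact lt_irrefl _ this

/-- An edge off the lines of the tiling is covered by collinear edges of the other pentagons. This
holds because only countably many of its points lie on the tiling, see
`exists_pent_of_not_onGrid` for the others. -/
theorem exists_contact {i : Fin 3} {k : Fin 5} (hk : ¬ C.IsInt i k) {z : Plane}
    (hz : z ∈ C.edge i k) :
    ∃ j, j ≠ i ∧ ∃ m, C.On i j k ∧ C.On j i m ∧ z ∈ C.edge j m := by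
  set a := C.w i k with ha
  set b := C.w i (k + 1) with hb
  have hab : a ≠ b := (C.cyc i).ne_succ k
  by_contra! hno
  -- the part of the edge outside the closed union `U` of the collinear edges of the other pentagons
  -- is relatively open, so it has uncountably many points off the tiling if it is not empty
  let U : Set Plane := ⋃ p : {p : Fin 3 × Fin 5 // p.1 ≠ i ∧ C.On i p.1 k ∧ C.On p.1 i p.2},
    C.edge p.1.1 p.1.2
  have hU : IsClosed U := isClosed_iUnion_of_finite fun p => by
    rw [edge, ← convexHull_pair]
    exact ((Set.toFinite _).isCompact_convexHull ℝ).isClosed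
  have hzU : z ∉ U := by
    simp only [U, Set.mem_iUnion, not_exists]
    rintro ⟨⟨j, m⟩, h1, h2, h3⟩
    exact hno j h1 m h2 h3
  let γ : ℝ → Plane := fun t => a + t • (b - a)
  have hγ : Continuous γ := by fun_prop
  have hγinj : ∀ s t, γ s = γ t → s = t := by
    intro s t hst
    have h1 : (s - t) • (b - a) = 0 := by
      rw [sub_smul, sub_eq_zero]
      exact add_left_cancel hst
    rcases smul_eq_zero.1 h1 with h1 | h1
    · linarith
    · exact (hab (sub_eq_zero.1 h1).symm).elim
  have hγe : ∀ t ∈ Set.Ioo (0 : ℝ) 1, γ t ∈ C.edge i k := fun t ht => by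
    rw [edge, segment_eq_image']
    exact ⟨t, ⟨ht.1.le, ht.2.le⟩, rfl⟩
  obtain ⟨t₀, ht₀, rfl⟩ : ∃ t ∈ Set.Icc (0 : ℝ) 1, γ t = z := by
    rw [edge, segment_eq_image'] at hz
    exact hz
  have hV : IsOpen (γ ⁻¹' Uᶜ) := hU.isOpen_compl.preimage hγ
  obtain ⟨s, hs1, hs2⟩ : (γ ⁻¹' Uᶜ ∩ Set.Ioo (0 : ℝ) 1).Nonempty := by
    have : t₀ ∈ closure (Set.Ioo (0 : ℝ) 1) := by rw [closure_Ioo (by norm_num)]; exact ht₀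
    exact mem_closure_iff.1 this _ hV hzU
  have hW : ¬ (γ ⁻¹' Uᶜ ∩ Set.Ioo (0 : ℝ) 1 ∩ {t : ℝ | OnGrid (γ t)}ᶜ).Countable := by
    intro hcount
    have h1 : (γ ⁻¹' Uᶜ ∩ Set.Ioo (0 : ℝ) 1).Countable := by
      refine (hcount.union (countable_onGrid hk)).mono fun t ht => ?_
      by_cases hg : OnGrid (γ t)
      · exact Or.inr hg
      · exact Or.inl ⟨ht, hg⟩
    exact absurd (h1.dense_compl ℝ |>.inter_open_nonempty _ (hV.inter isOpen_Ioo) ⟨s, hs1, hs2⟩)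
      (by rintro ⟨x, hx, hx'⟩; exact hx' hx)
  -- two of these points lie in the same pentagon `j`, whose intersection with the pentagon `i` is
  -- then contained in an edge of `j` on the separating line, that is, in `U`
  have hWinf : (γ ⁻¹' Uᶜ ∩ Set.Ioo (0 : ℝ) 1 ∩ {t : ℝ | OnGrid (γ t)}ᶜ).Infinite :=
    fun h => hW h.countable
  have hch : ∀ t ∈ γ ⁻¹' Uᶜ ∩ Set.Ioo (0 : ℝ) 1 ∩ {t : ℝ | OnGrid (γ t)}ᶜ,
      ∃ j, j ≠ i ∧ γ t ∈ C.pent j := fun t ht =>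
    C.exists_pent_of_not_onGrid (hγe t ht.1.2) ht.2
  choose! φ hφ using hch
  obtain ⟨t, ht, t', ht', htt, hφt⟩ := hWinf.exists_ne_map_eq_of_mapsTo
    (t := (Set.univ : Set (Fin 3))) (f := φ) (fun _ _ => Set.mem_univ _) Set.finite_univ
  have hj := hφ t ht
  have hj' := hφ t' ht'
  rw [← hφt] at hj'
  set j := φ t
  have hne : γ t ≠ γ t' := fun h => htt (hγinj _ _ h)
  have hi := C.edge_subset i k (hγe t ht.1.2)
  have hi' := C.edge_subset i k (hγe t' ht'.1.2)
  obtain ⟨m, hm, hm'⟩ := C.exists_on hj.1 hne hj.2 hj'.2 hi hi'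
  have hon : C.On i j k := by
    have aff := C.isAff i j hj.1.symm
    have e : ∀ t, C.h i j (γ t) = (1 - t) * C.h i j a + t * C.h i j b := fun t => by
      rw [← aff.combo a b (by ring : 1 - t + t = 1)]
      congr 1
      simp only [γ]
      module
    have e1 := C.h_eq_zero hj.1.symm hi hj.2
    have e2 := C.h_eq_zero hj.1.symm hi' hj'.2
    rw [e] at e1 e2
    have hne' : t - t' ≠ 0 := sub_ne_zero.2 htt
    have e3 : (t - t') * (C.h i j b - C.h i j a) = 0 := by linear_combination e1 - e2
    have e4 := (mul_eq_zero.1 e3).resolve_left hne'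
    have e5 : C.h i j a = 0 := by linear_combination e1 - t * e4
    exact ⟨e5, by linarith⟩
  exact ht.1.1 (Set.mem_iUnion.2 ⟨⟨(j, m), hj.1, hon, hm⟩, hm' _ hj.2 hi⟩)

end Config

/-! ### Segments -/

theorem dist_eq_sqrt (a b : Plane) : dist a b = √(nsq (a - b)) := by
  rw [← dist_sq_eq, Real.sqrt_sq dist_nonneg]

theorem dist_le_of_mem_segment {a b c d : Plane} (ha : a ∈ segment ℝ c d)
    (hb : b ∈ segment ℝ c d) : dist a b ≤ dist c d := by
  rw [segment_eq_image'] at ha hb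
  obtain ⟨s, ⟨hs0, hs1⟩, rfl⟩ := ha
  obtain ⟨t, ⟨ht0, ht1⟩, rfl⟩ := hb
  rw [dist_eq_norm, show c + s • (d - c) - (c + t • (d - c)) = (s - t) • (d - c) by module,
    norm_smul, dist_comm, dist_eq_norm, Real.norm_eq_abs]
  exact mul_le_of_le_one_left (norm_nonneg _) (abs_le.2 ⟨by linarith, by linarith⟩)

theorem endpoints_of_dist_le {a b c d : Plane} (hcd : c ≠ d) (ha : a ∈ segment ℝ c d)
    (hb : b ∈ segment ℝ c d) (h : dist c d ≤ dist a b) :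
    (a = c ∧ b = d) ∨ (a = d ∧ b = c) := by
  rw [segment_eq_image'] at ha hb
  obtain ⟨s, ⟨hs0, hs1⟩, rfl⟩ := ha
  obtain ⟨t, ⟨ht0, ht1⟩, rfl⟩ := hb
  have hpos : 0 < ‖d - c‖ := norm_pos_iff.2 (sub_ne_zero.2 hcd.symm)
  simp only at h
  rw [dist_eq_norm (c + s • (d - c)),
    show c + s • (d - c) - (c + t • (d - c)) = (s - t) • (d - c) by module,
    norm_smul, dist_comm, dist_eq_norm, Real.norm_eq_abs] at h
  have h1 : 1 ≤ |s - t| := by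
    by_contra! hlt
    nlinarith
  rcases le_abs.1 h1 with h1 | h1
  · have e1 : s = 1 := by linarith
    have e2 : t = 0 := by linarith
    right
    subst e1 e2
    constructor <;> simp
  · have e1 : s = 0 := by linarith
    have e2 : t = 1 := by linarith
    left
    subst e1 e2
    constructor <;> simp

theorem IsAff.eq_zero_of_mem_segment {f : Plane → ℝ} (hf : IsAff f) {a b p q : Plane}
    (hpq : p ≠ q) (hp : p ∈ segment ℝ a b) (hq : q ∈ segment ℝ a b) (hp0 : f p = 0)
    (hq0 : f q = 0) : f a = 0 ∧ f b = 0 := by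
  obtain ⟨s, s', -, -, hs, rfl⟩ := hp
  obtain ⟨t, t', -, -, ht, rfl⟩ := hq
  rw [hf.combo _ _ hs] at hp0
  rw [hf.combo _ _ ht] at hq0
  obtain rfl : s' = 1 - s := by linarith
  obtain rfl : t' = 1 - t := by linarith
  have hst : s - t ≠ 0 := by
    intro h
    apply hpq
    rw [sub_eq_zero.1 h]
  have e1 : (s - t) * (f a - f b) = 0 := by linear_combination hp0 - hq0
  have e2 := (mul_eq_zero.1 e1).resolve_left hst
  constructor
  · linear_combination hp0 + (1 - s) * e2
  · linear_combination hp0 - s * e2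

/-! ### Lines of the tiling -/

theorem IntLine.of_collinear {a b c d : Plane} (h : IntLine a b) (hab : a ≠ b)
    (hc : cr a b c = 0) (hd : cr a b d = 0) : IntLine c d := by
  obtain ⟨s, rfl⟩ := eq_lineMap_of_cr_eq_zero hab hc
  obtain ⟨t, rfl⟩ := eq_lineMap_of_cr_eq_zero hab hd
  obtain ⟨n, h | h | h⟩ := h
  · exact ⟨n, Or.inl (by simp [h.1, h.2])⟩
  · exact ⟨n, Or.inr (Or.inl (by simp [h.1, h.2]))⟩
  · refine ⟨n, Or.inr (Or.inr ?_)⟩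
    simp only [X_add, Y_add, X_smul, Y_smul, X_sub, Y_sub]
    exact ⟨by linear_combination (1 - s) * h.1 + s * h.2,
      by linear_combination (1 - t) * h.1 + t * h.2⟩

theorem LatDir.of_collinear {a b c d : Plane} (h : LatDir a b) (hab : a ≠ b)
    (hc : cr a b c = 0) (hd : cr a b d = 0) : LatDir c d := by
  obtain ⟨s, rfl⟩ := eq_lineMap_of_cr_eq_zero hab hc
  obtain ⟨t, rfl⟩ := eq_lineMap_of_cr_eq_zero hab hd
  rcases h with h | h | h
  · exact Or.inl (by simp [h])
  · exact Or.inr (Or.inl (by simp [h]))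
  · refine Or.inr (Or.inr ?_)
    simp only [X_add, Y_add, X_smul, Y_smul, X_sub, Y_sub]
    linear_combination (t - s) * h

/-- A direction is parallel to the tiling if and only if its angle with a line of the tiling is a
multiple of 60 degrees, which is a condition on scalar products. -/
theorem latDir_iff {a b c d : Plane} (h : LatDir a b) (hab : a ≠ b) :
    LatDir c d ↔ (ip (d - c) (b - a) ^ 2 - nsq (d - c) * nsq (b - a)) *
      (4 * ip (d - c) (b - a) ^ 2 - nsq (d - c) * nsq (b - a)) = 0 := by
  obtain ⟨x, hx⟩ : ∃ x, x = X b - X a := ⟨_, rfl⟩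
  obtain ⟨y, hy⟩ : ∃ y, y = Y b - Y a := ⟨_, rfl⟩
  obtain ⟨p, hp⟩ : ∃ x, x = X d - X c := ⟨_, rfl⟩
  obtain ⟨q, hq⟩ : ∃ y, y = Y d - Y c := ⟨_, rfl⟩
  have hL : LatDir c d ↔ p * q * (p + q) = 0 := by
    rw [LatDir, mul_eq_zero, mul_eq_zero, hp, hq, or_assoc]
    refine or_congr ?_ (or_congr ?_ ?_)
    · rw [sub_eq_zero, eq_comm]
    · rw [sub_eq_zero, eq_comm]
    · constructor <;> intro h <;> linarith
  have h0 : x ≠ 0 ∨ y ≠ 0 := by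
    by_contra! h0
    exact hab (ext_XY (by linarith [h0.1]) (by linarith [h0.2]))
  rw [hL]
  simp only [ip, nsq, X_sub, Y_sub, ← hx, ← hy, ← hp, ← hq]
  -- in each of the three cases the left hand side is a product of `p * q * (p + q)` and a factor
  -- that vanishes only if `p * q * (p + q)` does
  have hxy : x = 0 ∨ y = 0 ∨ x + y = 0 := by
    rcases h with h | h | h
    · exact Or.inl (by linarith)
    · exact Or.inr (Or.inl (by linarith))
    · exact Or.inr (Or.inr (by linarith))
  rcases hxy with h1 | h1 | h1
  · have hy0 : y ≠ 0 := h0.resolve_left (not_not.2 h1)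
    rw [show ((p * x + (p * y + x * q) / 2 + q * y) ^ 2 - (p ^ 2 + p * q + q ^ 2) *
      (x ^ 2 + x * y + y ^ 2)) * (4 * (p * x + (p * y + x * q) / 2 + q * y) ^ 2 -
      (p ^ 2 + p * q + q ^ 2) * (x ^ 2 + x * y + y ^ 2)) =
      (-9 / 4 * y ^ 4 * p) * (p * q * (p + q)) by rw [h1]; ring]
    constructor
    · intro h; rw [h, mul_zero]
    · intro h
      rcases mul_eq_zero.1 h with h | h
      · have : p = 0 := by simpa [hy0] using h
        rw [this]; ring
      · exact h
  · have hx0 : x ≠ 0 := h0.resolve_right (not_not.2 h1)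
    rw [show ((p * x + (p * y + x * q) / 2 + q * y) ^ 2 - (p ^ 2 + p * q + q ^ 2) *
      (x ^ 2 + x * y + y ^ 2)) * (4 * (p * x + (p * y + x * q) / 2 + q * y) ^ 2 -
      (p ^ 2 + p * q + q ^ 2) * (x ^ 2 + x * y + y ^ 2)) =
      (-9 / 4 * x ^ 4 * q) * (p * q * (p + q)) by rw [h1]; ring]
    constructor
    · intro h; rw [h, mul_zero]
    · intro h
      rcases mul_eq_zero.1 h with h | h
      · have : q = 0 := by simpa [hx0] using h
        rw [this]; ring
      · exact h
  · have h2 : y = -x := by linarith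
    have hx0 : x ≠ 0 := by
      rintro rfl
      simp [h2] at h0
    rw [show ((p * x + (p * y + x * q) / 2 + q * y) ^ 2 - (p ^ 2 + p * q + q ^ 2) *
      (x ^ 2 + x * y + y ^ 2)) * (4 * (p * x + (p * y + x * q) / 2 + q * y) ^ 2 -
      (p ^ 2 + p * q + q ^ 2) * (x ^ 2 + x * y + y ^ 2)) =
      (9 / 4 * x ^ 4 * (p + q)) * (p * q * (p + q)) by rw [h2]; ring]
    constructor
    · intro h; rw [h, mul_zero]
    · intro h
      rcases mul_eq_zero.1 h with h | h
      · have : p + q = 0 := by simpa [hx0] using h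
        rw [this]; ring
      · exact h

/-- Lattice points of the plane. -/
def IsLatt (z : Plane) : Prop := ∃ m n : ℤ, X z = m ∧ Y z = n

/-- Two lines of the tiling that are not parallel meet in a lattice point. -/
theorem isLatt_of_intLine {a b c : Plane} (h1 : IntLine a b) (h2 : IntLine b c)
    (h : cr a b c ≠ 0) : IsLatt b := by
  obtain ⟨m, h1⟩ := h1
  obtain ⟨n, h2⟩ := h2
  rcases h1 with h1 | h1 | h1 <;> rcases h2 with h2 | h2 | h2
  · exact absurd (by unfold cr; rw [h1.1, h1.2, h2.2, ← h2.1, h1.2]; ring) h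
  · exact ⟨m, n, h1.2, h2.1⟩
  · exact ⟨m, n - m, h1.2, by push_cast; linarith [h1.2, h2.1]⟩
  · exact ⟨n, m, h2.1, h1.2⟩
  · exact absurd (by unfold cr; rw [h1.1, h1.2, h2.2, ← h2.1, h1.2]; ring) h
  · exact ⟨n - m, m, by push_cast; linarith [h1.2, h2.1], h1.2⟩
  · exact ⟨n, m - n, h2.1, by push_cast; linarith [h1.2, h2.1]⟩
  · exact ⟨m - n, n, by push_cast; linarith [h1.2, h2.1], h2.1⟩
  · refine absurd ?_ h
    have e1 : Y a = m - X a := by linarith [h1.1]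
    have e2 : Y b = m - X b := by linarith [h1.2]
    have e3 : Y c = m - X c := by linarith [h1.2, h2.1, h2.2]
    unfold cr
    rw [e1, e2, e3]
    ring

/-- Lattice points on a line of the tiling have integral distance. -/
theorem IsLatt.dist_eq_int {a b : Plane} (ha : IsLatt a) (hb : IsLatt b) (h : LatDir a b) :
    ∃ n : ℤ, dist a b = n := by
  obtain ⟨p, q, hp, hq⟩ := ha
  obtain ⟨r, s, hr, hs⟩ := hb
  have key : ∀ n : ℤ, nsq (a - b) = (n : ℝ) ^ 2 → ∃ n : ℤ, dist a b = n := fun n hn =>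
    ⟨|n|, by rw [dist_eq_sqrt, hn, Real.sqrt_sq_eq_abs, Int.cast_abs]⟩
  simp only [nsq, X_sub, Y_sub, hp, hq, hr, hs] at key
  unfold LatDir at h
  rw [hp, hq, hr, hs] at h
  rcases h with h | h | h
  · exact key (q - s) (by rw [h]; push_cast; ring)
  · exact key (p - r) (by rw [h]; push_cast; ring)
  · refine key (p - r) ?_
    rw [show (q : ℝ) = r + s - p by linarith]
    push_cast
    ring

theorem IsLatt.cr_eq_int {a b c : Plane} (ha : IsLatt a) (hb : IsLatt b) (hc : IsLatt c) :
    ∃ n : ℤ, cr a b c = n := by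
  obtain ⟨p, q, hp, hq⟩ := ha
  obtain ⟨r, s, hr, hs⟩ := hb
  obtain ⟨t, u, ht, hu⟩ := hc
  refine ⟨(r - p) * (u - q) - (t - p) * (s - q), ?_⟩
  unfold cr
  rw [hp, hq, hr, hs, ht, hu]
  push_cast
  ring

namespace Config

variable {T : Finset Cell} (C : Config T)

/-! ### Contacts of the pentagons of a trisection -/

theorem dist_eq (i j : Fin 3) (k l : Fin 5) :
    dist (C.w i k) (C.w i l) = dist (C.w j k) (C.w j l) :=
  nsq_eq_iff_dist.1 (C.nsq_eq i j k l)

theorem ip_eq (i j : Fin 3) (a b c : Fin 5) :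
    ip (C.w i a - C.w i b) (C.w i c - C.w i b) = ip (C.w j a - C.w j b) (C.w j c - C.w j b) := by
  rw [Polyiamond.ip_eq, Polyiamond.ip_eq, C.nsq_eq i j, C.nsq_eq i j, C.nsq_eq i j]

/-- The three pentagons have equal areas with sum seven. -/
theorem area (hT : T.card = 7) (i : Fin 3) : C.ε i * pentArea (C.w i) = 7 / 3 := by
  have h1 : volume (region T) = ∑ j, volume (C.pent j) := by
    rw [← C.cover, ← tsum_fintype (L := .unconditional _)]
    refine measure_iUnion₀ ?_ fun j => (C.isCompact_pent j).measurableSet.nullMeasurableSet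
    intro j k hjk
    refine measure_mono_null ?_ (null_line (C.isAff j k hjk))
    rintro z ⟨hz1, hz2⟩
    exact C.h_eq_zero hjk hz1 hz2
  have h2 : ∀ j, volume (C.pent j) = ENNReal.ofReal (C.ε i * pentArea (C.w i)) * cellVol :=
    fun j => by rw [C.area_eq i j]; exact (C.cyc j).volume_eq (C.sign j)
  rw [volume_region, hT, Finset.sum_congr rfl fun j _ => h2 j, Finset.sum_const, nsmul_eq_mul,
    ← mul_assoc] at h1
  have h3 := (ENNReal.mul_left_inj cellVol_ne_zero cellVol_ne_top).1 h1
  have h4 := congrArg ENNReal.toReal h3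
  have h5 := (C.cyc i).area_pos
  simp [ENNReal.toReal_mul, ENNReal.toReal_ofReal h5.le] at h4
  linarith

/-- An edge off the lines of the tiling lies on a line separating its pentagon from another one;
this gives at most two such edges. -/
theorem card_not_isInt_le (i : Fin 3) (s : Finset (Fin 5)) (hs : ∀ k ∈ s, ¬ C.IsInt i k) :
    s.card ≤ 2 := by
  have h : ∀ k ∈ s, ∃ j, j ≠ i ∧ C.On i j k := fun k hk => by
    obtain ⟨j, hj, m, h1, -, -⟩ := C.exists_contact (hs k hk) (left_mem_segment ℝ _ _)
    exact ⟨j, hj, h1⟩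
  choose! φ hφ hφ' using h
  have := Finset.card_le_card_of_injOn (t := Finset.univ.erase i) φ
    (fun k hk => Finset.mem_erase.2 ⟨hφ k hk, Finset.mem_univ _⟩) (fun k hk l hl hkl => by
      have h2 := hφ' l hl
      rw [← hkl] at h2
      exact C.on_unique (hφ k hk).symm (hφ' k hk) h2)
  simpa using this

variable {C}

theorem On.cr_eq_zero {i j : Fin 3} (hij : i ≠ j) {a b : Fin 5} (h : C.On i j a)
    (h' : C.On j i b) : cr (C.w i a) (C.w i (a + 1)) (C.w j b) = 0 ∧
      cr (C.w i a) (C.w i (a + 1)) (C.w j (b + 1)) = 0 := by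
  have e : ∀ z, C.h j i z = 0 → C.h i j z = 0 := fun z hz => by
    have := C.anti i j z
    linarith
  exact ⟨(C.isAff i j hij).cr_eq_zero h.1 h.2 (e _ h'.1),
    (C.isAff i j hij).cr_eq_zero h.1 h.2 (e _ h'.2)⟩

theorem On.isInt {i j : Fin 3} (hij : i ≠ j) {a b : Fin 5} (h : C.On i j a)
    (h' : C.On j i b) (ha : C.IsInt i a) : C.IsInt j b :=
  ha.of_collinear ((C.cyc i).ne_succ a) (h.cr_eq_zero hij h').1 (h.cr_eq_zero hij h').2

theorem On.lat {i j : Fin 3} (hij : i ≠ j) {a b : Fin 5} (h : C.On i j a)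
    (h' : C.On j i b) (ha : C.Lat i a) : C.Lat j b :=
  ha.of_collinear ((C.cyc i).ne_succ a) (h.cr_eq_zero hij h').1 (h.cr_eq_zero hij h').2

/-- Pentagons with edges on a common separating line lie on different sides of it. -/
theorem On.mul_neg {i j : Fin 3} (hij : i ≠ j) {a b : Fin 5} (h : C.On i j a)
    (h' : C.On j i b) {f : Plane → ℝ} (hf : IsAff f) (h1 : f (C.w i a) = 0)
    (h2 : f (C.w i (a + 1)) = 0) : f (C.w i (a + 2)) * f (C.w j (b + 2)) < 0 := by
  have e : ∀ z, C.h j i z = 0 → C.h i j z = 0 := fun z hz => by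
    have := C.anti i j z
    linarith
  have d1 : ∀ k : Fin 5, k ≠ k + 1 ∧ k + 1 ≠ k + 2 ∧ k ≠ k + 2 := by decide
  have hne : ∀ i a, C.w i (a + 2) ∈ C.pent i := fun i a => subset_convexHull ℝ _ ⟨a + 2, rfl⟩
  obtain ⟨c, hc, hc'⟩ := hf.eq_cr ((C.cyc i).ne_succ a) h1 h2
  obtain ⟨d, hd, hd'⟩ := (C.isAff i j hij).eq_cr ((C.cyc i).ne_succ a) h.1 h.2
  have p1 := C.nonneg i j hij _ (hne i a)
  have p2 := C.nonneg j i hij.symm _ (hne j b)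
  have p3 : cr (C.w i a) (C.w i (a + 1)) (C.w i (a + 2)) ≠ 0 :=
    (C.cyc i).cr_ne (d1 a).1 (d1 a).2.1 (d1 a).2.2
  have p4 : cr (C.w i a) (C.w i (a + 1)) (C.w j (b + 2)) ≠ 0 := by
    intro h0
    have q : C.h i j (C.w j (b + 2)) = 0 := by rw [hd', h0, mul_zero]
    exact (C.cyc j).cr_ne (d1 b).1 (d1 b).2.1 (d1 b).2.2
      ((C.isAff i j hij).cr_eq_zero (e _ h'.1) (e _ h'.2) q)
  rw [C.anti, hd'] at p2
  rw [hd'] at p1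
  set x := cr (C.w i a) (C.w i (a + 1)) (C.w i (a + 2))
  set y := cr (C.w i a) (C.w i (a + 1)) (C.w j (b + 2))
  have q1 : 0 < d * x := lt_of_le_of_ne p1 (mul_ne_zero hd p3).symm
  have q2 : d * y < 0 := lt_of_le_of_ne (by linarith) (mul_ne_zero hd p4)
  have q3 : d ^ 2 * (x * y) < 0 := by nlinarith [mul_neg_of_pos_of_neg q1 q2]
  have q4 : x * y < 0 := by
    by_contra! hxy
    exact absurd (mul_nonneg (sq_nonneg d) hxy) (not_le.2 q3)
  rw [hc', hc']
  have hc2 : 0 < c ^ 2 := by positivity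
  nlinarith [mul_neg_of_pos_of_neg hc2 q4]

/-- Three pentagons cannot pairwise lie on different sides of one line. -/
theorem not_on_three {i j k : Fin 3} (hij : i ≠ j) (hjk : j ≠ k) (hik : i ≠ k) {a b c : Fin 5}
    (h1 : C.On i j a) (h2 : C.On j i b) (h3 : C.On j k b) (h4 : C.On k j c) (h5 : C.On i k a)
    (h6 : C.On k i c) : False := by
  have hf := C.isAff i j hij
  have e : ∀ z, C.h j i z = 0 → C.h i j z = 0 := fun z hz => by
    have := C.anti i j z
    linarith
  have q1 := h1.mul_neg hij h2 hf h1.1 h1.2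
  have q2 := h3.mul_neg hjk h4 hf (e _ h2.1) (e _ h2.2)
  have q3 := h5.mul_neg hik h6 hf h1.1 h1.2
  set x := C.h i j (C.w i (a + 2))
  set y := C.h i j (C.w j (b + 2))
  set z := C.h i j (C.w k (c + 2))
  nlinarith [mul_pos_of_neg_of_neg q1 q2, mul_nonneg (sq_nonneg y) (sq_nonneg x),
    mul_neg_of_pos_of_neg (mul_pos_of_neg_of_neg q1 q2) q3, sq_nonneg (x * y * z)]

/-- An edge that has two points in common with another pentagon lies on the separating line. -/
theorem on_of_common {i j : Fin 3} (hij : i ≠ j) {a : Fin 5} {p q : Plane} (hpq : p ≠ q)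
    (hp : p ∈ C.edge i a) (hq : q ∈ C.edge i a) (hp' : p ∈ C.pent j) (hq' : q ∈ C.pent j) :
    C.On i j a :=
  (C.isAff i j hij).eq_zero_of_mem_segment hpq hp hq (C.h_eq_zero hij (C.edge_subset _ _ hp) hp')
    (C.h_eq_zero hij (C.edge_subset _ _ hq) hq')

/-- An edge off the lines of the tiling that touches only one other pentagon is contained in an
edge of the latter. -/
theorem exists_edge_superset {i j : Fin 3} {a : Fin 5} (ha : ¬ C.IsInt i a)
    (h : ∀ l, l ≠ i → ∀ m, C.On i l a → C.On l i m → l = j) :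
    j ≠ i ∧ ∃ b, C.On i j a ∧ C.On j i b ∧ C.edge i a ⊆ C.edge j b := by
  obtain ⟨l, hl, b, h1, h2, -⟩ := C.exists_contact ha (left_mem_segment ℝ _ _)
  obtain rfl := h l hl b h1 h2
  refine ⟨hl, b, h1, h2, fun z hz => ?_⟩
  obtain ⟨l', hl', b', h1', h2', hz'⟩ := C.exists_contact ha hz
  obtain rfl := h l' hl' b' h1' h2'
  rwa [C.on_unique hl h2 h2']

theorem edge_endpoints {i j : Fin 3} {a b : Fin 5} (h : C.edge i a ⊆ C.edge j b)
    (hd : dist (C.w j b) (C.w j (b + 1)) ≤ dist (C.w i a) (C.w i (a + 1))) :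
    (C.w i a = C.w j b ∧ C.w i (a + 1) = C.w j (b + 1)) ∨
      (C.w i a = C.w j (b + 1) ∧ C.w i (a + 1) = C.w j b) :=
  endpoints_of_dist_le ((C.cyc j).ne_succ b) (h (left_mem_segment ℝ _ _))
    (h (right_mem_segment ℝ _ _)) hd

theorem edge_eq {i j : Fin 3} {a b : Fin 5} (h : C.edge i a ⊆ C.edge j b)
    (hd : dist (C.w j b) (C.w j (b + 1)) ≤ dist (C.w i a) (C.w i (a + 1))) :
    C.edge i a = C.edge j b := by
  unfold edge
  rcases edge_endpoints h hd with ⟨h1, h2⟩ | ⟨h1, h2⟩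
  · rw [h1, h2]
  · rw [h1, h2, segment_symm]

/-- It cannot happen that the edges with a given index lie off the lines of the tiling and touch
each other only. -/
theorem not_three_equal {k : Fin 5} (hk : ∀ i, ¬ C.IsInt i k)
    (h : ∀ i j m, i ≠ j → C.On i j k → C.On j i m → m = k) : False := by
  -- if `i` touches both `j` and `l`, then these do not touch each other, so that the edges of all
  -- three coincide
  have path : ∀ i j l : Fin 3, i ≠ j → i ≠ l → j ≠ l → C.On i j k → C.On j i k → C.On i l k →
      C.On l i k → False := by
    intro i j l hij hil hjl h1 h2 h3 h4
    have hno : ¬ (C.On j l k ∧ C.On l j k) := fun h5 =>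
      not_on_three hij hjl hil h1 h2 h5.1 h5.2 h3 h4
    have only : ∀ j l : Fin 3, i ≠ j → i ≠ l → j ≠ l → ¬ (C.On j l k ∧ C.On l j k) →
        C.edge j k = C.edge i k := by
      intro j l hij hil hjl hno
      obtain ⟨-, b, h6, h7, h8⟩ := exists_edge_superset (i := j) (j := i) (hk j) (by
        intro l' hl' m h6 h7
        by_contra hl
        obtain rfl : l' = l :=
          (by decide : ∀ i j l l' : Fin 3, i ≠ j ∧ i ≠ l ∧ j ≠ l ∧ l' ≠ j ∧ l' ≠ i → l' = l)
            i j l l' ⟨hij, hil, hjl, hl', hl⟩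
        obtain rfl := h j l' m hjl h6 h7
        exact hno ⟨h6, h7⟩)
      obtain rfl := h j i b hij.symm h6 h7
      exact edge_eq h8 (C.dist_eq _ _ _ _).le
    have e1 := only j l hij hil hjl hno
    have e2 := only l j hil hij hjl.symm fun h => hno ⟨h.2, h.1⟩
    have e3 : C.edge j k = C.edge l k := e1.trans e2.symm
    have l1 : C.w j k ∈ C.edge j k := left_mem_segment ℝ _ _
    have l2 : C.w j (k + 1) ∈ C.edge j k := right_mem_segment ℝ _ _
    have ne := (C.cyc j).ne_succ k
    exact hno ⟨on_of_common hjl ne l1 l2 (C.edge_subset l k (e3 ▸ l1))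
      (C.edge_subset l k (e3 ▸ l2)),
      on_of_common hjl.symm ne (e3 ▸ l1) (e3 ▸ l2) (C.edge_subset j k l1) (C.edge_subset j k l2)⟩
  have ex : ∀ i, ∃ j, j ≠ i ∧ C.On i j k ∧ C.On j i k := fun i => by
    obtain ⟨j, hj, m, h1, h2, -⟩ := C.exists_contact (hk i) (left_mem_segment ℝ _ _)
    obtain rfl := h i j m hj.symm h1 h2
    exact ⟨j, hj, h1, h2⟩
  choose φ hφ hφ1 hφ2 using ex
  -- a map of three points without fixed points has a fibre or a path with two edges
  obtain ⟨i, j, hij, hj⟩ : ∃ i j, i ≠ j ∧ φ j = i ∧ φ i ≠ j :=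
    (by decide : ∀ φ : Fin 3 → Fin 3, (∀ i, φ i ≠ i) → ∃ i j, i ≠ j ∧ φ j = i ∧ φ i ≠ j) φ hφ
  obtain ⟨rfl, hj⟩ := hj
  exact path (φ j) j (φ (φ j)) hij (hφ _).symm (Ne.symm hj) (hφ2 j) (hφ1 j) (hφ1 _) (hφ2 _)

variable (C) in
/-- Which edges are parallel to the tiling is the same for all three pentagons: any two of them have
a common index whose edges lie on lines of the tiling, and the angles with these edges agree. -/
theorem lat_of_lat (i j : Fin 3) (m : Fin 5) (h : C.Lat i m) : C.Lat j m := by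
  classical
  -- at most two of the five edges of either pentagon are off the lines
  obtain ⟨k, hk, hk'⟩ : ∃ k, C.IsInt i k ∧ C.IsInt j k := by
    by_contra! hno
    have h1 := C.card_not_isInt_le i {k | ¬ C.IsInt i k} (by simp)
    have h2 := C.card_not_isInt_le j {k | ¬ C.IsInt j k} (by simp)
    have h3 : (Finset.univ : Finset (Fin 5)) ⊆
        ({k | ¬ C.IsInt i k} : Finset (Fin 5)) ∪ ({k | ¬ C.IsInt j k} : Finset (Fin 5)) := by
      intro k _
      simp only [Finset.mem_union, Finset.mem_filter, Finset.mem_univ, true_and]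
      by_cases hk : C.IsInt i k
      · exact Or.inr (hno k hk)
      · exact Or.inl hk
    have h4 := (Finset.card_le_card h3).trans (Finset.card_union_le _ _)
    rw [Finset.card_univ, Fintype.card_fin] at h4
    omega
  have key : ∀ i, C.IsInt i k → (C.Lat i m ↔ _) := fun i hi =>
    latDir_iff (c := C.w i m) (d := C.w i (m + 1)) hi.latDir ((C.cyc i).ne_succ k)
  have hip : ∀ i, ip (C.w i (m + 1) - C.w i m) (C.w i (k + 1) - C.w i k) =
      (nsq (C.w i (m + 1) - C.w i k) + nsq (C.w i m - C.w i (k + 1)) -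
        nsq (C.w i (m + 1) - C.w i (k + 1)) - nsq (C.w i m - C.w i k)) / 2 := fun i => by
    simp only [ip, nsq, X_sub, Y_sub]; ring
  rw [key i hk, hip] at h
  rw [key j hk', hip]
  simpa only [C.nsq_eq j i] using h

end Config

/-! ### Pentagons with edges parallel to the tiling -/

/-- The six directions of the edges of the tiling, in counterclockwise order. -/
def hexDir : Fin 6 → Plane := ![pt 1 0, pt 0 1, pt (-1) 1, pt (-1) 0, pt 0 (-1), pt 1 (-1)]

@[simp] theorem X_neg (z : Plane) : X (-z) = -X z := by simp [X]; ring
@[simp] theorem Y_neg (z : Plane) : Y (-z) = -Y z := by simp [Y]; ring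

/-- A segment parallel to the tiling has one of the six directions. -/
theorem exists_hexDir {a b : Plane} (h : LatDir a b) : ∃ θ, b - a = dist a b • hexDir θ := by
  have key : ∀ (r : ℝ) (θ θ' : Fin 6), hexDir θ' = -hexDir θ → nsq (hexDir θ) = 1 →
      b - a = r • hexDir θ → ∃ θ, b - a = dist a b • hexDir θ := by
    intro r θ θ' h1 h2 h3
    have hr : dist a b = |r| := by
      rw [dist_comm, dist_eq_sqrt, h3, ← Real.sqrt_sq_eq_abs]
      congr 1
      have : nsq (r • hexDir θ) = r ^ 2 * nsq (hexDir θ) := by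
        simp only [nsq, X_smul, Y_smul]; ring
      rw [this, h2, mul_one]
    rcases le_total 0 r with h0 | h0
    · exact ⟨θ, by rw [hr, abs_of_nonneg h0, h3]⟩
    · exact ⟨θ', by rw [hr, abs_of_nonpos h0, h1, h3, smul_neg, neg_smul, neg_neg]⟩
  have neg : ∀ x y, pt (-x) (-y) = -pt x y := fun x y => ext_XY
    (by simp) (by simp)
  rcases h with h | h | h
  · refine key (Y b - Y a) 1 4 ?_ ?_ (ext_XY ?_ ?_) <;> simp [hexDir, nsq, ← neg, h]
  · refine key (X b - X a) 0 3 ?_ ?_ (ext_XY ?_ ?_) <;> simp [hexDir, nsq, ← neg, h]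
  · refine key (X b - X a) 5 2 ?_ ?_ (ext_XY ?_ ?_) <;> simp [hexDir, nsq, ← neg]
    linarith

/-- At a left turn the direction changes by 60 or 120 degrees. -/
theorem hexDir_turn {a b c : Plane} {θ θ' : Fin 6} {r s : ℝ} (hr : 0 < r) (hs : 0 < s)
    (h1 : b - a = r • hexDir θ) (h2 : c - b = s • hexDir θ') (h : 0 < cr a b c) :
    θ' = θ + 1 ∨ θ' = θ + 2 := by
  have e : cr a b c = r * s * (X (hexDir θ) * Y (hexDir θ') - X (hexDir θ') * Y (hexDir θ)) := by
    have e1 : cr a b c = X (b - a) * Y (c - b) - X (c - b) * Y (b - a) := by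
      simp only [cr, X_sub, Y_sub]; ring
    rw [e1, h1, h2]
    simp only [X_smul, Y_smul]
    ring
  rw [e] at h
  have h' := (pos_iff_pos_of_mul_pos h).1 (mul_pos hr hs)
  fin_cases θ <;> fin_cases θ' <;> first | decide | (norm_num [hexDir] at h')

theorem ip_hexDir {a b c : Plane} {θ θ' : Fin 6} {r s : ℝ} (h1 : b - a = r • hexDir θ)
    (h2 : c - b = s • hexDir θ') :
    ip (a - b) (c - b) = -(r * s * ip (hexDir θ) (hexDir θ')) := by
  have e : ip (a - b) (c - b) = -ip (b - a) (c - b) := by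
    simp only [ip, X_sub, Y_sub]; ring
  rw [e, h1, h2]
  simp only [ip, X_smul, Y_smul]
  ring

theorem ip_hexDir_one (θ : Fin 6) : ip (hexDir θ) (hexDir (θ + 1)) = 1 / 2 := by
  fin_cases θ <;> simp [hexDir, ip] <;> norm_num

theorem ip_hexDir_two (θ : Fin 6) : ip (hexDir θ) (hexDir (θ + 2)) = -1 / 2 := by
  fin_cases θ <;> simp [hexDir, ip] <;> norm_num

/-- The turning angles of a pentagon parallel to the tiling are multiples of 60 degrees with sum
360 degrees, so that exactly one of them is 120 degrees. -/
theorem exists_turn (θ : Fin 5 → Fin 6) (h : ∀ m, θ (m + 1) = θ m + 1 ∨ θ (m + 1) = θ m + 2) :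
    ∃ t, θ (t + 1) = θ t + 1 ∧ θ (t + 2) = θ (t + 1) + 1 ∧ θ (t + 3) = θ (t + 2) + 1 ∧
      θ (t + 4) = θ (t + 3) + 1 ∧ θ t = θ (t + 4) + 2 := by
  have key : ∀ a b : Fin 6, (b = a + 1 ∨ b = a + 2) → ∀ c, (c = b + 1 ∨ c = b + 2) →
      ∀ d, (d = c + 1 ∨ d = c + 2) → ∀ e, (e = d + 1 ∨ e = d + 2) → (a = e + 1 ∨ a = e + 2) →
      (b = a + 1 ∧ c = b + 1 ∧ d = c + 1 ∧ e = d + 1 ∧ a = e + 2) ∨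
      (c = b + 1 ∧ d = c + 1 ∧ e = d + 1 ∧ a = e + 1 ∧ b = a + 2) ∨
      (d = c + 1 ∧ e = d + 1 ∧ a = e + 1 ∧ b = a + 1 ∧ c = b + 2) ∨
      (e = d + 1 ∧ a = e + 1 ∧ b = a + 1 ∧ c = b + 1 ∧ d = c + 2) ∨
      (a = e + 1 ∧ b = a + 1 ∧ c = b + 1 ∧ d = c + 1 ∧ e = d + 2) := by
    decide +kernel
  rcases key (θ 0) (θ 1) (h 0) (θ 2) (h 1) (θ 3) (h 2) (θ 4) (h 3) (h 4) with h | h | h | h | h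
  · exact ⟨0, h⟩
  · exact ⟨1, h⟩
  · exact ⟨2, h⟩
  · exact ⟨3, h⟩
  · exact ⟨4, h⟩

theorem pentArea_rotate (v : Fin 5 → Plane) (n : Fin 5) :
    pentArea (fun k => v (k + n)) = pentArea v := by
  have e : ∀ v : Fin 5 → Plane, pentArea (fun k => v (k + 1)) = pentArea v := fun v => by
    simp only [pentArea, cr]
    have e0 : (0 : Fin 5) + 1 = 1 := rfl
    have e1 : (1 : Fin 5) + 1 = 2 := rfl
    have e2 : (2 : Fin 5) + 1 = 3 := rfl
    have e3 : (3 : Fin 5) + 1 = 4 := rfl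
    have e4 : (4 : Fin 5) + 1 = 0 := rfl
    simp only [e0, e1, e2, e3, e4]
    ring
  have k1 := e v
  have k2 := (e fun k => v (k + 1)).trans k1
  have k3 := (e _).trans k2
  have k4 := (e _).trans k3
  simp only [add_assoc] at k2 k3 k4
  fin_cases n
  · simp
  · exact k1
  · exact k2
  · exact k3
  · exact k4

/-- The closing relations and the area of a pentagon parallel to the tiling, with successive
directions `θ`, …, `θ + 4`. The area is that of a triangle with side `a + b`, from which two
triangles with sides `b` and `d` are cut off. -/
theorem hex_closing {v : Fin 5 → Plane} {a b c d e : ℝ} {θ : Fin 6}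
    (h0 : v 1 - v 0 = a • hexDir θ) (h1 : v 2 - v 1 = b • hexDir (θ + 1))
    (h2 : v 3 - v 2 = c • hexDir (θ + 2)) (h3 : v 4 - v 3 = d • hexDir (θ + 3))
    (h4 : v 0 - v 4 = e • hexDir (θ + 4)) :
    a = c + d ∧ e = b + c ∧ pentArea v = (a + b) ^ 2 - b ^ 2 - d ^ 2 := by
  have xy : ∀ {p q : Plane} {r : ℝ} {φ}, p - q = r • hexDir φ →
      X p = X q + r * X (hexDir φ) ∧ Y p = Y q + r * Y (hexDir φ) := fun {p q r φ} h => by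
    constructor
    · have := congrArg X h
      rw [X_sub, X_smul] at this
      linarith
    · have := congrArg Y h
      rw [Y_sub, Y_smul] at this
      linarith
  obtain ⟨x0, y0⟩ := xy h0
  obtain ⟨x1, y1⟩ := xy h1
  obtain ⟨x2, y2⟩ := xy h2
  obtain ⟨x3, y3⟩ := xy h3
  obtain ⟨x4, y4⟩ := xy h4
  rw [x3, x2, x1, x0] at x4
  rw [y3, y2, y1, y0] at y4
  have hA : pentArea v = a * b * (X (hexDir θ) * Y (hexDir (θ + 1)) - X (hexDir (θ + 1)) *
      Y (hexDir θ)) + (a * c * (X (hexDir θ) * Y (hexDir (θ + 2)) - X (hexDir (θ + 2)) *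
      Y (hexDir θ)) + b * c * (X (hexDir (θ + 1)) * Y (hexDir (θ + 2)) - X (hexDir (θ + 2)) *
      Y (hexDir (θ + 1)))) + d * (a * (X (hexDir θ) * Y (hexDir (θ + 3)) - X (hexDir (θ + 3)) *
      Y (hexDir θ)) + b * (X (hexDir (θ + 1)) * Y (hexDir (θ + 3)) - X (hexDir (θ + 3)) *
      Y (hexDir (θ + 1))) + c * (X (hexDir (θ + 2)) * Y (hexDir (θ + 3)) - X (hexDir (θ + 3)) *
      Y (hexDir (θ + 2)))) := by
    unfold pentArea cr
    rw [x3, x2, x1, x0, y3, y2, y1, y0]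
    ring
  have key : a = c + d ∧ e = b + c := by
    clear hA x0 x1 x2 x3 y0 y1 y2 y3 h0 h1 h2 h3 h4
    fin_cases θ <;> simp [hexDir] at x4 y4 <;> constructor <;> linarith
  refine ⟨key.1, key.2, ?_⟩
  obtain ⟨rfl, rfl⟩ := key
  rw [hA]
  clear hA x0 x1 x2 x3 x4 y0 y1 y2 y3 y4 h0 h1 h2 h3 h4
  fin_cases θ <;> simp [hexDir] <;> ring

/-- Exchanging the lattice coordinates is a reflection, so it reverses the orientation. -/
theorem IsCyclic.swap {v : Fin 5 → Plane} {ε : ℝ} (h : IsCyclic ε v) :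
    IsCyclic (-ε) fun k => pt (Y (v k)) (X (v k)) := by
  intro i j k hij hjk
  have := h i j k hij hjk
  simp only [cr, X_pt, Y_pt] at this ⊢
  linarith

/-- The shape of a pentagon whose edges are parallel to the tiling: an equilateral triangle from
which two corners have been cut. The index `t` is that of the vertex with an angle of 60 degrees. -/
theorem IsCyclic.hex_shape {v : Fin 5 → Plane} {ε : ℝ} (hε : ε = 1 ∨ ε = -1) (h : IsCyclic ε v)
    (hL : ∀ m, LatDir (v m) (v (m + 1))) :
    ∃ t, dist (v t) (v (t + 1)) = dist (v (t + 2)) (v (t + 3)) + dist (v (t + 3)) (v (t + 4)) ∧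
      dist (v (t + 4)) (v t) = dist (v (t + 1)) (v (t + 2)) + dist (v (t + 2)) (v (t + 3)) ∧
      ε * pentArea v = (dist (v t) (v (t + 1)) + dist (v (t + 1)) (v (t + 2))) ^ 2 -
        dist (v (t + 1)) (v (t + 2)) ^ 2 - dist (v (t + 3)) (v (t + 4)) ^ 2 ∧
      ∀ m, 0 < ip (v (m + 4) - v m) (v (m + 1) - v m) ↔ m = t := by
  have main : ∀ v : Fin 5 → Plane, IsCyclic 1 v → (∀ m, LatDir (v m) (v (m + 1))) →
    ∃ t, dist (v t) (v (t + 1)) = dist (v (t + 2)) (v (t + 3)) + dist (v (t + 3)) (v (t + 4)) ∧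
      dist (v (t + 4)) (v t) = dist (v (t + 1)) (v (t + 2)) + dist (v (t + 2)) (v (t + 3)) ∧
      pentArea v = (dist (v t) (v (t + 1)) + dist (v (t + 1)) (v (t + 2))) ^ 2 -
        dist (v (t + 1)) (v (t + 2)) ^ 2 - dist (v (t + 3)) (v (t + 4)) ^ 2 ∧
      ∀ m, 0 < ip (v (m + 4) - v m) (v (m + 1) - v m) ↔ m = t := by
    intro v h hL
    choose θ hθ using fun m => exists_hexDir (hL m)
    have hpos : ∀ m, 0 < dist (v m) (v (m + 1)) := fun m => dist_pos.2 (h.ne_succ m)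
    have hturn : ∀ m, θ (m + 1) = θ m + 1 ∨ θ (m + 1) = θ m + 2 := fun m => by
      refine hexDir_turn (hpos m) (hpos (m + 1)) (hθ m) (hθ (m + 1)) ?_
      have := h.pos m (i := 0) (j := 1) (k := 2) (by decide) (by decide)
      rw [one_mul, zero_add, add_comm 1 m, add_comm 2 m] at this
      rw [add_assoc]
      exact this
    obtain ⟨t, t1, t2, t3, t4, t0⟩ := exists_turn θ hturn
    have s2 : t + 1 + 1 = t + 2 := by rw [add_assoc]; rfl
    have s3 : t + 2 + 1 = t + 3 := by rw [add_assoc]; rfl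
    have s4 : t + 3 + 1 = t + 4 := by rw [add_assoc]; rfl
    have s5 : t + 4 + 1 = t := by rw [add_assoc]; exact add_zero t
    have p0 := hθ t
    have p1 := hθ (t + 1)
    have p2 := hθ (t + 2)
    have p3 := hθ (t + 3)
    have p4 := hθ (t + 4)
    rw [s2] at p1
    rw [s3] at p2
    rw [s4] at p3
    rw [s5] at p4
    have q1 : θ (t + 1) = θ t + 1 := t1
    have q2 : θ (t + 2) = θ t + 2 := by rw [t2, t1, add_assoc]; rfl
    have q3 : θ (t + 3) = θ t + 3 := by rw [t3, q2, add_assoc]; rfl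
    have q4 : θ (t + 4) = θ t + 4 := by rw [t4, q3, add_assoc]; rfl
    have r1 := hpos (t + 1)
    have r2 := hpos (t + 2)
    have r3 := hpos (t + 3)
    have r4 := hpos (t + 4)
    have r0 := hpos t
    rw [s2] at r1
    rw [s3] at r2
    rw [s4] at r3
    rw [s5] at r4
    -- the angle at a vertex is acute if and only if the turning angle is 120 degrees
    have hip : ∀ m, 0 < ip (v (m + 4) - v m) (v (m + 1) - v m) ↔ θ m = θ (m + 4) + 2 := by
      intro m
      have s5 : m + 4 + 1 = m := by rw [add_assoc]; exact add_zero m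
      have e1 := hθ (m + 4)
      have e2 := hpos (m + 4)
      have e3 := hturn (m + 4)
      rw [s5] at e1 e2 e3
      rw [ip_hexDir e1 (hθ m)]
      have e4 := mul_pos e2 (hpos m)
      rcases e3 with e3 | e3
      · rw [e3, ip_hexDir_one]
        constructor
        · intro h
          linarith
        · intro h
          exact absurd h ((by decide : ∀ a : Fin 6, a + 1 ≠ a + 2) _)
      · rw [e3, ip_hexDir_two]
        exact ⟨fun _ => rfl, fun _ => by linarith⟩
    rw [q1] at p1
    rw [q2] at p2
    rw [q3] at p3
    rw [q4] at p4
    have hc := hex_closing (v := fun k => v (k + t)) (a := dist (v t) (v (t + 1)))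
      (b := dist (v (t + 1)) (v (t + 2))) (c := dist (v (t + 2)) (v (t + 3)))
      (d := dist (v (t + 3)) (v (t + 4))) (e := dist (v (t + 4)) (v t)) (θ := θ t)
      (by simp only [add_comm _ t, add_zero]; exact p0) (by simp only [add_comm _ t]; exact p1)
      (by simp only [add_comm _ t]; exact p2) (by simp only [add_comm _ t]; exact p3)
      (by simp only [add_comm _ t, add_zero]; exact p4)
    rw [pentArea_rotate] at hc
    refine ⟨t, hc.1, hc.2.1, hc.2.2, fun m => ?_⟩
    rw [hip]
    have hm : ∀ m t : Fin 5, m = t ∨ m = t + 1 ∨ m = t + 2 ∨ m = t + 3 ∨ m = t + 4 := by decide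
    have hn : ∀ a : Fin 6, a + 1 ≠ a + 2 := by decide
    have hs : ∀ k : Fin 5, t + k + 4 = t + (k + 4) := fun k => add_assoc _ _ _
    rcases hm m t with rfl | rfl | rfl | rfl | rfl
    · exact ⟨fun _ => rfl, fun _ => t0⟩
    · rw [hs, t1]
      exact ⟨fun h => absurd (by simp at h) (hn (θ t)), fun h => by simp at h⟩
    · rw [hs, t2]
      exact ⟨fun h => absurd h (hn (θ (t + 1))), fun h => by simp at h⟩
    · rw [hs, t3]
      exact ⟨fun h => absurd h (hn (θ (t + 2))), fun h => by simp at h⟩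
    · rw [hs, t4]
      exact ⟨fun h => absurd h (hn (θ (t + 3))), fun h => by simp at h⟩
  rcases hε with rfl | rfl
  · simpa only [one_mul] using main v h hL
  · -- reflect a clockwise pentagon
    have h' := h.swap
    rw [neg_neg] at h'
    have hL' : ∀ m, LatDir (pt (Y (v m)) (X (v m))) (pt (Y (v (m + 1))) (X (v (m + 1)))) := by
      intro m
      simp only [LatDir, X_pt, Y_pt]
      rcases hL m with h | h | h
      · exact Or.inr (Or.inl h)
      · exact Or.inl h
      · exact Or.inr (Or.inr (by linarith))
    have hd : ∀ a b : Plane, dist (pt (Y a) (X a)) (pt (Y b) (X b)) = dist a b := fun a b => by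
      rw [dist_eq_sqrt, dist_eq_sqrt]
      congr 1
      simp only [nsq, X_sub, Y_sub, X_pt, Y_pt]
      ring
    have hip : ∀ a b c : Plane, ip (pt (Y a) (X a) - pt (Y b) (X b))
        (pt (Y c) (X c) - pt (Y b) (X b)) = ip (a - b) (c - b) := fun a b c => by
      simp only [ip, X_sub, Y_sub, X_pt, Y_pt]
      ring
    have hA : pentArea (fun k => pt (Y (v k)) (X (v k))) = -1 * pentArea v := by
      simp only [pentArea, cr, X_pt, Y_pt]
      ring
    have := main _ h' hL'
    simp only [hd, hip, hA] at this
    exact this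

/-- A vertex between two edges on lines of the tiling is a lattice point. -/
theorem IsCyclic.isLatt {v : Fin 5 → Plane} {ε : ℝ} (h : IsCyclic ε v) {m : Fin 5}
    (h1 : IntLine (v m) (v (m + 1))) (h2 : IntLine (v (m + 1)) (v (m + 1 + 1))) :
    IsLatt (v (m + 1)) :=
  isLatt_of_intLine h1 h2 (h.cr_ne ((by decide : ∀ k : Fin 5, k ≠ k + 1) m)
    ((by decide : ∀ k : Fin 5, k + 1 ≠ k + 1 + 1) m) ((by decide : ∀ k : Fin 5, k ≠ k + 1 + 1) m))

theorem Int.eq_one_of_mul_le {p q : ℤ} (hp : 1 ≤ p) (hq : 1 ≤ q) (h : (p : ℝ) * q < 2) :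
    p = 1 ∧ q = 1 := by
  have h : p * q < 2 := by exact_mod_cast h
  constructor <;> nlinarith

set_option maxHeartbeats 800000 in
/-- If exactly one edge of a pentagon of area `7 / 3` with edges parallel to the tiling does not
lie on a line of the tiling, then the lengths of the edges are known. -/
theorem IsCyclic.lengths_of_one {v : Fin 5 → Plane} {ε : ℝ} (hε : ε = 1 ∨ ε = -1)
    (h : IsCyclic ε v) (hL : ∀ m, LatDir (v m) (v (m + 1))) (hA : ε * pentArea v = 7 / 3)
    {k : Fin 5} (hk : ∀ m, m ≠ k → IntLine (v m) (v (m + 1))) :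
    dist (v k) (v (k + 1)) ^ 2 = 2 / 3 ∧ ∀ m, m ≠ k → dist (v m) (v (m + 1)) = 1 ∨
      dist (v m) (v (m + 1)) = 1 - dist (v k) (v (k + 1)) ∨
      dist (v m) (v (m + 1)) = 2 - dist (v k) (v (k + 1)) := by
  obtain ⟨t, h1, h2, h3, -⟩ := h.hex_shape hε hL
  rw [hA] at h3
  -- edges whose neighbours lie on lines of the tiling have integral length
  have hint : ∀ m, m ≠ k → m + 1 ≠ k → m + 1 + 1 ≠ k →
      ∃ n : ℤ, 1 ≤ n ∧ dist (v (m + 1)) (v (m + 1 + 1)) = n := by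
    intro m e1 e2 e3
    obtain ⟨n, hn⟩ := (h.isLatt (hk m e1) (hk _ e2)).dist_eq_int (h.isLatt (hk _ e2) (hk _ e3))
      (hL (m + 1))
    have hpos : 0 < dist (v (m + 1)) (v (m + 1 + 1)) := dist_pos.2 (h.ne_succ _)
    rw [hn] at hpos
    exact ⟨n, by exact_mod_cast hpos, hn⟩
  have hpos : ∀ m, 0 < dist (v m) (v (m + 1)) := fun m => dist_pos.2 (h.ne_succ m)
  have s2 : t + 1 + 1 = t + 2 := by rw [add_assoc]; rfl
  have s3 : t + 2 + 1 = t + 3 := by rw [add_assoc]; rfl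
  have s4 : t + 3 + 1 = t + 4 := by rw [add_assoc]; rfl
  have s5 : t + 4 + 1 = t := by rw [add_assoc]; exact add_zero t
  have r1 := hpos (t + 1)
  have r2 := hpos (t + 2)
  have r3 := hpos (t + 3)
  have r4 := hpos (t + 4)
  have r0 := hpos t
  have i0 := hint (t + 4)
  have i1 := hint t
  have i2 := hint (t + 1)
  have i3 := hint (t + 2)
  have i4 := hint (t + 3)
  have hm : ∀ m t : Fin 5, m = t ∨ m = t + 1 ∨ m = t + 2 ∨ m = t + 3 ∨ m = t + 4 := by decide
  have cases5 : ∀ P : Fin 5 → Prop, P t → P (t + 1) → P (t + 2) → P (t + 3) → P (t + 4) →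
      ∀ m, P m := by
    intro P p0 p1 p2 p3 p4 m
    rcases hm m t with rfl | rfl | rfl | rfl | rfl <;> assumption
  simp only [s2, s3, s4, s5] at r1 r2 r3 r4 i0 i1 i2 i3 i4
  obtain ⟨a, ha⟩ : ∃ a, a = dist (v t) (v (t + 1)) := ⟨_, rfl⟩
  obtain ⟨b, hb⟩ : ∃ a, a = dist (v (t + 1)) (v (t + 2)) := ⟨_, rfl⟩
  obtain ⟨c, hc⟩ : ∃ a, a = dist (v (t + 2)) (v (t + 3)) := ⟨_, rfl⟩
  obtain ⟨d, hd⟩ : ∃ a, a = dist (v (t + 3)) (v (t + 4)) := ⟨_, rfl⟩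
  obtain ⟨e, he⟩ : ∃ a, a = dist (v (t + 4)) (v t) := ⟨_, rfl⟩
  rw [← ha] at h1 r0 i0 h3
  rw [← hb] at h2 r1 i1 h3
  rw [← hc] at h1 h2 r2 i2
  rw [← hd] at h1 r3 i3 h3
  rw [← he] at h2 r4 i4
  -- the cases are distinguished by the position of the exceptional edge relative to `t`; here it is
  -- next to the angle of 60 degrees, and the area is at least `3`
  rcases hm k t with rfl | rfl | rfl | rfl | rfl
  · obtain ⟨p, hp, rfl⟩ := i2 (by simp) (by simp) (by simp)
    obtain ⟨q, hq, rfl⟩ := i3 (by simp) (by simp) (by simp)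
    have hp' : (1 : ℝ) ≤ p := by exact_mod_cast hp
    have hq' : (1 : ℝ) ≤ q := by exact_mod_cast hq
    nlinarith [mul_pos r1 r2, mul_pos r1 r3]
  · -- the exceptional edge `b` is a cut: `p ^ 2 + 2 * p * q - b ^ 2 = 7 / 3` with `b < p`
    obtain ⟨q, hq, rfl⟩ := i3 (by simp) (by simp) (by simp)
    obtain ⟨p, hp, rfl⟩ := i4 (by simp) (by simp) (by simp)
    have hsq : b ^ 2 ≤ p ^ 2 := by
      gcongr
      linarith
    have hA : (p : ℝ) ^ 2 + 2 * (p * q) - b ^ 2 = 7 / 3 := by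
      rw [show a = p - b + q by linarith] at h3
      linarith
    obtain ⟨rfl, rfl⟩ := Int.eq_one_of_mul_le hp hq (by linarith)
    push_cast at *
    rw [s2, ← hb]
    refine ⟨by linarith, cases5 _ ?_ ?_ ?_ ?_ ?_⟩ <;> intro _ <;>
      simp only [s2, s3, s4, s5, ← ha, ← hb, ← hc, ← hd, ← he]
    · exact Or.inr (Or.inr (by linarith))
    · contradiction
    · exact Or.inr (Or.inl (by linarith))
    · exact Or.inl trivial
    · exact Or.inl trivial
  · -- the exceptional edge is opposite to the angle of 60 degrees: `2 * p * q - c ^ 2 = 7 / 3` has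
    -- no solution with `c` less than `p` and `q`
    exfalso
    obtain ⟨p, hp, rfl⟩ := i4 (by simp) (by simp) (by simp)
    obtain ⟨q, hq, rfl⟩ := i0 (by simp) (by simp) (by simp)
    have hA : 2 * (p : ℝ) * q - c ^ 2 = 7 / 3 := by
      have e1 : b = p - c := by linarith
      have e2 : d = q - c := by linarith
      rw [e1, e2] at h3
      linarith
    have c1 : c < p := by linarith
    have c2 : c < q := by linarith
    have key : ∀ p q : ℤ, 1 ≤ p → p ≤ q → c < p → 2 * (p : ℝ) * q - c ^ 2 = 7 / 3 → False := by
      intro p q hp hpq c1 hA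
      have hp' : (1 : ℝ) ≤ p := by exact_mod_cast hp
      have hpq' : (p : ℝ) ≤ q := by exact_mod_cast hpq
      rcases (by omega : q = 1 ∨ 2 ≤ q) with rfl | h2q
      · obtain rfl : p = 1 := by omega
        push_cast at hA
        linarith [sq_nonneg c]
      · have h2 : (2 : ℝ) ≤ q := by exact_mod_cast h2q
        have h3 : c ^ 2 ≤ p ^ 2 := by gcongr
        have h4 : 0 ≤ ((p : ℝ) - 1) * (2 * q - p - 1) :=
          mul_nonneg (by linarith) (by linarith)
        linarith
    rcases le_total p q with hpq | hpq
    · exact key p q hp hpq c1 hA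
    · exact key q p hq hpq c2 (by linarith)
  · -- the mirror image of the second case
    obtain ⟨p, hp, rfl⟩ := i0 (by simp) (by simp) (by simp)
    obtain ⟨q, hq, rfl⟩ := i1 (by simp) (by simp) (by simp)
    have hsq : d ^ 2 ≤ p ^ 2 := by
      gcongr
      linarith
    have hA : (p : ℝ) ^ 2 + 2 * (p * q) - d ^ 2 = 7 / 3 := by linarith
    obtain ⟨rfl, rfl⟩ := Int.eq_one_of_mul_le hp hq (by linarith)
    push_cast at *
    rw [s4, ← hd]
    refine ⟨by linarith, cases5 _ ?_ ?_ ?_ ?_ ?_⟩ <;> intro _ <;>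
      simp only [s2, s3, s4, s5, ← ha, ← hb, ← hc, ← hd, ← he]
    · exact Or.inl trivial
    · exact Or.inl trivial
    · exact Or.inr (Or.inl (by linarith))
    · contradiction
    · exact Or.inr (Or.inr (by linarith))
  · -- the mirror image of the first case
    obtain ⟨p, hp, rfl⟩ := i1 (by simp) (by simp) (by simp)
    obtain ⟨q, hq, rfl⟩ := i2 (by simp) (by simp) (by simp)
    have hp' : (1 : ℝ) ≤ p := by exact_mod_cast hp
    have hq' : (1 : ℝ) ≤ q := by exact_mod_cast hq
    nlinarith [mul_pos r1 r3, mul_pos r2 r3]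

/-! ### Every pentagon has two edges off the lines of the tiling -/

namespace Config

variable {T : Finset Cell} {C : Config T}

/-- In contrast to `not_on_three`, the two edges of the third pentagon are not assumed to be the
same. -/
theorem not_on_three' {i j k : Fin 3} (hij : i ≠ j) (hjk : j ≠ k) (hik : i ≠ k)
    {a b c c' : Fin 5} (h1 : C.On i j a) (h2 : C.On j i b) (h3 : C.On j k b) (h4 : C.On k j c)
    (h5 : C.On i k a) (h6 : C.On k i c') : False := by
  have hf := C.isAff i j hij
  have e : ∀ i j z, C.h j i z = 0 → C.h i j z = 0 := fun i j z hz => by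
    have := C.anti i j z
    linarith
  have line : ∀ {p q : Plane} {g : Plane → ℝ}, IsAff g → p ≠ q → C.h i j p = 0 → C.h i j q = 0 →
      g p = 0 → g q = 0 → ∀ z, g z = 0 → C.h i j z = 0 := by
    intro p q g hg hpq p1 q1 p2 q2 z hz
    obtain ⟨r, hr, hr'⟩ := hf.eq_cr hpq p1 q1
    rw [hr', hg.cr_eq_zero p2 q2 hz, mul_zero]
  have l1 := line (C.isAff i k hik) ((C.cyc i).ne_succ a) h1.1 h1.2 h5.1 h5.2
  have l2 := line (C.isAff j k hjk) ((C.cyc j).ne_succ b) (e _ _ _ h2.1) (e _ _ _ h2.2) h3.1 h3.2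
  obtain rfl := (C.cyc k).edge_unique hf (l2 _ (e _ _ _ h4.1)) (l2 _ (e _ _ _ h4.2))
    (l1 _ (e _ _ _ h6.1)) (l1 _ (e _ _ _ h6.2))
  exact not_on_three hij hjk hik h1 h2 h3 h4 h5 h6

theorem On.not_isInt {i j : Fin 3} (hij : i ≠ j) {a b : Fin 5} (h : C.On i j a)
    (h' : C.On j i b) (ha : ¬ C.IsInt i a) : ¬ C.IsInt j b := fun hb =>
  ha (h'.isInt hij.symm h hb)

theorem isLatt {i : Fin 3} {m : Fin 5} (h1 : C.IsInt i m) (h2 : C.IsInt i (m + 1)) :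
    IsLatt (C.w i (m + 1)) :=
  (C.cyc i).isLatt h1 h2

/-- Otherwise all vertices are lattice points and the area is an integer, but it is `7 / 3`. -/
theorem exists_not_isInt (hT : T.card = 7) (i : Fin 3) : ∃ k, ¬ C.IsInt i k := by
  by_contra! hno
  have hl : ∀ m, IsLatt (C.w i m) := fun m => by
    have := isLatt (hno (m - 1)) (hno (m - 1 + 1))
    rwa [sub_add_cancel] at this
  obtain ⟨p, hp⟩ := (hl 0).cr_eq_int (hl 1) (hl 2)
  obtain ⟨q, hq⟩ := (hl 0).cr_eq_int (hl 2) (hl 3)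
  obtain ⟨r, hr⟩ := (hl 0).cr_eq_int (hl 3) (hl 4)
  have hA := C.area hT i
  rw [pentArea, hp, hq, hr] at hA
  rcases C.sign i with h | h
  · rw [h] at hA
    have : 3 * (p + q + r) = 7 := by
      have : (3 : ℝ) * (p + q + r) = 7 := by linarith
      exact_mod_cast this
    omega
  · rw [h] at hA
    have : 3 * (p + q + r) = -7 := by
      have : (3 : ℝ) * (p + q + r) = -7 := by linarith
      exact_mod_cast this
    omega

/-- If a pentagon has two edges off the lines of the tiling, then each of them touches only one
other pentagon. -/
theorem eq_of_on {i j l : Fin 3} {a b : Fin 5} (hab : a ≠ b)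
    (hb : ¬ C.IsInt i b) (hj : j ≠ i) (hl : l ≠ i) (h1 : C.On i j a) (h2 : C.On i l a) :
    j = l := by
  obtain ⟨p, hp, -, h3, -, -⟩ := C.exists_contact hb (left_mem_segment ℝ _ _)
  have e1 : p ≠ j := fun e => hab (C.on_unique hj.symm h1 (e ▸ h3))
  have e2 : p ≠ l := fun e => hab (C.on_unique hl.symm h2 (e ▸ h3))
  exact (by decide : ∀ i j l p : Fin 3, j ≠ i ∧ l ≠ i ∧ p ≠ i ∧ p ≠ j ∧ p ≠ l → j = l) i j l p
    ⟨hj, hl, hp, e1, e2⟩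

/-- If a pentagon has another edge off the lines of the tiling, then its edge is covered by one edge
of the pentagon that it touches. -/
theorem edge_subset_of_two {i j : Fin 3} {a b b' : Fin 5} (ha : ¬ C.IsInt i a)
    (hb' : ¬ C.IsInt i b') (hab : a ≠ b') (hj : j ≠ i) (h1 : C.On i j a) (h2 : C.On j i b) :
    C.edge i a ⊆ C.edge j b := by
  obtain ⟨-, b'', -, h4, h5⟩ := exists_edge_superset (j := j) ha fun l hl m h3 _ =>
    eq_of_on hab hb' hl hj h3 h1
  rwa [C.on_unique hj h2 h4]

/-- A pentagon with only one edge off the lines of the tiling is impossible if the lengths of the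
edges are as in `IsCyclic.lengths_of_one`. -/
theorem not_one {i : Fin 3} {k : Fin 5} {ρ : ℝ} (hρ : ρ ^ 2 = 2 / 3)
    (hlen : ∀ i m, m ≠ k → dist (C.w i m) (C.w i (m + 1)) = 1 ∨
      dist (C.w i m) (C.w i (m + 1)) = 1 - ρ ∨ dist (C.w i m) (C.w i (m + 1)) = 2 - ρ)
    (hlenk : ∀ i, dist (C.w i k) (C.w i (k + 1)) = ρ)
    (hone : ∀ j m, (∀ m', ¬ C.IsInt j m' → m' = m) → m = k)
    (hex : ∀ j, ∃ m, ¬ C.IsInt j m)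
    (hi : ∀ m, ¬ C.IsInt i m → m = k) : False := by
  have hρ0 : 0 < ρ := by rw [← hlenk i]; exact dist_pos.2 ((C.cyc i).ne_succ k)
  have hρ1 : 4 / 5 < ρ := by nlinarith
  have hρ2 : ρ < 5 / 6 := by nlinarith
  -- only the edge `k` has length `ρ`
  have hU : ∀ i m, dist (C.w i m) (C.w i (m + 1)) = ρ → m = k := by
    intro i m hm
    by_contra hmk
    rcases hlen i m hmk with h | h | h <;> linarith
  have hpoints : ∀ {p q l : Fin 3} {a b : Fin 5}, p ≠ l → C.edge p a ⊆ C.edge q b →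
      C.edge q b ⊆ C.pent l → C.On p l a := by
    intro p q l a b hpl h1 h2
    exact on_of_common hpl ((C.cyc p).ne_succ a) (left_mem_segment ℝ _ _)
      (right_mem_segment ℝ _ _) (h2 (h1 (left_mem_segment ℝ _ _)))
      (h2 (h1 (right_mem_segment ℝ _ _)))
  obtain ⟨k', hk'⟩ := hex i
  obtain rfl := hi k' hk'
  by_cases hboth : ∃ j l a c, j ≠ i ∧ l ≠ i ∧ j ≠ l ∧ C.On i j k' ∧ C.On j i a ∧ C.On i l k' ∧
      C.On l i c
  · -- the edge `k'` of `i` touches both other pentagons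
    obtain ⟨j, l, a, c, hj, hl, hjl, h1, h2, h3, h4⟩ := hboth
    -- then each of these has another edge off the lines of the tiling
    have key : ∀ {j l : Fin 3} {a c : Fin 5}, j ≠ i → l ≠ i → j ≠ l → C.On i j k' → C.On j i a →
        C.On i l k' → C.On l i c → ∃ a', a ≠ a' ∧ ¬ C.IsInt j a' := by
      intro j l a c hj hl hjl h1 h2 h3 h4
      by_contra! hno
      have ha : ∀ m', ¬ C.IsInt j m' → m' = a := fun m' hm' => by
        by_contra hne
        exact hm' (hno m' (Ne.symm hne))
      obtain rfl := hone j a ha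
      have hja := h1.not_isInt hj.symm h2 hk'
      have hlc := h3.not_isInt hl.symm h4 hk'
      -- the edges of `i` and `j` coincide, and that of `l` lies in them
      have e1 : C.edge j a ⊆ C.edge i a := by
        obtain ⟨-, b, -, h5, h6⟩ := exists_edge_superset (j := i) hja fun p hp m h5 h6 => by
          by_contra hpi
          obtain rfl : p = l :=
            (by decide : ∀ i j l p : Fin 3, j ≠ i ∧ l ≠ i ∧ j ≠ l ∧ p ≠ j ∧ p ≠ i → p = l) i j l p
            ⟨hj, hl, hjl, hp, hpi⟩
          exact not_on_three' hj.symm hjl hl.symm h1 h2 h5 h6 h3 h4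
        rwa [← C.on_unique hj.symm h1 h5] at h6
      have e2 : C.edge j a = C.edge i a := edge_eq e1 (by rw [hlenk, hlenk])
      have e3 : C.edge l c ⊆ C.edge i a := by
        obtain ⟨-, b, -, h5, h6⟩ := exists_edge_superset (j := i) hlc fun p hp m h5 h6 => by
          by_contra hpi
          obtain rfl : p = j :=
            (by decide : ∀ i j l p : Fin 3, j ≠ i ∧ l ≠ i ∧ j ≠ l ∧ p ≠ l ∧ p ≠ i → p = j) i j l p
            ⟨hj, hl, hjl, hp, hpi⟩
          obtain rfl := ha m (h5.not_isInt hjl.symm h6 hlc)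
          exact not_on_three' hj.symm hjl hl.symm h1 h2 h6 h5 h3 h4
        rwa [← C.on_unique hl.symm h3 h5] at h6
      have e4 : C.On l j c := hpoints hjl.symm e3 (e2 ▸ C.edge_subset j a)
      have e5 : C.On j l a := by
        have l1 : C.w l c ∈ C.edge l c := left_mem_segment ℝ _ _
        have l2 : C.w l (c + 1) ∈ C.edge l c := right_mem_segment ℝ _ _
        exact on_of_common hjl ((C.cyc l).ne_succ c) (e2 ▸ e3 l1) (e2 ▸ e3 l2)
          (C.edge_subset l c l1) (C.edge_subset l c l2)
      exact not_on_three' hj.symm hjl hl.symm h1 h2 e5 e4 h3 h4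
    obtain ⟨a', ha, ha'⟩ := key hj hl hjl h1 h2 h3 h4
    obtain ⟨c', hc, hc'⟩ := key hl hj hjl.symm h3 h4 h1 h2
    have hja := h1.not_isInt hj.symm h2 hk'
    have hlc := h3.not_isInt hl.symm h4 hk'
    have e1 := edge_subset_of_two hja ha' ha hj.symm h2 h1
    have e2 := edge_subset_of_two hlc hc' hc hl.symm h4 h3
    have hcov : C.edge i k' ⊆ C.edge j a ∪ C.edge l c := by
      intro z hz
      obtain ⟨p, hp, m, h5, h6, h7⟩ := C.exists_contact hk' hz
      rcases (by decide : ∀ i j l p : Fin 3, j ≠ i ∧ l ≠ i ∧ j ≠ l ∧ p ≠ i → p = j ∨ p = l) i j l p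
        ⟨hj, hl, hjl, hp⟩ with rfl | rfl
      · exact Or.inl (C.on_unique hj h2 h6 ▸ h7)
      · exact Or.inr (C.on_unique hl h4 h6 ▸ h7)
    -- neither of the two edges covers the edge of `i` alone, so both have the length `1 - ρ`
    have hne : ∀ {j l : Fin 3} {a c : Fin 5}, j ≠ i → l ≠ i → j ≠ l → C.On i j k' → C.On j i a →
        C.On i l k' → C.On l i c → C.edge j a ⊆ C.edge i k' → C.edge l c ⊆ C.edge i k' →
        dist (C.w j a) (C.w j (a + 1)) = 1 - ρ := by
      intro j l a c hj hl hjl h1 h2 h3 h4 e1 e2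
      have hle := dist_le_of_mem_segment (e1 (left_mem_segment ℝ _ _))
        (e1 (right_mem_segment ℝ _ _))
      by_cases hak : a = k'
      · exfalso
        subst hak
        have e3 : C.edge j a = C.edge i a := edge_eq e1 (by rw [hlenk, hlenk])
        have e4 : C.On l j c := hpoints hjl.symm e2 (e3 ▸ C.edge_subset j a)
        have e5 : C.On j l a := by
          have l1 : C.w l c ∈ C.edge l c := left_mem_segment ℝ _ _
          have l2 : C.w l (c + 1) ∈ C.edge l c := right_mem_segment ℝ _ _
          exact on_of_common hjl ((C.cyc l).ne_succ c) (e3 ▸ e2 l1) (e3 ▸ e2 l2)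
            (C.edge_subset l c l1) (C.edge_subset l c l2)
        exact not_on_three' hj.symm hjl hl.symm h1 h2 e5 e4 h3 h4
      · rw [hlenk] at hle
        rcases hlen j a hak with h | h | h
        · linarith
        · exact h
        · linarith
    have d1 := hne hj hl hjl h1 h2 h3 h4 e1 e2
    have d2 := hne hl hj hjl.symm h3 h4 h1 h2 e2 e1
    -- but then they do not cover it together, as `2 * (1 - ρ) < ρ`
    have hpre : IsPreconnected (C.edge i k') := (convex_segment _ _).isPreconnected
    have hcl : ∀ p m, IsClosed (C.edge p m) := fun p m => by
      rw [edge, ← convexHull_pair]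
      exact ((Set.toFinite _).isCompact_convexHull ℝ).isClosed
    obtain ⟨x, -, hx1, hx2⟩ := isPreconnected_closed_iff.1 hpre _ _ (hcl j a) (hcl l c) hcov
      ⟨C.w j a, e1 (left_mem_segment ℝ _ _), left_mem_segment ℝ _ _⟩
      ⟨C.w l c, e2 (left_mem_segment ℝ _ _), left_mem_segment ℝ _ _⟩
    have near : ∀ z ∈ C.edge i k', dist z x ≤ 1 - ρ := by
      intro z hz
      rcases hcov hz with hz | hz
      · exact (dist_le_of_mem_segment hz hx1).trans d1.le
      · exact (dist_le_of_mem_segment hz hx2).trans d2.le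
    have t1 := near _ (left_mem_segment ℝ _ _)
    have t2 := near _ (right_mem_segment ℝ _ _)
    have t3 := dist_triangle_right (C.w i k') (C.w i (k' + 1)) x
    rw [hlenk] at t3
    linarith
  · -- the edge `k'` of `i` touches only the pentagon `j`
    obtain ⟨j, hj, a, h1, h2, -⟩ := C.exists_contact hk' (left_mem_segment ℝ _ _)
    have only : ∀ p, p ≠ i → ∀ m, C.On i p k' → C.On p i m → p = j := by
      intro p hp m h3 h4
      by_contra hpj
      exact hboth ⟨j, p, a, m, hj, hp, Ne.symm hpj, h1, h2, h3, h4⟩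
    have e1 : C.edge i k' ⊆ C.edge j a := by
      obtain ⟨-, b, -, h4, h5⟩ := exists_edge_superset (j := j) hk' only
      rwa [C.on_unique hj h2 h4]
    have hja := h1.not_isInt hj.symm h2 hk'
    obtain ⟨l, hl, hlj⟩ : ∃ l, l ≠ i ∧ l ≠ j :=
      (by decide : ∀ i j : Fin 3, ∃ l, l ≠ i ∧ l ≠ j) i j
    -- the third pentagon touches only `j`, and in only one edge
    have hlonly : ∀ c, ¬ C.IsInt l c → ∀ p, p ≠ l → ∀ m, C.On l p c → C.On p l m → p = j := by
      intro c hc p hp m h3 h4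
      by_contra hpj
      obtain rfl : p = i :=
        (by decide : ∀ i j l p : Fin 3, j ≠ i ∧ l ≠ i ∧ l ≠ j ∧ p ≠ l ∧ p ≠ j → p = i) i j l p
        ⟨hj, hl, hlj, hp, hpj⟩
      obtain rfl := hi m (h3.not_isInt hp.symm h4 hc)
      exact hlj (only l hl c h4 h3)
    obtain ⟨c, hc⟩ := hex l
    have hlc : ∀ m, ¬ C.IsInt l m → m = c := by
      intro m hm
      obtain ⟨-, b, h5, -, -⟩ := exists_edge_superset hm (hlonly m hm)
      obtain ⟨-, b', h6, -, -⟩ := exists_edge_superset hc (hlonly c hc)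
      exact C.on_unique hlj h5 h6
    obtain rfl := hone l c hlc
    obtain ⟨-, b, h3, h4, e2⟩ := exists_edge_superset hc (hlonly c hc)
    have hjb := h3.not_isInt hlj h4 hc
    by_cases hab : a = b
    · subst hab
      by_cases hj1 : ∀ m, ¬ C.IsInt j m → m = a
      · obtain rfl := hone j a hj1
        have e3 := edge_eq e1 (by rw [hlenk, hlenk])
        have e4 := edge_eq e2 (by rw [hlenk, hlenk])
        have e5 : C.On i l a := hpoints hl.symm e1 (e4 ▸ C.edge_subset l a)
        have e6 : C.On l i a := hpoints hl e2 (e3 ▸ C.edge_subset i a)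
        exact hlj (only l hl a e5 e6)
      · push Not at hj1
        obtain ⟨m, hm, hma⟩ := hj1
        exact hl (eq_of_on (Ne.symm hma) hm hj.symm hlj h2 h4).symm
    · have e3 := edge_subset_of_two hja hjb hab hj.symm h2 h1
      have e4 := edge_subset_of_two hjb hja (Ne.symm hab) hlj h4 h3
      have f1 : C.edge i c = C.edge j a := Set.Subset.antisymm e1 e3
      have f2 : C.edge l c = C.edge j b := Set.Subset.antisymm e2 e4
      have g : ∀ {p q : Fin 3} {m n : Fin 5}, C.edge p m = C.edge q n →
          dist (C.w q n) (C.w q (n + 1)) = dist (C.w p m) (C.w p (m + 1)) := by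
        intro p q m n h
        apply le_antisymm
        · exact dist_le_of_mem_segment (h.symm.subset (left_mem_segment ℝ _ _))
            (h.symm.subset (right_mem_segment ℝ _ _))
        · exact dist_le_of_mem_segment (h.subset (left_mem_segment ℝ _ _))
            (h.subset (right_mem_segment ℝ _ _))
      have a1 := hU j a ((g f1).trans (hlenk i))
      have a2 := hU j b ((g f2).trans (hlenk l))
      exact hab (a1.trans a2.symm)

theorem not_isInt_of_not_lat {i : Fin 3} {m : Fin 5} (h : ¬ C.Lat i m) (j : Fin 3) :
    ¬ C.IsInt j m := fun h' => h (C.lat_of_lat j i m h'.latDir)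

/-- It is impossible that exactly one edge of a pentagon is not parallel to the tiling: the edges
with this index touch each other only, in contradiction to `not_three_equal`. -/
theorem lat_or (i : Fin 3) : (∀ m, C.Lat i m) ∨ ∃ m m', m ≠ m' ∧ ¬ C.Lat i m ∧ ¬ C.Lat i m' := by
  by_contra! hno
  obtain ⟨⟨m, hm⟩, h1⟩ := hno
  refine not_three_equal (C := C) (k := m) (fun j => not_isInt_of_not_lat hm j) ?_
  intro p q m' hpq h2 h3
  by_contra hne
  exact hm (C.lat_of_lat p i m
    (h3.lat hpq.symm h2 (C.lat_of_lat i q m' (h1 m m' (Ne.symm hne) hm))))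

/-- Every pentagon of a trisection has two edges off the lines of the tiling. If it had one only,
then all pentagons would be parallel to the tiling, with the lengths excluded by `not_one`. -/
theorem exists_two (hT : T.card = 7) (i : Fin 3) :
    ∃ a b, a ≠ b ∧ ¬ C.IsInt i a ∧ ¬ C.IsInt i b := by
  rcases lat_or (C := C) i with h0 | ⟨m, m', hne, hm, hm'⟩
  · have hL : ∀ j m, C.Lat j m := fun j m => C.lat_of_lat i j m (h0 m)
    by_contra! hno
    obtain ⟨k, hk⟩ := exists_not_isInt (C := C) hT i
    have hik : ∀ m, m ≠ k → C.IsInt i m := fun m hm => hno k m hm.symm hk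
    have main : ∀ j m, (∀ m', ¬ C.IsInt j m' → m' = m) → _ := fun j m hm =>
      (C.cyc j).lengths_of_one (C.sign j) (hL j) (C.area hT j) (k := m) fun m' hm' => by
        by_contra h
        exact hm' (hm m' h)
    obtain ⟨l1, l2⟩ := main i k fun m hm => by
      by_contra h
      exact hm (hik m h)
    refine not_one (C := C) (i := i) (k := k) l1 (fun j m hm => ?_) (fun j => C.dist_eq _ _ _ _) ?_
      (exists_not_isInt hT) fun m hm => by
        by_contra h
        exact hm (hik m h)
    · rw [C.dist_eq j i]
      exact l2 m hm
    · intro j m hm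
      obtain ⟨l3, -⟩ := main j m hm
      by_contra hne
      rw [C.dist_eq j i] at l3
      have h1 : 0 < dist (C.w i k) (C.w i (k + 1)) := dist_pos.2 ((C.cyc i).ne_succ k)
      rcases l2 m hne with h | h | h <;> rw [h] at l3 <;> nlinarith
  · exact ⟨m, m', hne, not_isInt_of_not_lat hm i, not_isInt_of_not_lat hm' i⟩

end Config

/-! ### Heptiamonds have no holes -/

/-- A degenerate triangle is the union of its sides. -/
theorem mem_segment_of_collinear {a b c z : Plane} (h : cr a b c = 0)
    (hz : z ∈ convexHull ℝ {a, b, c}) :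
    z ∈ segment ℝ a b ∨ z ∈ segment ℝ b c ∨ z ∈ segment ℝ c a := by
  by_cases hab : a = b
  · subst hab
    rw [Set.insert_eq_of_mem (Set.mem_insert _ _), convexHull_pair] at hz
    exact Or.inr (Or.inl hz)
  obtain ⟨t, rfl⟩ := eq_lineMap_of_cr_eq_zero hab h
  have key : ∀ p q : Plane, a ∈ segment ℝ p q → b ∈ segment ℝ p q →
      a + t • (b - a) ∈ segment ℝ p q → z ∈ segment ℝ p q := fun p q h1 h2 h3 =>
    convexHull_min (by rintro _ (rfl | rfl | rfl) <;> assumption) (convex_segment p q) hz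
  rcases le_total 0 t with h0 | h0
  · rcases le_total t 1 with h1 | h1
    · refine Or.inl (key a b (left_mem_segment ℝ _ _) (right_mem_segment ℝ _ _) ?_)
      exact mem_segment_iff_XY.2 ⟨t, h0, h1, by simp, by simp⟩
    · refine Or.inr (Or.inr (key _ a (right_mem_segment ℝ _ _) ?_ (left_mem_segment ℝ _ _)))
      have ht : 0 < t := by linarith
      refine mem_segment_iff_XY.2 ⟨1 - 1 / t, ?_, ?_, ?_, ?_⟩
      · rw [sub_nonneg, div_le_one ht]
        exact h1
      · have : 0 < 1 / t := by positivity
        linarith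
      · simp
        field_simp
        ring
      · simp
        field_simp
        ring
  · refine Or.inr (Or.inl (key b _ ?_ (left_mem_segment ℝ _ _) (right_mem_segment ℝ _ _)))
    have ht : 0 < 1 - t := by linarith
    refine mem_segment_iff_XY.2 ⟨1 / (1 - t), by positivity, ?_, ?_, ?_⟩
    · rw [div_le_one ht]
      linarith
    · simp
      field_simp
      ring
    · simp
      field_simp
      ring

/-- A point of a triangle lies on a side or strictly inside. -/
theorem mem_segment_or_strict {a b c z : Plane} (h : 0 < cr a b c)
    (hz : z ∈ convexHull ℝ {a, b, c}) : (z ∈ segment ℝ a b ∨ z ∈ segment ℝ b c ∨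
      z ∈ segment ℝ c a) ∨ (0 < cr a b z ∧ 0 < cr b c z ∧ 0 < cr c a z) := by
  have key : ∀ a b c : Plane, 0 < cr a b c → cr a b z = 0 → 0 ≤ cr b c z → 0 ≤ cr c a z →
      z ∈ segment ℝ a b := by
    intro a b c h h1 h2 h3
    have hab : a ≠ b := by rintro rfl; simp at h
    obtain ⟨t, rfl⟩ := eq_lineMap_of_cr_eq_zero hab h1
    have e2 : cr b c (a + t • (b - a)) = (1 - t) * cr a b c := by
      simp only [cr, X_add, Y_add, X_smul, Y_smul, X_sub, Y_sub]; ring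
    have e3 : cr c a (a + t • (b - a)) = t * cr a b c := by
      simp only [cr, X_add, Y_add, X_smul, Y_smul, X_sub, Y_sub]; ring
    rw [e2] at h2
    rw [e3] at h3
    have t0 := nonneg_of_mul_nonneg_left h3 h
    have t1 := nonneg_of_mul_nonneg_left h2 h
    exact mem_segment_iff_XY.2 ⟨t, t0, by linarith, by simp, by simp⟩
  obtain ⟨h1, h2, h3⟩ := (mem_triangle_iff h).1 hz
  rcases h1.eq_or_lt with e1 | e1
  · exact Or.inl (Or.inl (key a b c h e1.symm h2 h3))
  rcases h2.eq_or_lt with e2 | e2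
  · exact Or.inl (Or.inr (Or.inl (key b c a (by rwa [cr_rot]) e2.symm h3 h1)))
  rcases h3.eq_or_lt with e3 | e3
  · exact Or.inl (Or.inr (Or.inr (key c a b (by rwa [cr_rot, cr_rot]) e3.symm h1 h2)))
  exact Or.inr ⟨e1, e2, e3⟩

/-- A set has no triangular holes if it contains every triangle whose sides it contains. -/
def FillsTriangles (R : Set Plane) : Prop :=
  ∀ a b c : Plane, segment ℝ a b ⊆ R → segment ℝ b c ⊆ R → segment ℝ c a ⊆ R →
    convexHull ℝ {a, b, c} ⊆ R

/-- If every point of the complement lies in an unbounded connected subset of the complement, then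
there are no triangular holes. -/
theorem fillsTriangles_of_escape {R : Set Plane}
    (h : ∀ z, z ∉ R → ∃ G : Set Plane, IsPreconnected G ∧ z ∈ G ∧ Disjoint G R ∧
      ∀ r : ℝ, ∃ p ∈ G, r < dist p 0) : FillsTriangles R := by
  have main : ∀ a b c : Plane, 0 < cr a b c → segment ℝ a b ⊆ R → segment ℝ b c ⊆ R →
      segment ℝ c a ⊆ R → convexHull ℝ {a, b, c} ⊆ R := by
    intro a b c habc h1 h2 h3 z hz
    by_contra hzR
    obtain ⟨G, hG, hzG, hGR, hfar⟩ := h z hzR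
    have hcomp : IsCompact (convexHull ℝ {a, b, c}) := (Set.toFinite _).isCompact_convexHull ℝ
    have hstrict : ∀ p ∈ G, p ∈ convexHull ℝ {a, b, c} →
        0 < cr a b p ∧ 0 < cr b c p ∧ 0 < cr c a p := by
      intro p hp hp'
      rcases mem_segment_or_strict habc hp' with h' | h'
      · exfalso
        have : p ∈ R := by
          rcases h' with h' | h' | h'
          exacts [h1 h', h2 h', h3 h']
        exact Set.disjoint_left.1 hGR hp this
      · exact h'
    have hU : IsOpen {p | 0 < cr a b p ∧ 0 < cr b c p ∧ 0 < cr c a p} :=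
      (isOpen_lt continuous_const (continuous_cr a b)).inter
        ((isOpen_lt continuous_const (continuous_cr b c)).inter
          (isOpen_lt continuous_const (continuous_cr c a)))
    have hsub : {p | 0 < cr a b p ∧ 0 < cr b c p ∧ 0 < cr c a p} ⊆ convexHull ℝ {a, b, c} :=
      fun p hp => (mem_triangle_iff habc).2 ⟨hp.1.le, hp.2.1.le, hp.2.2.le⟩
    -- the connected set does not meet the sides, so it stays inside the triangle or outside
    rcases hG.subset_or_subset hU hcomp.isClosed.isOpen_compl
      (Set.disjoint_compl_right_iff_subset.2 hsub) (fun p hp => by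
        by_cases hp' : p ∈ convexHull ℝ {a, b, c}
        · exact Or.inl (hstrict p hp hp')
        · exact Or.inr hp') with h' | h'
    · obtain ⟨r, hr⟩ := hcomp.isBounded.subset_closedBall 0
      obtain ⟨p, hp, hp'⟩ := hfar r
      exact absurd (hr (hsub (h' hp))) (by simpa using hp')
    · exact h' hzG hz
  intro a b c h1 h2 h3
  rcases lt_trichotomy (cr a b c) 0 with h0 | h0 | h0
  · rw [show ({a, b, c} : Set Plane) = {a, c, b} by rw [Set.pair_comm b c]]
    refine main a c b (by rw [cr_swap']; linarith) ?_ ?_ ?_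
    · rwa [segment_symm]
    · rwa [segment_symm]
    · rwa [segment_symm]
  · intro z hz
    rcases mem_segment_of_collinear h0 hz with h' | h' | h'
    exacts [h1 h', h2 h', h3 h']
  · exact main a b c h0 h1 h2 h3

/-- The row of cells starting at `d` in a direction that increases the lattice coordinates by
`(p, q)` does not meet `T`. Cells of the row are described by the strips containing them. -/
def RowFree (T : List Cell) (d : Cell) (p q : ℤ) : Prop :=
  ∀ c ∈ T, ¬ (0 ≤ p * (c.1 - d.1) ∧ 0 ≤ q * (c.2.1 - d.2.1) ∧ 0 ≤ (p + q) * (c.diag - d.diag) ∧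
    (p = 0 → c.1 = d.1) ∧ (q = 0 → c.2.1 = d.2.1) ∧ (p + q = 0 → c.diag = d.diag))

instance (T : List Cell) (d : Cell) (p q : ℤ) : Decidable (RowFree T d p q) := by
  unfold RowFree; infer_instance

/-- The directions of the six rows starting at a cell. -/
def rowDirs : List (ℤ × ℤ) := [(1, 0), (-1, 0), (0, 1), (0, -1), (1, -1), (-1, 1)]

/-- The finite computation behind `exists_rowFree`; all representatives lie in a 4 by 4 box. -/
theorem rowFree_box : ∀ r ∈ reps 7, ∀ i : ℕ, i < 4 → ∀ j : ℕ, j < 4 →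
    ∀ b : Bool, ((i : ℤ), (j : ℤ), b) ∉ r →
      ∃ u ∈ rowDirs, RowFree r ((i : ℤ), (j : ℤ), b) u.1 u.2 := by
  decide +kernel

theorem reps_box : ∀ r ∈ reps 7, ∀ c ∈ r, 0 ≤ c.1 ∧ c.1 < 4 ∧ 0 ≤ c.2.1 ∧ c.2.1 < 4 := by
  decide +kernel

/-- From every cell outside a heptiamond a row leads to infinity outside the heptiamond. -/
theorem exists_rowFree {r : List Cell} (hr : r ∈ reps 7) {d : Cell} (hd : d ∉ r) :
    ∃ u ∈ rowDirs, RowFree r d u.1 u.2 := by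
  obtain ⟨i, j, b⟩ := d
  by_cases hj : 0 ≤ j ∧ j < 4
  · by_cases hi : 0 ≤ i ∧ i < 4
    · obtain ⟨i', rfl⟩ := Int.eq_ofNat_of_zero_le hi.1
      obtain ⟨j', rfl⟩ := Int.eq_ofNat_of_zero_le hj.1
      exact rowFree_box r hr i' (by omega) j' (by omega) b hd
    · refine ⟨(0, 1), by simp [rowDirs], fun c hc h => ?_⟩
      have h1 := h.2.2.2.1 rfl
      have h2 := reps_box r hr c hc
      simp only at h1
      omega
  · refine ⟨(1, 0), by simp [rowDirs], fun c hc h => ?_⟩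
    have h1 := h.2.2.2.2.1 rfl
    have h2 := reps_box r hr c hc
    simp only at h1
    omega

theorem Cell.center_strict (d : Cell) : ((d.1 : ℝ) < X d.center ∧ X d.center < d.1 + 1) ∧
    ((d.2.1 : ℝ) < Y d.center ∧ Y d.center < d.2.1 + 1) ∧
      ((d.diag : ℝ) < X d.center + Y d.center ∧ X d.center + Y d.center < d.diag + 1) := by
  obtain ⟨i, j, b⟩ := d
  cases b <;> simp [Cell.center, Cell.diag] <;> norm_num <;> constructor <;> linarith

theorem Cell.not_onGrid_of_strict {d : Cell} {z : Plane} (h1 : (d.1 : ℝ) < X z)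
    (h2 : X z < d.1 + 1) (h3 : (d.2.1 : ℝ) < Y z) (h4 : Y z < d.2.1 + 1)
    (h5 : (d.diag : ℝ) < X z + Y z) (h6 : X z + Y z < d.diag + 1) : ¬ OnGrid z := by
  have key : ∀ (m n : ℤ) (x : ℝ), (m : ℝ) < x → x < m + 1 → x ≠ n := by
    rintro m n x h1 h2 rfl
    have e1 : m < n := by exact_mod_cast h1
    have e2 : n < m + 1 := by exact_mod_cast h2
    omega
  rintro ⟨n, h | h | h⟩
  · exact key _ n _ h1 h2 h
  · exact key _ n _ h3 h4 h
  · exact key _ n _ h5 h6 h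

/-- A point moving with velocity `p` from inside the strip `m` can reach only strips on the side of
`m` given by the sign of `p`. -/
theorem strip_of_ray {m n p : ℤ} {x t : ℝ} (h1 : (m : ℝ) < x) (h2 : x < m + 1) (ht : 0 ≤ t)
    (h3 : (n : ℝ) ≤ x + t * p) (h4 : x + t * p ≤ n + 1) : 0 ≤ p * (n - m) ∧ (p = 0 → n = m) := by
  have up : 0 ≤ p → m ≤ n := fun hp => by
    have h5 : 0 ≤ t * p := mul_nonneg ht (by exact_mod_cast hp)
    have : (m : ℝ) < n + 1 := by linarith
    have : m < n + 1 := by exact_mod_cast this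
    omega
  have down : p ≤ 0 → n ≤ m := fun hp => by
    have h5 : t * p ≤ 0 := mul_nonpos_of_nonneg_of_nonpos ht (by exact_mod_cast hp)
    have : (n : ℝ) < m + 1 := by linarith
    have : n < m + 1 := by exact_mod_cast this
    omega
  refine ⟨?_, fun hp => le_antisymm (down hp.le) (up hp.ge)⟩
  rcases le_total 0 p with hp | hp
  · exact mul_nonneg hp (sub_nonneg.2 (up hp))
  · exact mul_nonneg_of_nonpos_of_nonpos hp (sub_nonpos.2 (down hp))

theorem strip_of_segment {m x c t : ℝ} (h1 : m ≤ x) (h2 : x ≤ m + 1) (h3 : m < c) (h4 : c < m + 1)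
    (h5 : 0 < t) (h6 : t ≤ 1) : m < x + t * (c - x) ∧ x + t * (c - x) < m + 1 := by
  constructor
  · nlinarith [mul_pos h5 (sub_pos.2 h3), mul_nonneg (sub_nonneg.2 h6) (sub_nonneg.2 h1)]
  · nlinarith [mul_pos h5 (sub_pos.2 h4), mul_nonneg (sub_nonneg.2 h6) (sub_nonneg.2 h2)]

/-- From a point outside, one can move to the centre of a cell containing it and then along a row of
cells to infinity. -/
theorem fillsTriangles_rep {r : List Cell} (hr : r ∈ reps 7) :
    FillsTriangles (region r.toFinset) := by
  refine fillsTriangles_of_escape fun z hz => ?_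
  obtain ⟨d, hzd⟩ := Cell.exists_mem z
  have hd : d ∉ r := fun hd => hz (by
    simp only [region, Set.mem_iUnion]
    exact ⟨d, List.mem_toFinset.2 hd, hzd⟩)
  obtain ⟨⟨p, q⟩, hu, hfree⟩ := exists_rowFree hr hd
  obtain ⟨⟨c1, c2⟩, ⟨c3, c4⟩, c5, c6⟩ := d.center_strict
  refine ⟨segment ℝ z d.center ∪ (fun t : ℝ => d.center + t • pt p q) '' Set.Ici 0, ?_,
    Or.inl (left_mem_segment ℝ _ _), ?_, ?_⟩
  · refine (convex_segment z d.center).isPreconnected.union d.center (right_mem_segment ℝ _ _)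
      ⟨0, Set.self_mem_Ici, by simp⟩ (isPreconnected_Ici.image _ ?_)
    exact Continuous.continuousOn (by fun_prop)
  · rw [Set.disjoint_left]
    intro y hy hyR
    simp only [region, Set.mem_iUnion] at hyR
    obtain ⟨c, hc, hyc⟩ := hyR
    rw [List.mem_toFinset] at hc
    -- on the way to the centre of `d` only the starting point can belong to other cells; on the row
    -- only the cells counted by `RowFree` are met
    rcases hy with hy | ⟨t, ht, rfl⟩
    · obtain ⟨t, t0, t1, hX, hY⟩ := mem_segment_iff_XY.1 hy
      rcases t0.eq_or_lt with rfl | t0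
      · have : y = z := ext_XY (by simpa using hX) (by simpa using hY)
        subst this
        exact hz (by
          simp only [region, Set.mem_iUnion]
          exact ⟨c, List.mem_toFinset.2 hc, hyc⟩)
      · obtain ⟨⟨z1, z2⟩, ⟨z3, z4⟩, z5, z6⟩ := Cell.mem_triangle.1 hzd
        have hg : ¬ OnGrid y := by
          have e1 := strip_of_segment z1 z2 c1 c2 t0 t1
          have e2 := strip_of_segment z3 z4 c3 c4 t0 t1
          have e3 := strip_of_segment z5 z6 c5 c6 t0 t1
          rw [← hX] at e1
          rw [← hY] at e2
          rw [show X z + Y z + t * (X d.center + Y d.center - (X z + Y z)) = X y + Y y by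
            rw [hX, hY]; ring] at e3
          exact Cell.not_onGrid_of_strict e1.1 e1.2 e2.1 e2.2 e3.1 e3.2
        have hyd : y ∈ d.triangle := d.triangle_convex.segment_subset hzd d.center_mem hy
        exact hd (Cell.eq_of_mem hg hyc hyd ▸ hc)
    · obtain ⟨⟨z1, z2⟩, ⟨z3, z4⟩, z5, z6⟩ := Cell.mem_triangle.1 hyc
      simp only [X_add, Y_add, X_smul, Y_smul, X_pt, Y_pt] at z1 z2 z3 z4 z5 z6
      have ht : (0 : ℝ) ≤ t := ht
      have e1 := strip_of_ray c1 c2 ht z1 z2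
      have e2 := strip_of_ray c3 c4 ht z3 z4
      have e3 := strip_of_ray (p := p + q) (n := c.diag) c5 c6 ht
        (by push_cast; linarith) (by push_cast; linarith)
      exact hfree c hc ⟨e1.1, e2.1, e3.1, e1.2, e2.2, e3.2⟩
  · intro R
    have hu0 : (pt p q : Plane) ≠ 0 := by
      intro h
      have h1 := congrArg X h
      have h2 := congrArg Y h
      simp only [X_pt, Y_pt, X_zero, Y_zero, Int.cast_eq_zero] at h1 h2
      subst h1 h2
      simp [rowDirs] at hu
    have hpos : 0 < ‖(pt p q : Plane)‖ := norm_pos_iff.2 hu0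
    set t := (|R| + ‖d.center‖ + 1) / ‖(pt p q : Plane)‖ with ht
    have ht0 : 0 ≤ t := by positivity
    refine ⟨d.center + t • pt p q, Or.inr ⟨t, ht0, rfl⟩, ?_⟩
    have h1 := norm_sub_le (d.center + t • (pt p q : Plane)) d.center
    rw [add_sub_cancel_left, norm_smul, Real.norm_of_nonneg ht0, ht,
      div_mul_cancel₀ _ hpos.ne'] at h1
    rw [dist_zero_right]
    linarith [le_abs_self R]

theorem FillsTriangles.image {R : Set Plane} (h : FillsTriangles R) (e : Plane ≃ᵢ Plane) :
    FillsTriangles (e '' R) := by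
  have key : ∀ s : Set Plane, convexHull ℝ s ⊆ e '' R ↔ convexHull ℝ (e.symm '' s) ⊆ R := by
    intro s
    rw [← IsometryEquiv.image_convexHull, Set.image_subset_iff]
    constructor
    · intro h z hz
      obtain ⟨y, hy, rfl⟩ := h hz
      rw [Set.mem_preimage, IsometryEquiv.symm_apply_apply]
      exact hy
    · intro h z hz
      exact ⟨e.symm z, h hz, e.apply_symm_apply z⟩
  intro a b c h1 h2 h3
  rw [← convexHull_pair, key, Set.image_pair, convexHull_pair] at h1 h2 h3
  rw [key, Set.image_insert_eq, Set.image_pair]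
  exact h _ _ _ h1 h2 h3

theorem LatticeSym.image_region (g : LatticeSym) (T : Finset Cell) :
    g.iso '' region T = region (T.map g.cell.toEmbedding) := by
  simp only [region, Set.image_iUnion, g.image_triangle, Finset.mem_map_equiv]
  ext z
  simp only [Set.mem_iUnion]
  constructor
  · rintro ⟨c, hc, hz⟩
    exact ⟨g.cell c, by simpa using hc, hz⟩
  · rintro ⟨c, hc, hz⟩
    exact ⟨_, hc, by simpa using hz⟩

/-- Heptiamonds have no triangular holes. -/
theorem IsHeptiamond.fillsTriangles {T : Finset Cell} (hT : IsHeptiamond T) :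
    FillsTriangles (region T) := by
  obtain ⟨r, hr, g, hg⟩ := exists_rep 6 (by norm_num) T hT
  have h := (fillsTriangles_rep hr).image g.iso.symm
  rw [← hg, ← g.image_region, Set.image_image] at h
  simpa using h

/-! ### A common point of three convex sets -/

/-- Three compact convex sets that meet pairwise have a common point if their union contains the
triangle formed by points common to two of them. -/
theorem exists_common_point {K : Fin 3 → Set Plane} (hc : ∀ i, Convex ℝ (K i))
    (hK : ∀ i, IsCompact (K i)) {a b c : Plane} (ha : a ∈ K 0 ∩ K 1) (hb : b ∈ K 0 ∩ K 2)
    (hc' : c ∈ K 1 ∩ K 2) (h : convexHull ℝ {a, b, c} ⊆ ⋃ i, K i) :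
    ∃ x, ∀ i, x ∈ K i := by
  by_contra! hno
  have hdisj : Disjoint (K 0 ∩ K 1) (K 2) := by
    rw [Set.disjoint_left]
    rintro x ⟨h0, h1⟩ h2
    obtain ⟨i, hi⟩ := hno x
    fin_cases i <;> exact hi ‹_›
  obtain ⟨φ, u, v, hu, huv, hv⟩ := geometric_hahn_banach_compact_closed ((hc 0).inter (hc 1))
    ((hK 0).inter (hK 1)) (hc 2) (hK 2).isClosed hdisj
  -- the line between `K 0 ∩ K 1` and `K 2` crosses the triangle in a connected set
  set L : Set Plane := convexHull ℝ {a, b, c} ∩ {z | φ z = u} with hL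
  have hLc : Convex ℝ L :=
    (convex_convexHull ℝ _).inter (convex_hyperplane φ.toLinearMap.isLinear u)
  have hcross : ∀ p q, φ p < u → u < φ q → ∃ z ∈ segment ℝ p q, φ z = u := by
    intro p q h1 h2
    have hne : φ q - φ p ≠ 0 := by linarith
    refine ⟨p + ((u - φ p) / (φ q - φ p)) • (q - p), ?_, ?_⟩
    · rw [segment_eq_image']
      refine ⟨_, ⟨div_nonneg (by linarith) (by linarith), ?_⟩, rfl⟩
      rw [div_le_one (by linarith)]
      linarith
    · rw [map_add, map_smul, map_sub, smul_eq_mul]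
      field_simp
      ring
  have hsub : L ⊆ K 0 ∪ K 1 := by
    rintro z ⟨hz, hzu⟩
    obtain ⟨i, hi⟩ := Set.mem_iUnion.1 (h hz)
    fin_cases i
    · exact Or.inl hi
    · exact Or.inr hi
    · have h1 := hv z hi
      have h2 : φ z = u := hzu
      linarith
  have hmem : ∀ p ∈ ({a, b, c} : Set Plane), ∀ q ∈ ({a, b, c} : Set Plane), ∀ z ∈ segment ℝ p q,
      φ z = u → z ∈ L := fun p hp q hq z hz hzu =>
    ⟨(convex_convexHull ℝ _).segment_subset (subset_convexHull ℝ _ hp) (subset_convexHull ℝ _ hq)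
      hz, hzu⟩
  -- it meets both `K 0` and `K 1`, on the sides `a b` and `a c`
  obtain ⟨y, hy, hyu⟩ := hcross a b (hu a ha) (huv.trans (hv b hb.2))
  obtain ⟨y', hy', hyu'⟩ := hcross a c (hu a ha) (huv.trans (hv c hc'.2))
  obtain ⟨z, hz, h0, h1⟩ := isPreconnected_closed_iff.1 hLc.isPreconnected _ _ (hK 0).isClosed
    (hK 1).isClosed hsub
    ⟨y, hmem a (by simp) b (by simp) y hy hyu, (hc 0).segment_subset ha.1 hb.1 hy⟩
    ⟨y', hmem a (by simp) c (by simp) y' hy' hyu', (hc 1).segment_subset ha.2 hc'.1 hy'⟩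
  exact absurd (hu z ⟨h0, h1⟩) (by rw [show φ z = u from hz.2]; exact lt_irrefl u)

/-! ### The common vertex of the three pentagons -/

/-- Two edges of a pentagon meet in a vertex only. -/
theorem IsCyclic.eq_vertex {v : Fin 5 → Plane} {ε : ℝ} (h : IsCyclic ε v) {a b : Fin 5}
    (hab : a ≠ b) {z : Plane} (ha : z ∈ segment ℝ (v a) (v (a + 1)))
    (hb : z ∈ segment ℝ (v b) (v (b + 1))) : (b = a + 1 ∧ z = v b) ∨ (a = b + 1 ∧ z = v a) := by
  have aff := isAff_cr (h.ne_succ a)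
  have hz : cr (v a) (v (a + 1)) z = 0 := by
    obtain ⟨s, t, -, -, hst, rfl⟩ := ha
    have := aff.combo (v a) (v (a + 1)) hst
    simp only [cr_self_right, cr_self_mid, mul_zero, add_zero] at this
    exact this
  have hpos : ∀ m, m ≠ a → m ≠ a + 1 → 0 < ε * cr (v a) (v (a + 1)) (v m) := by
    intro m h1 h2
    have := h.pos a (i := 0) (j := 1) (k := m - a) (by decide)
      ((by decide : ∀ m k : Fin 5, m ≠ k → m ≠ k + 1 → 1 < m - k) m a h1 h2)
    rwa [zero_add, add_comm 1 a, sub_add_cancel] at this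
  obtain ⟨s, t, hs, ht, hst, rfl⟩ := hb
  have e := aff.combo (v b) (v (b + 1)) hst
  rw [hz] at e
  by_cases h1 : b = a + 1
  · subst h1
    refine Or.inl ⟨rfl, ?_⟩
    have h2 := hpos (a + 1 + 1) ((by decide : ∀ a : Fin 5, a + 1 + 1 ≠ a) a)
      ((by decide : ∀ a : Fin 5, a + 1 + 1 ≠ a + 1) a)
    rw [cr_self_right, mul_zero, zero_add] at e
    have ht0 : t = 0 := (mul_eq_zero.1 e.symm).resolve_right fun h0 => by
      rw [h0, mul_zero] at h2
      exact lt_irrefl _ h2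
    rw [ht0, add_zero] at hst
    rw [ht0, hst, one_smul, zero_smul, add_zero]
  · have h2 := hpos b (Ne.symm hab) h1
    by_cases h3 : b + 1 = a
    · subst h3
      refine Or.inr ⟨rfl, ?_⟩
      rw [cr_self_mid, mul_zero, add_zero] at e
      have hs0 : s = 0 := (mul_eq_zero.1 e.symm).resolve_right fun h0 => by
        rw [h0, mul_zero] at h2
        exact lt_irrefl _ h2
      rw [hs0, zero_add] at hst
      rw [hs0, hst, one_smul, zero_smul, zero_add]
    · have h4 := hpos (b + 1) h3 (fun h => hab (add_right_cancel h).symm)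
      exfalso
      have h5 : s * (ε * cr (v a) (v (a + 1)) (v b)) +
          t * (ε * cr (v a) (v (a + 1)) (v (b + 1))) = 0 := by
        linear_combination (-ε) * e
      rcases hs.eq_or_lt with rfl | hs
      · obtain rfl : t = 1 := by linarith
        linarith
      · have := mul_pos hs h2
        have := mul_nonneg ht h4.le
        linarith

namespace Config

variable {T : Finset Cell} {C : Config T}

/-- Any two of the pentagons meet in a common edge: each of them has two edges off the lines of the
tiling, which touch one other pentagon each, and not the same. -/
theorem exists_shared (hT : T.card = 7) {i j : Fin 3} (hij : i ≠ j) :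
    ∃ a b, ¬ C.IsInt i a ∧ C.On i j a ∧ C.edge i a = C.edge j b ∧
      ∀ z ∈ C.pent i, z ∈ C.pent j → z ∈ C.edge i a := by
  have key : ∀ {i j : Fin 3}, i ≠ j → ∃ a b, ¬ C.IsInt i a ∧ C.On i j a ∧ C.On j i b := by
    intro i j hij
    obtain ⟨a, b, hab, ha, hb⟩ := exists_two (C := C) hT i
    obtain ⟨p, hp, m, h1, h2, -⟩ := C.exists_contact ha (left_mem_segment ℝ _ _)
    obtain ⟨q, hq, n, h3, h4, -⟩ := C.exists_contact hb (left_mem_segment ℝ _ _)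
    by_cases hpj : p = j
    · subst hpj
      exact ⟨a, m, ha, h1, h2⟩
    by_cases hqj : q = j
    · subst hqj
      exact ⟨b, n, hb, h3, h4⟩
    obtain rfl : p = q := (by decide : ∀ i j p q : Fin 3,
      i ≠ j ∧ p ≠ i ∧ q ≠ i ∧ p ≠ j ∧ q ≠ j → p = q) i j p q ⟨hij, hp, hq, hpj, hqj⟩
    exact (hab (C.on_unique hp.symm h1 h3)).elim
  have sub : ∀ {i j : Fin 3} {a b : Fin 5}, i ≠ j → ¬ C.IsInt i a → C.On i j a → C.On j i b →
      C.edge i a ⊆ C.edge j b := by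
    intro i j a b hij ha h1 h2
    obtain ⟨p, q, hpq, hp, hq⟩ := exists_two (C := C) hT i
    by_cases hap : a = p
    · exact edge_subset_of_two ha hq (hap ▸ hpq) hij.symm h1 h2
    · exact edge_subset_of_two ha hp hap hij.symm h1 h2
  obtain ⟨a, b, ha, h1, h2⟩ := key hij
  have hb := h1.not_isInt hij h2 ha
  refine ⟨a, b, ha, h1, Set.Subset.antisymm (sub hij ha h1 h2) (sub hij.symm hb h2 h1), ?_⟩
  have s := sub hij ha h1 h2
  obtain ⟨m, h3, h4⟩ := C.exists_on hij ((C.cyc i).ne_succ a)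
    (C.edge_subset i a (left_mem_segment ℝ _ _)) (C.edge_subset i a (right_mem_segment ℝ _ _))
    (C.edge_subset j b (s (left_mem_segment ℝ _ _)))
    (C.edge_subset j b (s (right_mem_segment ℝ _ _)))
  rwa [C.on_unique hij h1 h3]

/-- The three pentagons have a common vertex `x`. The two edges of each pentagon at `x` are shared
with the other pentagons; the remaining three edges lie on lines of the tiling. For pentagons `i`
and `j`, the index `s i j` is that of the endpoint other than `x` of their common edge, counted
from `x` along the pentagon `i`. -/
theorem exists_apex (hT : IsHeptiamond T) : ∃ (x : Plane) (k : Fin 3 → Fin 5)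
    (s : Fin 3 → Fin 3 → Fin 5), (∀ i, C.w i (k i) = x) ∧
      (∀ i, ¬ C.IsInt i (k i) ∧ ¬ C.IsInt i (k i + 4) ∧ C.IsInt i (k i + 1) ∧
        C.IsInt i (k i + 2) ∧ C.IsInt i (k i + 3)) ∧
      (∀ i j, i ≠ j → (s i j = 1 ∨ s i j = 4) ∧ C.w i (k i + s i j) = C.w j (k j + s j i) ∧
        ∃ c : ℝ, c ≠ 0 ∧ (∀ z ∈ C.pent i, 0 ≤ c * cr x (C.w i (k i + s i j)) z) ∧
          ∀ z ∈ C.pent j, c * cr x (C.w i (k i + s i j)) z ≤ 0) ∧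
      ∀ i j l, j ≠ i → l ≠ i → j ≠ l → s i j ≠ s i l := by
  have hcard := hT.1
  choose! κ κ' h1 h2 h3 h4 using fun i j (hij : i ≠ j) => exists_shared (C := C) hcard hij
  have hmem : ∀ {i j : Fin 3} {z : Plane}, i ≠ j → z ∈ C.edge i (κ i j) → z ∈ C.pent i ∩ C.pent j :=
    fun {i j z} hij hz => ⟨C.edge_subset _ _ hz, C.edge_subset _ _ (h3 i j hij ▸ hz)⟩
  -- the pentagons meet pairwise, so they have a common point because the region has no holes
  obtain ⟨x, hx⟩ : ∃ x, ∀ i, x ∈ C.pent i := by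
    have l : ∀ i j, C.w i (κ i j) ∈ C.edge i (κ i j) := fun i j => left_mem_segment ℝ _ _
    have m1 := hmem (i := 0) (j := 1) (by decide) (l _ _)
    have m2 := hmem (i := 0) (j := 2) (by decide) (l _ _)
    have m3 := hmem (i := 1) (j := 2) (by decide) (l _ _)
    have hconv : ∀ i, Convex ℝ (C.pent i) := fun i => convex_convexHull ℝ _
    refine exists_common_point hconv C.isCompact_pent m1 m2 m3 ?_
    rw [show (⋃ i, C.pent i) = region T from C.cover]
    refine hT.fillsTriangles _ _ _ ?_ ?_ ?_
    · exact ((hconv 0).segment_subset m1.1 m2.1).trans (C.pent_subset 0)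
    · exact ((hconv 2).segment_subset m2.2 m3.2).trans (C.pent_subset 2)
    · exact ((hconv 1).segment_subset m3.1 m1.2).trans (C.pent_subset 1)
  have hxe : ∀ i j, i ≠ j → x ∈ C.edge i (κ i j) := fun i j hij => h4 i j hij x (hx i) (hx j)
  -- this point lies on two different edges of each pentagon, hence it is their common vertex
  have hne : ∀ i j l, j ≠ i → l ≠ i → j ≠ l → κ i j ≠ κ i l := by
    intro i j l hj hl hjl h
    have hon := h2 i l hl.symm
    rw [← h] at hon
    obtain ⟨p, q, hpq, hp, hq⟩ := exists_two (C := C) hcard i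
    by_cases hap : κ i j = p
    · exact hjl (eq_of_on (hap ▸ hpq) hq hj hl (h2 i j hj.symm) hon)
    · exact hjl (eq_of_on hap hp hj hl (h2 i j hj.symm) hon)
  have hk : ∀ i, ∃ k, C.w i k = x ∧ (∀ j, j ≠ i → κ i j = k ∨ κ i j = k + 4) ∧
      ¬ C.IsInt i k ∧ ¬ C.IsInt i (k + 4) := by
    intro i
    obtain ⟨j, l, hj, hl, hjl, hall⟩ : ∃ j l, j ≠ i ∧ l ≠ i ∧ j ≠ l ∧ ∀ m, m ≠ i → m = j ∨ m = l :=
      (by decide : ∀ i : Fin 3, ∃ j l, j ≠ i ∧ l ≠ i ∧ j ≠ l ∧ ∀ m, m ≠ i → m = j ∨ m = l) i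
    have key : ∀ j l, j ≠ i → l ≠ i → (∀ m, m ≠ i → m = j ∨ m = l) → κ i l = κ i j + 1 →
        x = C.w i (κ i l) → ∃ k, C.w i k = x ∧ (∀ j, j ≠ i → κ i j = k ∨ κ i j = k + 4) ∧
          ¬ C.IsInt i k ∧ ¬ C.IsInt i (k + 4) := by
      intro j l hj hl hall e1 e2
      have e3 : κ i j = κ i l + 4 := by
        rw [e1, add_assoc]
        exact (add_zero _).symm
      refine ⟨κ i l, e2.symm, fun m hm => ?_, h1 i l hl.symm, e3 ▸ h1 i j hj.symm⟩
      rcases hall m hm with rfl | rfl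
      · exact Or.inr e3
      · exact Or.inl rfl
    rcases (C.cyc i).eq_vertex (hne i j l hj hl hjl) (hxe i j hj.symm) (hxe i l hl.symm) with
      ⟨e1, e2⟩ | ⟨e1, e2⟩
    · exact key j l hj hl hall e1 e2
    · exact key l j hl hj (fun m hm => (hall m hm).symm) e1 e2
  choose k hk1 hk2 hk3 hk4 using hk
  -- these two edges are the only ones off the lines of the tiling
  have hint : ∀ i m, m ≠ k i → m ≠ k i + 4 → C.IsInt i m := by
    intro i m hm hm'
    by_contra hno
    have := C.card_not_isInt_le i {k i, k i + 4, m} (by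
      intro n hn
      simp only [Finset.mem_insert, Finset.mem_singleton] at hn
      rcases hn with rfl | rfl | rfl
      exacts [hk3 i, hk4 i, hno])
    rw [Finset.card_eq_three.2 ⟨k i, k i + 4, m,
      (by decide : ∀ k : Fin 5, k ≠ k + 4) _, hm.symm, hm'.symm, rfl⟩] at this
    omega
  have hs : ∀ i j, i ≠ j → ∃ s : Fin 5, (s = 1 ∧ κ i j = k i ∨ s = 4 ∧ κ i j = k i + 4) ∧
      C.edge i (κ i j) = segment ℝ x (C.w i (k i + s)) := by
    intro i j hij
    rcases hk2 i j hij.symm with h | h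
    · exact ⟨1, Or.inl ⟨rfl, h⟩, by rw [h, edge, hk1]⟩
    · refine ⟨4, Or.inr ⟨rfl, h⟩, ?_⟩
      rw [h, edge, segment_symm, show k i + 4 + 1 = k i by rw [add_assoc]; exact add_zero _, hk1]
  choose! s hs1 hs2 using hs
  have hsne : ∀ i j, i ≠ j → x ≠ C.w i (k i + s i j) := by
    intro i j hij h
    rw [← hk1 i] at h
    have := (C.cyc i).injective h
    rcases hs1 i j hij with h' | h' <;> rw [h'.1] at this <;> simp at this
  refine ⟨x, k, s, hk1, fun i => ⟨hk3 i, hk4 i, ?_, ?_, ?_⟩, fun i j hij => ⟨?_, ?_, ?_⟩, ?_⟩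
  · exact hint i _ (by simp) (by simp)
  · exact hint i _ (by simp) (by simp)
  · exact hint i _ (by simp) (by simp)
  · rcases hs1 i j hij with h | h
    exacts [Or.inl h.1, Or.inr h.1]
  · have e1 : C.edge i (κ i j) = C.edge j (κ j i) := by
      apply Set.Subset.antisymm
      · intro z hz
        exact h4 j i hij.symm z (hmem hij hz).2 (hmem hij hz).1
      · intro z hz
        exact h4 i j hij z (hmem hij.symm hz).2 (hmem hij.symm hz).1
    rw [hs2 i j hij, hs2 j i hij.symm] at e1
    have m1 : C.w i (k i + s i j) ∈ segment ℝ x (C.w j (k j + s j i)) :=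
      e1 ▸ right_mem_segment ℝ _ _
    have m2 : C.w j (k j + s j i) ∈ segment ℝ x (C.w i (k i + s i j)) :=
      e1 ▸ right_mem_segment ℝ _ _
    rcases endpoints_of_dist_le (hsne j i hij.symm) (left_mem_segment ℝ _ _) m1
      (dist_le_of_mem_segment (left_mem_segment ℝ _ _) m2) with h | h
    · exact h.2
    · exact (hsne i j hij h.2.symm).elim
  · have haff := C.isAff i j hij
    obtain ⟨c, hc, hc'⟩ := haff.eq_cr (hsne i j hij)
      ((h2 i j hij).h_eq_zero hij (hs2 i j hij ▸ left_mem_segment ℝ _ _))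
      ((h2 i j hij).h_eq_zero hij (hs2 i j hij ▸ right_mem_segment ℝ _ _))
    refine ⟨c, hc, fun z hz => ?_, fun z hz => ?_⟩
    · rw [← hc']
      exact C.nonneg i j hij z hz
    · rw [← hc']
      have := C.nonneg j i hij.symm z hz
      rw [C.anti i j] at this
      linarith
  · intro i j l hj hl hjl h
    apply hne i j l hj hl hjl
    rcases hs1 i j hj.symm with h5 | h5 <;> rcases hs1 i l hl.symm with h6 | h6
    · rw [h5.2, h6.2]
    · rw [h5.1, h6.1] at h
      exact absurd h (by decide)
    · rw [h5.1, h6.1] at h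
      exact absurd h (by decide)
    · rw [h5.2, h6.2]

end Config

/-! ### Normalization of the labelling -/

theorem IntLine.symm {a b : Plane} (h : IntLine a b) : IntLine b a := by
  obtain ⟨n, h | h | h⟩ := h
  exacts [⟨n, Or.inl h.symm⟩, ⟨n, Or.inr (Or.inl h.symm)⟩, ⟨n, Or.inr (Or.inr h.symm)⟩]

theorem LatDir.symm {a b : Plane} (h : LatDir a b) : LatDir b a := by
  rcases h with h | h | h
  exacts [Or.inl h.symm, Or.inr (Or.inl h.symm), Or.inr (Or.inr h.symm)]

theorem LatDir.intLine {a b : Plane} (h : LatDir a b) (ha : IsLatt a) : IntLine a b := by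
  obtain ⟨p, q, hp, hq⟩ := ha
  rcases h with h | h | h
  · exact ⟨p, Or.inl ⟨hp, h ▸ hp⟩⟩
  · exact ⟨q, Or.inr (Or.inl ⟨hq, h ▸ hq⟩)⟩
  · exact ⟨p + q, Or.inr (Or.inr ⟨by rw [hp, hq]; push_cast; rfl, by
      rw [← h, hp, hq]; push_cast; rfl⟩)⟩

theorem ip_comm (a b : Plane) : ip a b = ip b a := by
  unfold ip; ring

/-- Two directions of the tiling are not perpendicular. -/
theorem LatDir.ip_ne_zero {a b c : Plane} (h : LatDir b a) (h' : LatDir b c) (hab : b ≠ a)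
    (hcb : b ≠ c) : ip (a - b) (c - b) ≠ 0 := by
  intro h0
  have h1 := (latDir_iff h' hcb).1 h
  rw [h0] at h1
  have h2 := nsq_pos (sub_ne_zero.2 hab.symm)
  have h3 := nsq_pos (sub_ne_zero.2 hcb.symm)
  have h4 := mul_pos h2 h3
  nlinarith [mul_pos h4 h4]

/-- Two segments of lines of the tiling issuing from a point `y`, on different sides of a line
through `y`, either meet in a lattice point or are opposite. -/
theorem isLatt_or_opposite {x y n n' : Plane} {c : ℝ} (h1 : IntLine y n) (h2 : IntLine y n')
    (hn : cr x y n ≠ 0) (hn' : n' ≠ y) (h3 : 0 ≤ c * cr x y n) (h4 : c * cr x y n' ≤ 0)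
    (hc : c ≠ 0) : IsLatt y ∨ ∃ t : ℝ, t < 0 ∧ n' - y = t • (n - y) := by
  by_cases h0 : cr n y n' = 0
  · right
    have hyn : y ≠ n := by
      rintro rfl
      simp at hn
    obtain ⟨t, rfl⟩ := eq_lineMap_of_cr_eq_zero hyn (by rw [cr_swap, h0, neg_zero])
    have e : cr x y (y + t • (n - y)) = t * cr x y n := by
      simp only [cr, X_add, Y_add, X_smul, Y_smul, X_sub, Y_sub]; ring
    refine ⟨t, ?_, by rw [add_sub_cancel_left]⟩
    have ht : t ≠ 0 := by
      rintro rfl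
      simp at hn'
    have h5 : 0 < c * cr x y n := lt_of_le_of_ne h3 (mul_ne_zero hc hn).symm
    rw [e] at h4
    refine lt_of_le_of_ne ?_ ht
    by_contra! h6
    nlinarith [mul_pos h6 h5]
  · exact Or.inl (isLatt_of_intLine h1.symm h2 h0)

/-- The vertex of a pentagon following the vertex `1`, or preceding the vertex `4`. -/
def nextIdx (s : Fin 5) : Fin 5 := if s = 1 then 2 else 3

/-- Three congruent pentagons with the common vertex `0`, such that the edges at this vertex are
shared and the other edges lie on lines of the tiling. The far end of a shared edge is a lattice
point unless the edges issuing from it on either side continue each other. -/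
structure Fan (T : Finset Cell) where
  /-- The common vertex. -/
  x : Plane
  /-- The vertices of the pentagons, in cyclic order starting at the common vertex. -/
  v : Fin 3 → Fin 5 → Plane
  /-- The orientations of the pentagons. -/
  ε : Fin 3 → ℝ
  /-- The index in the pentagon `i` of the far end of its common edge with the pentagon `j`. -/
  s : Fin 3 → Fin 3 → Fin 5
  sign : ∀ i, ε i = 1 ∨ ε i = -1
  cyc : ∀ i, IsCyclic (ε i) (v i)
  nsq_eq : ∀ i j k l, nsq (v i k - v i l) = nsq (v j k - v j l)
  area : ∀ i, ε i * pentArea (v i) = 7 / 3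
  cover : ⋃ i, convexHull ℝ (Set.range (v i)) = region T
  apex : ∀ i, v i 0 = x
  int : ∀ i, IntLine (v i 1) (v i 2) ∧ IntLine (v i 2) (v i 3) ∧ IntLine (v i 3) (v i 4)
  s_mem : ∀ i j, i ≠ j → s i j = 1 ∨ s i j = 4
  s_ne : ∀ i j l, j ≠ i → l ≠ i → j ≠ l → s i j ≠ s i l
  shared : ∀ i j, i ≠ j → v i (s i j) = v j (s j i)
  far : ∀ i j, i ≠ j → IsLatt (v i (s i j)) ∨ ∃ t : ℝ, t < 0 ∧
    v j (nextIdx (s j i)) - v i (s i j) = t • (v i (nextIdx (s i j)) - v i (s i j))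

namespace Config

variable {T : Finset Cell}

/-- The common vertex has the same index in all three pentagons. If two edges are not parallel to
the tiling, these are the edges at the common vertex. If all edges are parallel to the tiling, then
the far end of a shared edge is not a lattice point, so that the angles there are 60 and 120
degrees; since each pentagon has only one angle of 60 degrees, comparing lengths of shared edges
gives the claim. -/
theorem exists_fan (hT : IsHeptiamond T) (C : Config T) : ∃ F : Fan T, ∃ k : Fin 5,
    ∀ i m, F.v i m = C.w i (k + m) := by
  obtain ⟨x, k, s, hx, hint, hs, hsne⟩ := exists_apex (C := C) hT
  have a1 : ∀ k : Fin 5, k + 1 + 1 = k + 2 := fun k => by rw [add_assoc]; rfl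
  have a2 : ∀ k : Fin 5, k + 2 + 1 = k + 3 := fun k => by rw [add_assoc]; rfl
  have a3 : ∀ k : Fin 5, k + 3 + 1 = k + 4 := fun k => by rw [add_assoc]; rfl
  have a4 : ∀ k : Fin 5, k + 4 + 1 = k := fun k => by rw [add_assoc]; exact add_zero k
  have int1 : ∀ i, IntLine (C.w i (k i + 1)) (C.w i (k i + 2)) := fun i => by
    rw [← a1]; exact (hint i).2.2.1
  have int2 : ∀ i, IntLine (C.w i (k i + 2)) (C.w i (k i + 3)) := fun i => by
    rw [← a2]; exact (hint i).2.2.2.1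
  have int3 : ∀ i, IntLine (C.w i (k i + 3)) (C.w i (k i + 4)) := fun i => by
    rw [← a3]; exact (hint i).2.2.2.2
  have hfar : ∀ i j, i ≠ j → IsLatt (C.w i (k i + s i j)) ∨ ∃ t : ℝ, t < 0 ∧
      C.w j (k j + nextIdx (s j i)) - C.w i (k i + s i j) =
        t • (C.w i (k i + nextIdx (s i j)) - C.w i (k i + s i j)) := by
    intro i j hij
    have key : ∀ i j, i ≠ j → IntLine (C.w i (k i + s i j)) (C.w i (k i + nextIdx (s i j))) ∧
        cr x (C.w i (k i + s i j)) (C.w i (k i + nextIdx (s i j))) ≠ 0 ∧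
        C.w i (k i + nextIdx (s i j)) ≠ C.w i (k i + s i j) := by
      intro i j hij
      rw [← hx i]
      rcases (hs i j hij).1 with h | h
      · rw [h, nextIdx, if_pos rfl]
        refine ⟨int1 i, (C.cyc i).cr_ne ?_ ?_ ?_, fun h => ?_⟩
        · simp
        · simp
        · simp
        · simpa using (C.cyc i).injective h
      · rw [h, nextIdx, if_neg (by decide)]
        refine ⟨(int3 i).symm, (C.cyc i).cr_ne ?_ ?_ ?_, fun h => ?_⟩
        · simp
        · simp
        · simp
        · simpa using (C.cyc i).injective h
    obtain ⟨e1, e2, e3⟩ := key i j hij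
    obtain ⟨f1, -, f3⟩ := key j i hij.symm
    obtain ⟨-, h2, c, hc, h3, h4⟩ := hs i j hij
    rw [← h2] at f1 f3
    exact isLatt_or_opposite e1 f1 e2 f3 (h3 _ (subset_convexHull ℝ _ ⟨_, rfl⟩))
      (h4 _ (subset_convexHull ℝ _ ⟨_, rfl⟩)) hc
  have hk : ∀ i j, k i = k j := by
    rcases lat_or (C := C) 0 with hL | ⟨m, m', hne, hm, hm'⟩
    · -- all edges are parallel to the tiling
      have hL : ∀ i m, LatDir (C.w i m) (C.w i (m + 1)) := fun i m => C.lat_of_lat 0 i m (hL m)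
      obtain ⟨t, l1, l2, -, hac⟩ := (C.cyc 0).hex_shape (C.sign 0) (hL 0)
      have hac' : ∀ i m, 0 < ip (C.w i (m + 4) - C.w i m) (C.w i (m + 1) - C.w i m) ↔ m = t :=
        fun i m => by rw [C.ip_eq i 0]; exact hac m
      have hpos : ∀ m, 0 < dist (C.w 0 m) (C.w 0 (m + 1)) := fun m =>
        dist_pos.2 ((C.cyc 0).ne_succ m)
      -- exactly one of two adjacent pentagons has its angle of 60 degrees at the far end of the
      -- common edge
      have hone : ∀ i j, i ≠ j → (k i + s i j = t ↔ ¬ k j + s j i = t) := by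
        intro i j hij
        have key : ∀ i j, i ≠ j → (0 < ip (x - C.w i (k i + s i j))
            (C.w i (k i + nextIdx (s i j)) - C.w i (k i + s i j)) ↔ k i + s i j = t) ∧
            ip (x - C.w i (k i + s i j))
              (C.w i (k i + nextIdx (s i j)) - C.w i (k i + s i j)) ≠ 0 ∧
            ¬ IsLatt (C.w i (k i + s i j)) := by
          intro i j hij
          have hL' := hL i
          rw [← hx i]
          rcases (hs i j hij).1 with h | h
          · rw [h, nextIdx, if_pos rfl]
            have b1 := hL i (k i)
            have b2 := hL i (k i + 1)
            rw [a1] at b2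
            refine ⟨?_, b1.symm.ip_ne_zero b2 ((C.cyc i).ne_succ _).symm ?_, fun hl => ?_⟩
            · have := hac' i (k i + 1)
              rwa [a1, show k i + 1 + 4 = k i by rw [add_assoc]; exact add_zero _] at this
            · have := (C.cyc i).ne_succ (k i + 1)
              rwa [a1] at this
            · exact (hint i).1 (b1.symm.intLine hl).symm
          · rw [h, nextIdx, if_neg (by decide)]
            have b1 := hL i (k i + 4)
            have b2 := hL i (k i + 3)
            rw [a4] at b1
            rw [a3] at b2
            have ne1 := (C.cyc i).ne_succ (k i + 4)
            have ne2 := (C.cyc i).ne_succ (k i + 3)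
            rw [a4] at ne1
            rw [a3] at ne2
            refine ⟨?_, b1.ip_ne_zero b2.symm ne1 ne2.symm, fun hl => ?_⟩
            · have := hac' i (k i + 4)
              rw [a4, show k i + 4 + 4 = k i + 3 by rw [add_assoc]; rfl] at this
              rw [← this, ip_comm]
            · exact (hint i).2.1 (by
                rw [IsInt, a4]
                exact b1.intLine hl)
        obtain ⟨e1, e2, e3⟩ := key i j hij
        obtain ⟨f1, f2, -⟩ := key j i hij.symm
        rcases hfar i j hij with h | ⟨r, hr, h⟩
        · exact (e3 h).elim
        · rw [← (hs i j hij).2.1, h] at f1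
          have e : ∀ p q : Plane, ip p (r • q) = r * ip p q := fun p q => by
            simp only [ip, X_smul, Y_smul]; ring
          rw [e] at f1
          rw [← e1, ← f1]
          constructor
          · intro h1 h2
            nlinarith
          · intro h1
            by_contra h2
            have h3 := lt_of_le_of_ne (not_lt.1 h2) e2
            exact h1 (mul_pos_of_neg_of_neg hr h3)
      -- comparison of the lengths of the common edge: otherwise one of the edges at the angle of 60
      -- degrees would be as long as a proper part of it
      have hstep : ∀ i j l, i ≠ j → j ≠ l → i ≠ l → k i + s i j = t → k j + s j l = t →
          k i = k j := by
        intro i j l hij hjl hil h1 h2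
        have hd : dist (C.w 0 (k i)) (C.w 0 (k i + s i j)) =
            dist (C.w 0 (k j)) (C.w 0 (k j + s j i)) := by
          rw [C.dist_eq 0 i, C.dist_eq 0 j, hx, hx, (hs i j hij).2.1]
        have hne := hsne j i l hij hjl.symm hil
        have p1 := hpos (t + 1)
        have p2 := hpos (t + 2)
        rw [a1] at p1
        rw [a2] at p2
        rcases (hs i j hij).1 with g1 | g1 <;> rcases (hs j l hjl).1 with g2 | g2 <;>
          rcases (hs j i hij.symm).1 with g3 | g3 <;> rw [g1] at h1 hd <;> rw [g2] at h2 hne <;>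
          rw [g3] at hd hne
        · exact (hne rfl).elim
        · exact add_right_cancel (h1.trans h2.symm)
        · exfalso
          have q1 : k i = t + 4 := by rw [← h1]; generalize k i = a; revert a; decide
          have q2 : k j = t + 1 := by rw [← h2]; generalize k j = a; revert a; decide
          rw [q1, q2, a4, a1] at hd
          linarith
        · exact (hne rfl).elim
        · exact (hne rfl).elim
        · exfalso
          have q1 : k i = t + 1 := by rw [← h1]; generalize k i = a; revert a; decide
          have q2 : k j = t + 4 := by rw [← h2]; generalize k j = a; revert a; decide
          rw [q1, q2, show t + 1 + 4 = t by rw [add_assoc]; exact add_zero _,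
            show t + 4 + 4 = t + 3 by rw [add_assoc]; rfl, dist_comm,
            dist_comm (C.w 0 (t + 4))] at hd
          linarith
        · exact add_right_cancel (h1.trans h2.symm)
        · exact (hne rfl).elim
      have hex : ∀ i j l, j ≠ i → l ≠ i → j ≠ l → k i + s i j = t → ¬ k i + s i l = t :=
        fun i j l hj hl hjl h1 h2 => hsne i j l hj hl hjl (add_left_cancel (h1.trans h2.symm))
      -- so the far ends with an angle of 60 degrees follow each other around the common vertex
      have h01 := hone 0 1 (by decide)
      have h12 := hone 1 2 (by decide)
      have h20 := hone 2 0 (by decide)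
      have hall : k 0 = k 1 ∧ k 1 = k 2 := by
        by_cases h : k 0 + s 0 1 = t
        · have e2 := hex 0 1 2 (by decide) (by decide) (by decide) h
          have e3 : k 2 + s 2 0 = t := by tauto
          have e4 := hex 2 0 1 (by decide) (by decide) (by decide) e3
          have e5 : k 1 + s 1 2 = t := by tauto
          exact ⟨hstep 0 1 2 (by decide) (by decide) (by decide) h e5,
            hstep 1 2 0 (by decide) (by decide) (by decide) e5 e3⟩
        · have e1 : k 1 + s 1 0 = t := by tauto
          have e2 := hex 1 0 2 (by decide) (by decide) (by decide) e1
          have e3 : k 2 + s 2 1 = t := by tauto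
          have e4 := hex 2 1 0 (by decide) (by decide) (by decide) e3
          have e5 : k 0 + s 0 2 = t := by tauto
          exact ⟨(hstep 1 0 2 (by decide) (by decide) (by decide) e1 e5).symm,
            (hstep 2 1 0 (by decide) (by decide) (by decide) e3 e1).symm⟩
      intro i j
      fin_cases i <;> fin_cases j <;> simp [hall.1, hall.2]
    · -- two edges are not parallel to the tiling
      have hki : ∀ i m, ¬ C.Lat 0 m → m = k i ∨ m = k i + 4 := by
        intro i m hm
        have h := not_isInt_of_not_lat hm i
        rcases (by decide : ∀ k m : Fin 5, m = k ∨ m = k + 1 ∨ m = k + 2 ∨ m = k + 3 ∨ m = k + 4)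
          (k i) m with rfl | rfl | rfl | rfl | rfl
        · exact Or.inl rfl
        · exact (h (hint i).2.2.1).elim
        · exact (h (hint i).2.2.2.1).elim
        · exact (h (hint i).2.2.2.2).elim
        · exact Or.inr rfl
      intro i j
      exact (by decide : ∀ k k' m m' : Fin 5, m ≠ m' ∧ (m = k ∨ m = k + 4) ∧
        (m' = k ∨ m' = k + 4) ∧ (m = k' ∨ m = k' + 4) ∧ (m' = k' ∨ m' = k' + 4) → k = k')
        (k i) (k j) m m' ⟨hne, hki i m hm, hki i m' hm', hki j m hm, hki j m' hm'⟩
  have hk0 : ∀ i, k i = k 0 := fun i => hk i 0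
  simp only [hk0] at hx hs hfar int1 int2 int3
  refine ⟨⟨x, fun i m => C.w i (k 0 + m), C.ε, s, C.sign, fun i => ?_,
    fun i j a b => C.nsq_eq i j _ _, fun i => ?_, ?_, fun i => ?_, fun i => ⟨int1 i, int2 i, int3 i⟩,
    fun i j hij => (hs i j hij).1,
    hsne, fun i j hij => (hs i j hij).2.1, hfar⟩, k 0, fun i m => rfl⟩
  · have := (C.cyc i).rotate (k 0)
    simpa only [add_comm _ (k 0)] using this
  · have := pentArea_rotate (C.w i) (k 0)
    simp only [add_comm _ (k 0)] at this
    rw [this]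
    exact C.area hT.1 i
  · rw [← C.cover]
    refine Set.iUnion_congr fun i => ?_
    have : Function.Surjective fun m : Fin 5 => k 0 + m := fun m => ⟨m - k 0, by simp⟩
    rw [← this.range_comp (C.w i)]
    rfl
  · simp only [add_zero]
    exact hx i

end Config

/-! ### The shape of the pentagon -/

/-- The determinant of two vectors in lattice coordinates. -/
def dt (z w : Plane) : ℝ := X z * Y w - X w * Y z

theorem dt_hexDir (θ : Fin 6) : dt (hexDir θ) (hexDir (θ + 1)) = 1 ∧
    dt (hexDir θ) (hexDir (θ + 2)) = 1 ∧ dt (hexDir θ) (hexDir (θ + 3)) = 0 ∧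
      dt (hexDir θ) (hexDir (θ + 4)) = -1 := by
  fin_cases θ <;> simp [hexDir, dt]

theorem ip_hexDir_three (θ : Fin 6) : ip (hexDir θ) (hexDir (θ + 3)) = -1 ∧
    ip (hexDir θ) (hexDir (θ + 4)) = -1 / 2 ∧ ip (hexDir θ) (hexDir θ) = 1 := by
  fin_cases θ <;> simp [hexDir, ip] <;> norm_num

theorem ip_add_left (a b c : Plane) : ip (a + b) c = ip a c + ip b c := by
  simp only [ip, X_add, Y_add]; ring

theorem ip_smul_left (r : ℝ) (a b : Plane) : ip (r • a) b = r * ip a b := by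
  simp only [ip, X_smul, Y_smul]; ring

theorem dt_add_left (a b c : Plane) : dt (a + b) c = dt a c + dt b c := by
  simp only [dt, X_add, Y_add]; ring

theorem dt_smul_left (r : ℝ) (a b : Plane) : dt (r • a) b = r * dt a b := by
  simp only [dt, X_smul, Y_smul]; ring

theorem dt_comm (a b : Plane) : dt a b = -dt b a := by
  unfold dt; ring

theorem dt_self (a : Plane) : dt a a = 0 := by
  unfold dt; ring

/-- The difference of the two sides is a sum of nonnegative terms in `a - 1`, `b - 1`, `c - 1`. -/
theorem eq_one_of_sq_add_eq_seven {a b c : ℝ} (ha : 1 ≤ a) (hb : 1 ≤ b) (hc : 1 ≤ c)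
    (h : b ^ 2 + 4 * b * c + 2 * b * a + (c - a) ^ 2 = 7) : a = 1 ∧ b = 1 ∧ c = 1 := by
  have p1 := mul_nonneg (sub_nonneg.2 hb) (sub_nonneg.2 ha)
  have p2 := mul_nonneg (sub_nonneg.2 hb) (sub_nonneg.2 hc)
  have p3 := mul_nonneg (sub_nonneg.2 hb) (sub_nonneg.2 hb)
  have p4 := sq_nonneg (c - a)
  have e : b ^ 2 + 4 * b * c + 2 * b * a + (c - a) ^ 2 - 7 =
      (b - 1) * (b - 1) + 4 * ((b - 1) * (c - 1)) + 2 * ((b - 1) * (a - 1)) + (c - a) ^ 2 +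
        8 * (b - 1) + 4 * (c - 1) + 2 * (a - 1) := by ring
  exact ⟨by linarith, by linarith, by linarith⟩

set_option maxHeartbeats 1600000 in
/-- A pentagon of area `7 / 3` consisting of an isosceles triangle `v 0`, `v 1`, `v 4` with an angle
of 120 degrees at the apex `v 0`, and of a quadrangle `v 1`, `v 2`, `v 3`, `v 4` whose sides other
than the base of the triangle have directions `θ`, `φ`, `ψ` of the tiling and lengths `k`, `m`, `l`.
The last hypothesis says that `k` and `l` are integers or that the angles at `v 1` and `v 4` are
supplementary. -/
theorem lengths_eq_one {v : Fin 5 → Plane} (h : IsCyclic 1 v) (hA : pentArea v = 7 / 3)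
    {k m l : ℝ} {θ φ ψ : Fin 6} (hk : 0 < k) (hm : 0 < m) (hl : 0 < l)
    (h1 : v 2 - v 1 = k • hexDir θ) (h2 : v 3 - v 2 = m • hexDir φ)
    (h3 : v 4 - v 3 = l • hexDir ψ) (hX : X (v 4 - v 0) = -X (v 1 - v 0) - Y (v 1 - v 0))
    (hY : Y (v 4 - v 0) = X (v 1 - v 0)) (hm' : ∃ n : ℤ, m = n) (hkl : ∃ n : ℤ, k + l = n)
    (hbal : ((∃ n : ℤ, k = n) ∧ ∃ n : ℤ, l = n) ∨
      l * ip (v 0 - v 1) (v 2 - v 1) + k * ip (v 0 - v 4) (v 3 - v 4) = 0) :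
    k = 1 ∧ m = 1 ∧ l = 1 ∧ ((φ = θ + 1 ∧ ψ = θ + 3) ∨ (φ = θ + 2 ∧ ψ = θ + 3)) := by
  obtain ⟨D, hD⟩ : ∃ D, D = k • hexDir θ + (m • hexDir φ + l • hexDir ψ) := ⟨_, rfl⟩
  have hD' : D = v 4 - v 1 := by
    rw [hD, ← h1, ← h2, ← h3]
    abel
  simp only [X_sub, Y_sub] at hX hY
  -- the area and the angles in terms of the base `D` of the triangle
  have area : 3 * (k * m * dt (hexDir θ) (hexDir φ) + k * l * dt (hexDir θ) (hexDir ψ) +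
      m * l * dt (hexDir φ) (hexDir ψ)) + ip D D = 7 := by
    have e1 : k * m * dt (hexDir θ) (hexDir φ) + k * l * dt (hexDir θ) (hexDir ψ) +
        m * l * dt (hexDir φ) (hexDir ψ) = cr (v 1) (v 2) (v 3) + cr (v 1) (v 3) (v 4) := by
      have : k * m * dt (hexDir θ) (hexDir φ) + k * l * dt (hexDir θ) (hexDir ψ) +
        m * l * dt (hexDir φ) (hexDir ψ) = dt (k • hexDir θ) (m • hexDir φ) +
          dt (k • hexDir θ) (l • hexDir ψ) + dt (m • hexDir φ) (l • hexDir ψ) := by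
        simp only [dt, X_smul, Y_smul]; ring
      rw [this, ← h1, ← h2, ← h3]
      simp only [dt, cr, X_sub, Y_sub]
      ring
    have e2 : X (v 4) = X (v 0) - (X (v 1) - X (v 0)) - (Y (v 1) - Y (v 0)) := by linarith
    have e3 : Y (v 4) = Y (v 0) + (X (v 1) - X (v 0)) := by linarith
    have e4 : ip D D = 3 * cr (v 0) (v 1) (v 4) := by
      rw [hD']
      simp only [ip, cr, X_sub, Y_sub, e2, e3]
      ring
    have e5 : pentArea v = cr (v 1) (v 2) (v 3) + cr (v 1) (v 3) (v 4) +
        cr (v 0) (v 1) (v 4) := by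
      simp only [pentArea, cr]; ring
    rw [e1, e4]
    linarith
  have c1 : 0 < k * (ip D (hexDir θ) / 3 - dt D (hexDir θ) / 2) := by
    have e : k * (ip D (hexDir θ) / 3 - dt D (hexDir θ) / 2) = cr (v 0) (v 1) (v 2) := by
      have : k * (ip D (hexDir θ) / 3 - dt D (hexDir θ) / 2) =
          ip D (k • hexDir θ) / 3 - dt D (k • hexDir θ) / 2 := by
        simp only [ip, dt, X_smul, Y_smul]; ring
      rw [this, ← h1, hD']
      have e2 : X (v 4) = X (v 0) - (X (v 1) - X (v 0)) - (Y (v 1) - Y (v 0)) := by linarith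
      have e3 : Y (v 4) = Y (v 0) + (X (v 1) - X (v 0)) := by linarith
      simp only [ip, dt, cr, X_sub, Y_sub, e2, e3]
      ring
    rw [e]
    simpa using h 0 1 2 (by decide) (by decide)
  have c4 : 0 < l * (ip D (hexDir ψ) / 3 + dt D (hexDir ψ) / 2) := by
    have e : l * (ip D (hexDir ψ) / 3 + dt D (hexDir ψ) / 2) = cr (v 0) (v 3) (v 4) := by
      have : l * (ip D (hexDir ψ) / 3 + dt D (hexDir ψ) / 2) =
          ip D (l • hexDir ψ) / 3 + dt D (l • hexDir ψ) / 2 := by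
        simp only [ip, dt, X_smul, Y_smul]; ring
      rw [this, ← h3, hD']
      have e2 : X (v 4) = X (v 0) - (X (v 1) - X (v 0)) - (Y (v 1) - Y (v 0)) := by linarith
      have e3 : Y (v 4) = Y (v 0) + (X (v 1) - X (v 0)) := by linarith
      simp only [ip, dt, cr, X_sub, Y_sub, e2, e3]
      ring
    rw [e]
    simpa using h 0 3 4 (by decide) (by decide)
  have bal : l * ip (v 0 - v 1) (v 2 - v 1) + k * ip (v 0 - v 4) (v 3 - v 4) =
      k * l * (ip D (hexDir θ) / 2 + dt D (hexDir θ) / 4 + ip D (hexDir ψ) / 2 -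
        dt D (hexDir ψ) / 4) := by
    have : k * l * (ip D (hexDir θ) / 2 + dt D (hexDir θ) / 4 + ip D (hexDir ψ) / 2 -
        dt D (hexDir ψ) / 4) = l * (ip D (k • hexDir θ) / 2 + dt D (k • hexDir θ) / 4) +
        k * (ip D (l • hexDir ψ) / 2 - dt D (l • hexDir ψ) / 4) := by
      simp only [ip, dt, X_smul, Y_smul]; ring
    rw [this, ← h1, ← h3, hD']
    have e2 : X (v 4) = X (v 0) - (X (v 1) - X (v 0)) - (Y (v 1) - Y (v 0)) := by linarith
    have e3 : Y (v 4) = Y (v 0) + (X (v 1) - X (v 0)) := by linarith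
    simp only [ip, dt, X_sub, Y_sub, e2, e3]
    ring
  rw [bal] at hbal
  have t1 : φ = θ + 1 ∨ φ = θ + 2 := by
    refine hexDir_turn hk hm h1 h2 ?_
    simpa using h 1 2 3 (by decide) (by decide)
  have t2 : ψ = φ + 1 ∨ ψ = φ + 2 := by
    refine hexDir_turn hm hl h2 h3 ?_
    simpa using h 2 3 4 (by decide) (by decide)
  have a2 : (θ + 1) + 1 = θ + 2 := by rw [add_assoc]; rfl
  have a3 : (θ + 1) + 2 = θ + 3 := by rw [add_assoc]; rfl
  have a4 : (θ + 2) + 1 = θ + 3 := by rw [add_assoc]; rfl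
  have a5 : (θ + 2) + 2 = θ + 4 := by rw [add_assoc]; rfl
  obtain ⟨d1, d2, d3, d4⟩ := dt_hexDir θ
  have i1 := ip_hexDir_one θ
  have i2 := ip_hexDir_two θ
  obtain ⟨i3, i4, i0⟩ := ip_hexDir_three θ
  have ipD : ∀ w, ip D w = k * ip (hexDir θ) w + (m * ip (hexDir φ) w + l * ip (hexDir ψ) w) :=
    fun w => by rw [hD]; simp only [ip_add_left, ip_smul_left]
  have dtD : ∀ w, dt D w = k * dt (hexDir θ) w + (m * dt (hexDir φ) w + l * dt (hexDir ψ) w) :=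
    fun w => by rw [hD]; simp only [dt_add_left, dt_smul_left]
  have ipDD : ip D D = k * ip D (hexDir θ) + (m * ip D (hexDir φ) + l * ip D (hexDir ψ)) := by
    rw [ipD D, ip_comm _ D, ip_comm _ D, ip_comm _ D]
  rw [ipDD] at area
  simp only [ipD, dtD] at area c1 c4 hbal
  clear ipD dtD ipDD bal h1 h2 h3 hX hY hD' hA h hD
  obtain ⟨m, rfl⟩ := hm'
  have hm1 : (1 : ℝ) ≤ m := by
    have : (0 : ℤ) < m := by exact_mod_cast hm
    exact_mod_cast this
  have int1 : ∀ {x : ℝ}, 0 < x → (∃ n : ℤ, x = n) → 1 ≤ x := by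
    rintro x hx ⟨n, rfl⟩
    have : (0 : ℤ) < n := by exact_mod_cast hx
    exact_mod_cast this
  have hkl0 := mul_pos hk hl
  have j1 := ip_hexDir_one (θ + 1)
  have j2 := ip_hexDir_one (θ + 2)
  have j3 := ip_hexDir_two (θ + 1)
  have j4 := ip_hexDir_two (θ + 2)
  have e1 := (dt_hexDir (θ + 1)).1
  have e2 := (dt_hexDir (θ + 2)).1
  have e3 := (dt_hexDir (θ + 1)).2.1
  have e4 := (dt_hexDir (θ + 2)).2.1
  rw [a2] at j1 e1
  rw [a4] at j2 e2
  rw [a3] at j3 e3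
  rw [a5] at j4 e4
  have n0 : ∀ φ, ip (hexDir φ) (hexDir φ) = 1 := fun φ => (ip_hexDir_three φ).2.2
  rcases t1 with rfl | rfl <;> rcases t2 with rfl | rfl
  · -- two turns of 60 degrees: `n ^ 2 + 4 * m * n + m ^ 2 = 7` for `n = k + l` has no integral
    -- solution
    exfalso
    rw [a2] at area c1 c4 hbal
    simp only [ip_comm (hexDir (θ + 1)) (hexDir θ), ip_comm (hexDir (θ + 2)) (hexDir θ),
      ip_comm (hexDir (θ + 2)) (hexDir (θ + 1)), n0, d1, d2, i1, i2, j1, e1] at area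
    obtain ⟨n, hn⟩ := hkl
    have hn1 : (1 : ℝ) ≤ n := by
      have : (0 : ℝ) < n := by rw [← hn]; linarith
      have : (0 : ℤ) < n := by exact_mod_cast this
      exact_mod_cast this
    have e : (n : ℝ) ^ 2 + 4 * m * n + m ^ 2 = 7 := by
      rw [← hn]
      linarith
    have e' : n ^ 2 + 4 * m * n + m ^ 2 = 7 := by exact_mod_cast e
    have hm2 : 1 ≤ m := by exact_mod_cast hm1
    have hn2 : 1 ≤ n := by exact_mod_cast hn1
    have p1 := mul_nonneg (sub_nonneg.2 hm2) (sub_nonneg.2 hn2)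
    have p2 := mul_nonneg (sub_nonneg.2 hm2) (sub_nonneg.2 hm2)
    have p3 := mul_nonneg (sub_nonneg.2 hn2) (sub_nonneg.2 hn2)
    have p4 : (n - 1) * (n - 1) + (m - 1) * (m - 1) + 4 * ((m - 1) * (n - 1)) + 6 * (n - 1) +
        6 * (m - 1) = 1 := by linarith
    obtain rfl : m = 1 := by omega
    obtain rfl : n = 1 := by omega
    norm_num at p4
  · -- turns of 60 and 120 degrees: the angles at `v 1` and `v 4` are not supplementary, and the
    -- area forces all lengths to be `1`
    rw [a3] at area c1 c4 hbal ⊢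
    simp only [ip_comm (hexDir (θ + 1)) (hexDir θ), ip_comm (hexDir (θ + 3)) (hexDir θ),
      ip_comm (hexDir (θ + 3)) (hexDir (θ + 1)), dt_comm (hexDir (θ + 1)) (hexDir θ),
      dt_comm (hexDir (θ + 3)) (hexDir θ), n0, dt_self, d1, d3, i1, i3, j3, e3] at area hbal
    obtain ⟨hk', hl'⟩ := hbal.resolve_right (by
      intro h0
      have h1 := (mul_eq_zero.1 h0).resolve_left hkl0.ne'
      linarith)
    obtain ⟨p1, p2, p3⟩ := eq_one_of_sq_add_eq_seven (int1 hl hl') hm1 (int1 hk hk') (by linarith)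
    exact ⟨p3, p2, p1, Or.inl ⟨rfl, rfl⟩⟩
  · -- the mirror image of the preceding case
    rw [a4] at area c1 c4 hbal ⊢
    simp only [ip_comm (hexDir (θ + 2)) (hexDir θ), ip_comm (hexDir (θ + 3)) (hexDir θ),
      ip_comm (hexDir (θ + 3)) (hexDir (θ + 2)), dt_comm (hexDir (θ + 2)) (hexDir θ),
      dt_comm (hexDir (θ + 3)) (hexDir θ),
      n0, dt_self, d2, d3, i2, i3, j2, e2] at area hbal
    obtain ⟨hk', hl'⟩ := hbal.resolve_right (by
      intro h0
      have h1 := (mul_eq_zero.1 h0).resolve_left hkl0.ne'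
      linarith)
    obtain ⟨p1, p2, p3⟩ := eq_one_of_sq_add_eq_seven (int1 hk hk') hm1 (int1 hl hl') (by linarith)
    exact ⟨p1, p2, p3, Or.inr ⟨rfl, rfl⟩⟩
  · -- two turns of 120 degrees: convexity at `v 1` and `v 4` gives `k + l < 2 * m`, and the area is
    -- too large
    exfalso
    rw [a5] at area c1 c4 hbal
    simp only [ip_comm (hexDir (θ + 2)) (hexDir θ), ip_comm (hexDir (θ + 4)) (hexDir θ),
      ip_comm (hexDir (θ + 4)) (hexDir (θ + 2)), dt_comm (hexDir (θ + 2)) (hexDir θ),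
      dt_comm (hexDir (θ + 4)) (hexDir θ),
      n0, dt_self, d2, d4, i2, i4, j4, e4] at area hbal c1 c4
    have q1 := (pos_iff_pos_of_mul_pos c1).1 hk
    have q4 := (pos_iff_pos_of_mul_pos c4).1 hl
    obtain ⟨hk', hl'⟩ := hbal.resolve_right (by
      intro h0
      have h1 := (mul_eq_zero.1 h0).resolve_left hkl0.ne'
      linarith)
    have k1 := int1 hk hk'
    have l1 := int1 hl hl'
    have hm2 : (2 : ℝ) ≤ m := by
      have : (1 : ℝ) < m := by linarith
      have : (1 : ℤ) < m := by exact_mod_cast this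
      exact_mod_cast this
    have r1 : 0 < (k + l) * (2 * m - (k + l)) := mul_pos (by linarith) (by linarith)
    have r2 : 0 ≤ (k + l - 2) * (m - 2) := mul_nonneg (by linarith) (by linarith)
    nlinarith [sq_nonneg (k - l), mul_nonneg (sub_nonneg.2 hm2) (sub_nonneg.2 hm2)]

/-! ### The angle at the common vertex and the lengths of the edges -/

/-- The Gram determinant of three plane vectors vanishes. -/
theorem gram_eq_zero (a b d : Plane) :
    nsq a * nsq b * nsq d + 2 * ip a b * ip b d * ip a d - nsq a * ip b d ^ 2 -
      nsq b * ip a d ^ 2 - nsq d * ip a b ^ 2 = 0 := by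
  simp only [nsq, ip]; ring

/-- Three plane vectors of the same length whose differences have the same positive length make
angles of 120 degrees. -/
theorem ip_eq_of_regular {a b d : Plane} {p c : ℝ} (ha : nsq a = p) (hb : nsq b = p)
    (hd : nsq d = p) (hab : nsq (a - b) = c) (hbd : nsq (b - d) = c) (had : nsq (a - d) = c)
    (hc : c ≠ 0) : ip a b = -p / 2 := by
  have key : ∀ a b : Plane, ip a b = (nsq a + nsq b - nsq (a - b)) / 2 := fun a b => by
    simp only [nsq, ip, X_sub, Y_sub]; ring
  have h := gram_eq_zero a b d
  rw [key b d, key a d, key a b, ha, hb, hd, hab, hbd, had] at h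
  have h' : c ^ 2 * (3 * p - c) = 0 := by linarith
  have h'' := (mul_eq_zero.1 h').resolve_left (pow_ne_zero 2 hc)
  rw [key, ha, hb, hab]
  linarith

/-- The properties of a pentagon of a `Fan` that determine its shape: the edges at the vertex `0`
have the same length and make an angle of 120 degrees, and the other edges are as in `Fan.shape`. -/
structure FanShape (v : Fin 5 → Plane) : Prop where
  nsq_eq : nsq (v 1 - v 0) = nsq (v 4 - v 0)
  ip_eq : ip (v 1 - v 0) (v 4 - v 0) = -nsq (v 1 - v 0) / 2
  int₁ : IntLine (v 1) (v 2)
  int₂ : IntLine (v 2) (v 3)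
  int₃ : IntLine (v 3) (v 4)
  add_int : ∃ n : ℤ, dist (v 1) (v 2) + dist (v 3) (v 4) = n
  int_or : ((∃ n : ℤ, dist (v 1) (v 2) = n) ∧ ∃ n : ℤ, dist (v 3) (v 4) = n) ∨
    dist (v 3) (v 4) * ip (v 0 - v 1) (v 2 - v 1) +
      dist (v 1) (v 2) * ip (v 0 - v 4) (v 3 - v 4) = 0

namespace Fan

variable {T : Finset Cell} (F : Fan T)

theorem dist_eq (i j : Fin 3) (k l : Fin 5) :
    dist (F.v i k) (F.v i l) = dist (F.v j k) (F.v j l) :=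
  nsq_eq_iff_dist.1 (F.nsq_eq i j k l)

theorem ip_eq (i j : Fin 3) (a b c : Fin 5) :
    ip (F.v i a - F.v i b) (F.v i c - F.v i b) = ip (F.v j a - F.v j b) (F.v j c - F.v j b) := by
  rw [Polyiamond.ip_eq, Polyiamond.ip_eq, F.nsq_eq i j, F.nsq_eq i j, F.nsq_eq i j]

/-- Some common edge joins the apex to the vertex `1` of one of the pentagons and to the vertex `4`
of the other, since three is odd. -/
theorem exists_mixed : ∃ i j, i ≠ j ∧ F.s i j = 1 ∧ F.s j i = 4 := by
  by_contra! h
  have h1 := F.s_mem 0 1 (by decide)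
  have h2 := F.s_mem 1 0 (by decide)
  have h3 := F.s_mem 0 2 (by decide)
  have h4 := F.s_mem 2 0 (by decide)
  have h5 := F.s_mem 1 2 (by decide)
  have h6 := F.s_mem 2 1 (by decide)
  have n0 := F.s_ne 0 1 2 (by decide) (by decide) (by decide)
  have n1 := F.s_ne 1 0 2 (by decide) (by decide) (by decide)
  have n2 := F.s_ne 2 0 1 (by decide) (by decide) (by decide)
  have m1 := h 0 1 (by decide)
  have m2 := h 1 0 (by decide)
  have m3 := h 0 2 (by decide)
  have m4 := h 2 0 (by decide)
  have m5 := h 1 2 (by decide)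
  have m6 := h 2 1 (by decide)
  rcases h1 with h1 | h1 <;> rcases h3 with h3 | h3 <;> rcases h5 with h5 | h5 <;>
    rcases h2 with h2 | h2 <;> rcases h4 with h4 | h4 <;> rcases h6 with h6 | h6 <;>
    simp [h1, h2, h3, h4, h5, h6] at n0 n1 n2 m1 m2 m3 m4 m5 m6

/-- By congruence, the edges at the apex are equal because some shared edge is the first edge of one
pentagon and the last edge of another. -/
theorem nsq_apex (i : Fin 3) :
    nsq (F.v i 1 - F.v i 0) = nsq (F.v i 4 - F.v i 0) := by
  obtain ⟨a, b, hab, h1, h2⟩ := F.exists_mixed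
  have h := F.shared a b hab
  rw [h1, h2] at h
  rw [F.nsq_eq i a, F.nsq_eq i b 4 0, h, F.apex, F.apex]

/-- The angle at the apex is 120 degrees: the far ends of the shared edges have the same distance
from the apex and from each other. -/
theorem ip_apex (i : Fin 3) :
    ip (F.v i 1 - F.v i 0) (F.v i 4 - F.v i 0) = -nsq (F.v i 1 - F.v i 0) / 2 := by
  have hp : ∀ a b, a ≠ b → nsq (F.v a (F.s a b) - F.x) = nsq (F.v i 1 - F.v i 0) := by
    intro a b hab
    rw [← F.apex a]
    rcases F.s_mem a b hab with h | h
    · rw [h, F.nsq_eq a i]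
    · rw [h, ← F.nsq_apex, F.nsq_eq a i]
  have hneg : ∀ z w : Plane, nsq (z - w) = nsq (w - z) := fun z w => by
    simp only [nsq, X_sub, Y_sub]; ring
  have hc : ∀ a b c, b ≠ a → c ≠ a → b ≠ c →
      nsq (F.v a (F.s a b) - F.v a (F.s a c)) = nsq (F.v i 1 - F.v i 4) := by
    intro a b c hab hac hbc
    have hne := F.s_ne a b c hab hac hbc
    rcases F.s_mem a b hab.symm with h | h <;> rcases F.s_mem a c hac.symm with h' | h' <;>
      rw [h, h'] at hne ⊢
    · exact absurd rfl hne
    · exact F.nsq_eq a i 1 4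
    · rw [hneg]
      exact F.nsq_eq a i 1 4
    · exact absurd rfl hne
  have hne : nsq (F.v i 1 - F.v i 4) ≠ 0 := fun h => by
    have := (F.cyc i).injective (sub_eq_zero.1 (nsq_eq_zero h))
    exact absurd this (by decide)
  have key := ip_eq_of_regular (hp 0 1 (by decide)) (hp 0 2 (by decide)) (hp 1 2 (by decide))
    (c := nsq (F.v i 1 - F.v i 4))
    (by simpa using hc 0 1 2 (by decide) (by decide) (by decide))
    (by
      have := hc 2 0 1 (by decide) (by decide) (by decide)
      rwa [← F.shared 0 2 (by decide), ← F.shared 1 2 (by decide),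
        ← sub_sub_sub_cancel_right _ _ F.x] at this)
    (by
      have := hc 1 0 2 (by decide) (by decide) (by decide)
      rwa [← F.shared 0 1 (by decide), ← sub_sub_sub_cancel_right _ _ F.x] at this) hne
  rw [F.ip_eq i 0]
  rw [← F.apex 0] at key
  have hs := F.s_ne 0 1 2 (by decide) (by decide) (by decide)
  rcases F.s_mem 0 1 (by decide) with h | h <;> rcases F.s_mem 0 2 (by decide) with h' | h' <;>
    rw [h, h'] at hs key
  · exact absurd rfl hs
  · exact key
  · rw [ip_comm]
    exact key
  · exact absurd rfl hs

theorem isLatt_two (i : Fin 3) : IsLatt (F.v i 2) :=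
  isLatt_of_intLine (F.int i).1 (F.int i).2.1 ((F.cyc i).cr_ne (by decide) (by decide) (by decide))

theorem isLatt_three (i : Fin 3) : IsLatt (F.v i 3) :=
  isLatt_of_intLine (F.int i).2.1 (F.int i).2.2
    ((F.cyc i).cr_ne (by decide) (by decide) (by decide))

/-- The lengths of the edges next to the shared ones. They are integers if the far end of a shared
edge is a lattice point; otherwise the two edges issuing from this point on either side continue
each other, so that the lengths have an integral sum and the angles are supplementary. -/
theorem shape (i : Fin 3) : FanShape (F.v i) := by
  obtain ⟨a, b, hab, h1, h2⟩ := F.exists_mixed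
  have hs := F.shared a b hab
  have hfar := F.far a b hab
  rw [h1, h2] at hs
  rw [h1, h2, show nextIdx 1 = 2 from rfl, show nextIdx 4 = 3 from rfl] at hfar
  have key : (∃ n : ℤ, dist (F.v i 1) (F.v i 2) + dist (F.v i 3) (F.v i 4) = n) ∧
      (((∃ n : ℤ, dist (F.v i 1) (F.v i 2) = n) ∧ ∃ n : ℤ, dist (F.v i 3) (F.v i 4) = n) ∨
      dist (F.v i 3) (F.v i 4) * ip (F.v i 0 - F.v i 1) (F.v i 2 - F.v i 1) +
        dist (F.v i 1) (F.v i 2) * ip (F.v i 0 - F.v i 4) (F.v i 3 - F.v i 4) = 0) := by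
    rw [F.dist_eq i a 1 2, F.dist_eq i b 3 4, F.ip_eq i a, F.ip_eq i b 0 4 3]
    rcases hfar with hL | ⟨t, ht, he⟩
    · obtain ⟨n, hn⟩ := hL.dist_eq_int (F.isLatt_two a) (F.int a).1.latDir
      obtain ⟨n', hn'⟩ := (F.isLatt_three b).dist_eq_int (hs ▸ hL) (F.int b).2.2.latDir
      exact ⟨⟨n + n', by rw [hn, hn']; push_cast; rfl⟩, Or.inl ⟨⟨n, hn⟩, n', hn'⟩⟩
    · have e1 : dist (F.v b 3) (F.v b 4) = -t * dist (F.v a 1) (F.v a 2) := by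
        rw [← hs, dist_eq_norm, he, norm_smul, dist_comm, dist_eq_norm, Real.norm_eq_abs,
          abs_of_neg ht]
      have e2 : F.v a 2 - F.v b 3 = (1 - t) • (F.v a 2 - F.v a 1) := by
        rw [← sub_sub_sub_cancel_right _ _ (F.v a 1), he, sub_smul, one_smul]
      have e3 : dist (F.v a 2) (F.v b 3) =
          dist (F.v a 1) (F.v a 2) + dist (F.v b 3) (F.v b 4) := by
        rw [e1, dist_eq_norm, e2, norm_smul, dist_comm (F.v a 1), dist_eq_norm, Real.norm_eq_abs,
          abs_of_pos (by linarith)]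
        ring
      have e4 : LatDir (F.v a 2) (F.v b 3) := by
        have h := (F.int a).1.latDir
        have hX := congrArg X e2
        have hY := congrArg Y e2
        simp only [X_sub, Y_sub, X_smul, Y_smul] at hX hY
        rcases h with h | h | h
        · rw [← h, sub_self, mul_zero] at hX
          exact Or.inl (by linarith)
        · rw [← h, sub_self, mul_zero] at hY
          exact Or.inr (Or.inl (by linarith))
        · have : X (F.v a 2) - X (F.v b 3) + (Y (F.v a 2) - Y (F.v b 3)) = 0 := by
            rw [hX, hY, ← mul_add, show X (F.v a 2) - X (F.v a 1) + (Y (F.v a 2) - Y (F.v a 1)) = 0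
              by linarith, mul_zero]
          exact Or.inr (Or.inr (by linarith))
      obtain ⟨n, hn⟩ := (F.isLatt_two a).dist_eq_int (F.isLatt_three b) e4
      refine ⟨⟨n, by rw [← hn, e3]⟩, Or.inr ?_⟩
      rw [e1, F.apex, F.apex, ← hs, he, ip_comm _ (t • _), ip_smul_left,
        ip_comm (F.v a 2 - F.v a 1)]
      ring
  exact ⟨F.nsq_apex i, F.ip_apex i, (F.int i).1, (F.int i).2.1, (F.int i).2.2, key.1, key.2⟩

end Fan

/-! ### Recognition of the TH-pentagon -/

/-- The vertices `E`, `A`, `B`, `C`, `D` of the TH-pentagon; the vertex `0` corresponds to the apex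
of a `Fan`. -/
def thVertex : Fin 5 → Plane :=
  ![pt (2 / 3) (-1 / 3), pt 1 0, pt 0 1, pt (-1) 1, pt 0 0]

theorem thPentagon_eq : thPentagon = convexHull ℝ (Set.range thVertex) := by
  have h3 : √(3 : ℝ) ^ 2 = 3 := Real.sq_sqrt (by norm_num)
  have e : ∀ x y x' y' : ℝ, x = x' → y = y' → (!₂[x, y] : Plane) = !₂[x', y'] := by
    rintro x y _ _ rfl rfl; rfl
  rw [thPentagon]
  congr 1
  have : Set.range thVertex = {pt (2 / 3) (-1 / 3), pt 1 0, pt 0 1, pt (-1) 1, pt 0 0} := by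
    ext z
    simp [thVertex]
    tauto
  rw [this]
  have e1 : (!₂[(1 : ℝ), 0] : Plane) = pt 1 0 := e _ _ _ _ (by norm_num) (by norm_num)
  have e2 : (!₂[(1 / 2 : ℝ), √3 / 2] : Plane) = pt 0 1 := e _ _ _ _ (by norm_num) (by norm_num)
  have e3 : (!₂[(-1 / 2 : ℝ), √3 / 2] : Plane) = pt (-1) 1 :=
    e _ _ _ _ (by norm_num) (by norm_num)
  have e4 : (!₂[(0 : ℝ), 0] : Plane) = pt 0 0 := e _ _ _ _ (by norm_num) (by norm_num)
  have e5 : (!₂[(1 / 2 : ℝ), -√3 / 6] : Plane) = pt (2 / 3) (-1 / 3) :=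
    e _ _ _ _ (by norm_num) (by ring)
  rw [e1, e2, e3, e4, e5]
  ext z
  simp only [Set.mem_insert_iff, Set.mem_singleton_iff]
  tauto

theorem IsLatt.sub {z w : Plane} (hz : IsLatt z) (hw : IsLatt w) : IsLatt (z - w) := by
  obtain ⟨m, n, hm, hn⟩ := hz
  obtain ⟨m', n', hm', hn'⟩ := hw
  exact ⟨m - m', n - n', by rw [X_sub, hm, hm']; push_cast; rfl,
    by rw [Y_sub, hn, hn']; push_cast; rfl⟩

theorem isLatt_hexDir (θ : Fin 6) : IsLatt (hexDir θ) := by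
  fin_cases θ
  exacts [⟨1, 0, by simp [hexDir]⟩, ⟨0, 1, by simp [hexDir]⟩, ⟨-1, 1, by simp [hexDir]⟩,
    ⟨-1, 0, by simp [hexDir]⟩, ⟨0, -1, by simp [hexDir]⟩, ⟨1, -1, by simp [hexDir]⟩]

/-- There is a symmetry of the tiling that carries the origin to a given lattice point and the
lattice basis to given consecutive directions. -/
theorem exists_latticeSym (θ : Fin 6) {p : Plane} (hp : IsLatt p) : ∃ g : LatticeSym, ∀ z,
    g.iso z = p + (X z • hexDir θ + Y z • hexDir (θ + 1)) := by
  obtain ⟨m, n, hm, hn⟩ := hp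
  have key : ∃ g : LatticeSym, ∀ z, g.iso z = X z • hexDir θ + Y z • hexDir (θ + 1) := by
    let r := LatticeSym.rot
    have hr : ∀ z, X (r.iso z) = -Y z ∧ Y (r.iso z) = X z + Y z := fun z => by
      simp [r, LatticeSym.rot_iso]
    have h0 : ∀ z, LatticeSym.refl.iso z = z := fun z => rfl
    fin_cases θ
    · exact ⟨LatticeSym.refl, fun z => ext_XY (by simp [h0, hexDir]) (by simp [h0, hexDir])⟩
    · exact ⟨r, fun z => ext_XY (by simp [hr, hexDir]) (by simp [hr, hexDir])⟩
    · exact ⟨r.trans r, fun z => ext_XY (by simp [hr, hexDir]; ring) (by simp [hr, hexDir])⟩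
    · exact ⟨(r.trans r).trans r, fun z => ext_XY (by simp [hr, hexDir]) (by simp [hr, hexDir])⟩
    · exact ⟨((r.trans r).trans r).trans r, fun z => ext_XY (by simp [hr, hexDir])
        (by simp [hr, hexDir])⟩
    · exact ⟨(((r.trans r).trans r).trans r).trans r, fun z => ext_XY (by simp [hr, hexDir]; ring)
        (by simp [hr, hexDir])⟩
  obtain ⟨g, hg⟩ := key
  refine ⟨g.trans (LatticeSym.shift m n), fun z => ?_⟩
  rw [LatticeSym.trans_iso, LatticeSym.shift_iso, hg]
  exact ext_XY (by rw [X_pt, X_add p, hm, add_comm]) (by rw [Y_pt, Y_add p, hn, add_comm])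

/-- A counterclockwise pentagon with `FanShape` and area `7 / 3` is the image of the TH-pentagon;
for one of the two cases in `lengths_eq_one` the symmetry reverses the orientation. -/
theorem FanShape.exists_latticeSym_of_one {v : Fin 5 → Plane} (hv : FanShape v)
    (h : IsCyclic 1 v) (hA : pentArea v = 7 / 3) : ∃ g : LatticeSym,
      Set.range v = g.iso '' Set.range thVertex ∧ v 0 = g.iso (thVertex 0) := by
  -- the third edge at the apex is obtained from the first by a rotation through 120 degrees
  obtain ⟨hX, hY⟩ : X (v 4 - v 0) = -X (v 1 - v 0) - Y (v 1 - v 0) ∧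
      Y (v 4 - v 0) = X (v 1 - v 0) := by
    have h1 := hv.nsq_eq
    have h2 := hv.ip_eq
    have h3 := h 0 1 4 (by decide) (by decide)
    have h4 := cr_sq (v 0) (v 1) (v 4)
    rw [h2, ← h1] at h4
    have h5 : cr (v 0) (v 1) (v 4) = nsq (v 1 - v 0) := by
      refine (sq_eq_sq₀ (by linarith) (nsq_nonneg _)).1 ?_
      linarith
    have h6 : nsq (v 4 - v 0 - pt (-X (v 1 - v 0) - Y (v 1 - v 0)) (X (v 1 - v 0))) = 0 := by
      have : nsq (v 4 - v 0 - pt (-X (v 1 - v 0) - Y (v 1 - v 0)) (X (v 1 - v 0))) =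
          nsq (v 4 - v 0) + nsq (v 1 - v 0) + ip (v 1 - v 0) (v 4 - v 0) -
            3 / 2 * cr (v 0) (v 1) (v 4) := by
        simp only [nsq, ip, cr, X_sub, Y_sub, X_pt, Y_pt]; ring
      rw [this, h2, h5, ← h1]
      ring
    have h7 := sub_eq_zero.1 (nsq_eq_zero h6)
    rw [h7, X_pt, Y_pt]
    exact ⟨rfl, rfl⟩
  obtain ⟨θ, hθ⟩ := exists_hexDir hv.int₁.latDir
  obtain ⟨φ, hφ⟩ := exists_hexDir hv.int₂.latDir
  obtain ⟨ψ, hψ⟩ := exists_hexDir hv.int₃.latDir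
  have l2 : IsLatt (v 2) := isLatt_of_intLine hv.int₁ hv.int₂
    (h.cr_ne (by decide) (by decide) (by decide))
  have l3 : IsLatt (v 3) := isLatt_of_intLine hv.int₂ hv.int₃
    (h.cr_ne (by decide) (by decide) (by decide))
  obtain ⟨hk, hm, hl, ht⟩ := lengths_eq_one h hA (dist_pos.2 (h.injective.ne (by decide)))
    (dist_pos.2 (h.injective.ne (by decide))) (dist_pos.2 (h.injective.ne (by decide))) hθ hφ hψ
    hX hY (l2.dist_eq_int l3 hv.int₂.latDir) hv.add_int hv.int_or
  rw [hk, one_smul] at hθ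
  rw [hm, one_smul] at hφ
  rw [hl, one_smul] at hψ
  have neg3 : hexDir (θ + 3) = -hexDir θ := by
    fin_cases θ <;> exact ext_XY (by simp [hexDir]) (by simp [hexDir])
  obtain ⟨hXr, hYr⟩ : X (hexDir (θ + 1)) = -Y (hexDir θ) ∧
      Y (hexDir (θ + 1)) = X (hexDir θ) + Y (hexDir θ) := by
    fin_cases θ <;> simp [hexDir]
  have sub2 : hexDir (θ + 2) = hexDir (θ + 1) - hexDir θ := by
    fin_cases θ <;> exact ext_XY (by simp [hexDir]) (by simp [hexDir])
  have sub4 : hexDir (θ + 4) = -hexDir (θ + 1) := by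
    fin_cases θ <;> exact ext_XY (by simp [hexDir]) (by simp [hexDir])
  have a1 : θ + 4 + 1 = θ + 5 := by rw [add_assoc]; rfl
  have sub5 : hexDir (θ + 5) = hexDir θ - hexDir (θ + 1) := by
    fin_cases θ <;> exact ext_XY (by simp [hexDir]) (by simp [hexDir])
  have key : ∀ w : Fin 5 → Plane, ∀ g : LatticeSym, (∀ k, v k = g.iso (w k)) →
      Set.range v = g.iso '' Set.range w := fun w g hg => by
    rw [← Set.range_comp]
    exact congrArg Set.range (funext hg)
  have hX1 := congrArg X hθ
  have hY1 := congrArg Y hθ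
  have hX2 := congrArg X hφ
  have hY2 := congrArg Y hφ
  have hX3 := congrArg X hψ
  have hY3 := congrArg Y hψ
  rcases ht with ⟨rfl, rfl⟩ | ⟨rfl, rfl⟩
  · rw [neg3] at hX3 hY3
    obtain ⟨g, hg⟩ := exists_latticeSym (θ + 4) (p := v 2 - hexDir (θ + 5))
      (l2.sub (isLatt_hexDir _))
    rw [a1, sub4, sub5] at hg
    have hgv : ∀ k, v k = g.iso (thVertex k) := by
      intro k
      rw [hg]
      simp only [X_sub, Y_sub, X_neg, Y_neg] at hX1 hX2 hX3 hY1 hY2 hY3 hX hY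
      fin_cases k <;> refine ext_XY ?_ ?_ <;> simp [thVertex] <;> linarith
    exact ⟨g, key _ g hgv, hgv 0⟩
  · rw [sub2] at hX2 hY2
    rw [neg3] at hX3 hY3
    obtain ⟨g, hg⟩ := exists_latticeSym (θ + 1) (l2.sub (isLatt_hexDir θ))
    rw [add_assoc, show (1 : Fin 6) + 1 = 2 from rfl, sub2] at hg
    have hgv : ∀ k, v k = (LatticeSym.swap.trans g).iso (thVertex (-k)) := by
      intro k
      rw [LatticeSym.trans_iso, LatticeSym.swap_iso, hg]
      simp only [X_sub, Y_sub, X_neg, Y_neg] at hX1 hX2 hX3 hY1 hY2 hY3 hX hY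
      fin_cases k <;> refine ext_XY ?_ ?_ <;> simp [thVertex] <;> linarith
    refine ⟨LatticeSym.swap.trans g, ?_, hgv 0⟩
    rw [key (fun k => thVertex (-k)) _ hgv]
    congr 1
    exact (Equiv.neg (Fin 5)).surjective.range_comp thVertex

theorem FanShape.swap {v : Fin 5 → Plane} (hv : FanShape v) :
    FanShape fun k => LatticeSym.swap.iso (v k) := by
  have hip : ∀ a b c d : Plane, ip (LatticeSym.swap.iso a - LatticeSym.swap.iso b)
      (LatticeSym.swap.iso c - LatticeSym.swap.iso d) = ip (a - b) (c - d) := fun a b c d => by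
    simp only [LatticeSym.swap_iso, ip, X_sub, Y_sub, X_pt, Y_pt]; ring
  have hnsq : ∀ a b : Plane, nsq (LatticeSym.swap.iso a - LatticeSym.swap.iso b) =
      nsq (a - b) := fun a b => by
    simp only [LatticeSym.swap_iso, nsq, X_sub, Y_sub, X_pt, Y_pt]; ring
  have hint : ∀ {a b : Plane}, IntLine a b →
      IntLine (LatticeSym.swap.iso a) (LatticeSym.swap.iso b) := by
    rintro a b ⟨n, h⟩
    refine ⟨n, ?_⟩
    simp only [LatticeSym.swap_iso, X_pt, Y_pt]
    rcases h with h | h | h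
    exacts [Or.inr (Or.inl h), Or.inl h, Or.inr (Or.inr (by rwa [add_comm (Y a), add_comm (Y b)]))]
  constructor
  · rw [hnsq, hnsq]
    exact hv.nsq_eq
  · rw [hip, hnsq]
    exact hv.ip_eq
  · exact hint hv.int₁
  · exact hint hv.int₂
  · exact hint hv.int₃
  · simp only [IsometryEquiv.dist_eq]
    exact hv.add_int
  · simp only [IsometryEquiv.dist_eq, hip]
    exact hv.int_or

/-- The pentagons of a `Fan` are images of the TH-pentagon under symmetries of the tiling. -/
theorem Fan.exists_latticeSym {T : Finset Cell} (F : Fan T) (i : Fin 3) : ∃ g : LatticeSym,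
    Set.range (F.v i) = g.iso '' Set.range thVertex ∧ F.x = g.iso (thVertex 0) := by
  have hA := F.area i
  have hc := F.cyc i
  rw [← F.apex i]
  rcases F.sign i with h | h
  · rw [h] at hA hc
    exact (F.shape i).exists_latticeSym_of_one hc (by linarith)
  · rw [h] at hA hc
    have hc' := hc.swap
    rw [neg_neg] at hc'
    obtain ⟨g, hg, hg'⟩ := (F.shape i).swap.exists_latticeSym_of_one hc' (by
      rw [← hA]
      simp only [pentArea, cr, LatticeSym.swap_iso, X_pt, Y_pt]
      ring)
    refine ⟨g.trans LatticeSym.swap.symm, ?_, ?_⟩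
    · have h1 : Set.range (F.v i) =
          LatticeSym.swap.iso.symm '' Set.range fun k => LatticeSym.swap.iso (F.v i k) := by
        rw [← Set.range_comp]
        exact congrArg Set.range (funext fun k => by simp)
      rw [h1, hg, Set.image_image]
      rfl
    · rw [LatticeSym.trans_iso, ← hg']
      exact (LatticeSym.swap.iso.symm_apply_apply _).symm

/-! ### The cells covered by a TH-pentagon -/

theorem isCyclic_thVertex : IsCyclic 1 thVertex := by
  intro i j k hij hjk
  fin_cases i <;> fin_cases j <;> first | exact absurd hij (by decide) | skip
  all_goals fin_cases k <;>
    first | exact absurd hjk (by decide) | (simp [thVertex, cr] <;> norm_num)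

theorem mem_thPentagon_iff {z : Plane} : z ∈ thPentagon ↔ 0 ≤ X z + 2 * Y z ∧ X z - Y z ≤ 1 ∧
    X z + Y z ≤ 1 ∧ Y z ≤ 1 ∧ 0 ≤ X z + Y z := by
  rw [thPentagon_eq, isCyclic_thVertex.mem_iff (Or.inl rfl)]
  simp only [Fin.forall_fin_succ, one_mul]
  simp [thVertex, cr]
  constructor
  · rintro ⟨h1, h2, h3, h4, h5⟩
    refine ⟨?_, ?_, ?_, ?_, ?_⟩ <;> linarith
  · rintro ⟨h1, h2, h3, h4, h5⟩
    refine ⟨?_, ?_, ?_, ?_, ?_⟩ <;> linarith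

/-- The TH-pentagon consists of two cells and of a third of the cell `(0, -1, true)`, cut out by
lines through its centre. -/
theorem mem_thPentagon_iff_cells {z : Plane} : z ∈ thPentagon ↔
    z ∈ Cell.triangle (0, 0, false) ∨ z ∈ Cell.triangle (-1, 0, true) ∨
      z ∈ Cell.triangle (0, -1, true) ∧ 0 ≤ X z + 2 * Y z ∧ X z - Y z ≤ 1 := by
  rw [mem_thPentagon_iff]
  simp only [Cell.mem_triangle, Cell.diag]
  norm_num
  constructor
  · rintro ⟨h1, h2, h3, h4, h5⟩
    rcases le_total 0 (Y z) with hy | hy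
    · rcases le_total 0 (X z) with hx | hx
      · refine Or.inl ⟨⟨?_, ?_⟩, ⟨?_, ?_⟩, ⟨?_, ?_⟩⟩ <;> linarith
      · refine Or.inr (Or.inl ⟨⟨?_, ?_⟩, ⟨?_, ?_⟩, ⟨?_, ?_⟩⟩) <;> linarith
    · refine Or.inr (Or.inr ⟨⟨⟨?_, ?_⟩, ⟨?_, ?_⟩, ⟨?_, ?_⟩⟩, ?_, ?_⟩) <;> linarith
  · rintro (⟨⟨h1, h2⟩, ⟨h3, h4⟩, ⟨h5, h6⟩⟩ | ⟨⟨h1, h2⟩, ⟨h3, h4⟩, ⟨h5, h6⟩⟩ |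
      ⟨⟨⟨h1, h2⟩, ⟨h3, h4⟩, ⟨h5, h6⟩⟩, h7, h8⟩) <;>
    refine ⟨?_, ?_, ?_, ?_, ?_⟩ <;> linarith

theorem thVertex_zero : thVertex 0 = Cell.center (0, -1, true) := by
  refine ext_XY ?_ ?_ <;> simp [thVertex, Cell.center]
  norm_num

/-- The lists of the cells of the windmill and of the ship. -/
def targets : List (List Cell) :=
  [[(0, 0, false), (0, 0, true), (-1, 0, true), (0, -1, true),
    (1, 0, false), (-1, 1, false), (0, -1, false)],
   [(0, 0, false), (0, 0, true), (-1, 0, true), (0, -1, true),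
    (0, 1, false), (-1, 1, false), (0, -1, false)]]

/-- The cells `n₀`, `n₁`, `n₂` are the neighbours of the central cell, and each of `m₀`, `m₁`, `m₂`
is on one of the two free edges of its neighbour; all choices give the windmill or the ship. -/
theorem matchesRep_targets : ∀ n₀ ∈ nbrs (0, 0, false), ∀ n₁ ∈ nbrs (0, 0, false),
    ∀ n₂ ∈ nbrs (0, 0, false), ∀ m₀ ∈ nbrs n₀, ∀ m₁ ∈ nbrs n₁, ∀ m₂ ∈ nbrs n₂,
      [(0, 0, false), n₀, n₁, n₂, m₀, m₁, m₂].Nodup →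
        matchesRep targets [(0, 0, false), n₀, n₁, n₂, m₀, m₁, m₂] = true := by
  decide +kernel

theorem exists_latticeSym_cell (c : Cell) : ∃ g : LatticeSym, g.cell c = (0, 0, false) := by
  have key : ∀ i j : ℤ, ∃ g : LatticeSym, g.cell (i, j, false) = (0, 0, false) := fun i j =>
    ⟨LatticeSym.shift (-i) (-j), by simp [shiftCell]⟩
  obtain ⟨i, j, b⟩ := c
  cases b
  · exact key i j
  · obtain ⟨g, hg⟩ := key (-j - 1) (i + j + 1)
    exact ⟨LatticeSym.rot.trans g, hg⟩

/-- A set of seven cells formed by a cell, its neighbours and a neighbour of each of these is the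
windmill or the ship. -/
theorem samePiece_of_arms {T : Finset Cell} (hT : T.card = 7) {c : Cell} {n m : Fin 3 → Cell}
    (hn : ∀ i, cellGraph.Adj c (n i)) (hm : ∀ i, cellGraph.Adj (n i) (m i))
    (h : ∀ d ∈ T, d = c ∨ ∃ i, d = n i ∨ d = m i) :
    SamePiece T windmill ∨ SamePiece T ship := by
  obtain ⟨g, hg⟩ := exists_latticeSym_cell c
  have hn' : ∀ i, g.cell (n i) ∈ nbrs (0, 0, false) := fun i => by
    rw [← hg, ← adj_iff_mem_nbrs, g.adj_iff]
    exact hn i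
  have hm' : ∀ i, g.cell (m i) ∈ nbrs (g.cell (n i)) := fun i => by
    rw [← adj_iff_mem_nbrs, g.adj_iff]
    exact hm i
  obtain ⟨A, hA⟩ : ∃ A : List Cell, A = [(0, 0, false), g.cell (n 0), g.cell (n 1), g.cell (n 2),
      g.cell (m 0), g.cell (m 1), g.cell (m 2)] := ⟨_, rfl⟩
  have hsub : T.map g.cell.toEmbedding ⊆ A.toFinset := by
    intro d hd
    obtain ⟨e, he, rfl⟩ := Finset.mem_map.1 hd
    rw [hA]
    rcases h e he with rfl | ⟨i, rfl | rfl⟩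
    · simp [hg]
    · fin_cases i <;> simp
    · fin_cases i <;> simp
  have hlen : A.length = 7 := by rw [hA]; rfl
  have hcard : (T.map g.cell.toEmbedding).card = 7 := by rw [Finset.card_map, hT]
  have heq : T.map g.cell.toEmbedding = A.toFinset :=
    Finset.eq_of_subset_of_card_le hsub (by
      rw [hcard, ← hlen]
      exact A.toFinset_card_le)
  have hnd : A.Nodup := by
    rw [heq, List.card_toFinset, ← hlen] at hcard
    exact List.dedup_eq_self.1 ((List.dedup_sublist A).eq_of_length hcard)
  obtain ⟨B, hB, g', hg'⟩ := matchesRep_sound (L := targets) (A := A) (by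
    rw [hA] at hnd ⊢
    exact matchesRep_targets _ (hn' 0) _ (hn' 1) _ (hn' 2) _ (hm' 0) _ (hm' 1) _ (hm' 2) hnd) hnd
    (by
      rw [hlen]
      exact (by decide : ∀ B ∈ targets, B.length = 7))
  have hs := (g.samePiece T).trans (g'.samePiece _)
  rw [heq, hg'] at hs
  simp only [targets, List.mem_cons, List.not_mem_nil, or_false] at hB
  rcases hB with rfl | rfl
  · left
    rwa [show List.toFinset _ = windmill by decide +kernel] at hs
  · right
    rwa [show List.toFinset _ = ship by decide +kernel] at hs

/-- A fan of TH-pentagons covers the windmill or the ship: the thirds of cells belonging to the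
three pentagons lie in the same cell, whose centre is the apex. -/
theorem Fan.samePiece {T : Finset Cell} (hT : T.card = 7) (F : Fan T) :
    SamePiece T windmill ∨ SamePiece T ship := by
  choose g hg hx using fun i => F.exists_latticeSym i
  have hP : ∀ i, convexHull ℝ (Set.range (F.v i)) = (g i).iso '' thPentagon := fun i => by
    rw [hg, thPentagon_eq, IsometryEquiv.image_convexHull]
  have hc : ∀ i, (g i).cell (0, -1, true) = (g 0).cell (0, -1, true) := fun i => by
    have h : ∀ i, F.x = ((g i).cell (0, -1, true)).center := fun i => by
      rw [hx i, thVertex_zero, iso_center _ ((g i).image_triangle _)]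
    rw [← Cell.center_mem_iff, ← h, h 0]
    exact Cell.center_mem _
  refine samePiece_of_arms hT (c := (g 0).cell (0, -1, true))
    (n := fun i => (g i).cell (0, 0, false)) (m := fun i => (g i).cell (-1, 0, true)) ?_ ?_ ?_
  · intro i
    rw [← hc i, (g i).adj_iff, adj_iff_mem_nbrs]
    decide
  · intro i
    rw [(g i).adj_iff, adj_iff_mem_nbrs]
    decide
  · intro d hd
    have h1 := Cell.center_mem_region.2 hd
    rw [← F.cover] at h1
    obtain ⟨i, hi⟩ := Set.mem_iUnion.1 h1
    rw [hP] at hi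
    obtain ⟨w, hw, he⟩ := hi
    have key : ∀ c : Cell, w ∈ c.triangle → d = (g i).cell c := fun c hwc => by
      rw [← Cell.center_mem_iff, ← he, ← (g i).image_triangle]
      exact ⟨w, hwc, rfl⟩
    rcases mem_thPentagon_iff_cells.1 hw with h | h | ⟨h, -⟩
    · exact Or.inr ⟨i, Or.inl (key _ h)⟩
    · exact Or.inr ⟨i, Or.inr (key _ h)⟩
    · exact Or.inl ((key _ h).trans (hc i))

theorem exists_fan_of_trisection {T : Finset Cell} (hT : IsHeptiamond T) {P : Fin 3 → Set Plane}
    (hP : IsPentagonTrisection (region T) P) :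
    ∃ F : Fan T, ∀ i, P i = convexHull ℝ (Set.range (F.v i)) := by
  obtain ⟨C, hC⟩ := exists_config hP
  obtain ⟨F, k, hF⟩ := C.exists_fan hT
  refine ⟨F, fun i => ?_⟩
  rw [hC, funext (hF i)]
  exact congrArg _ ((Equiv.addLeft k).surjective.range_comp (C.w i)).symm

theorem figureCongruent_thPentagon {T : Finset Cell} (hT : IsHeptiamond T) {P : Fin 3 → Set Plane}
    (hP : IsPentagonTrisection (region T) P) (i : Fin 3) :
    FigureCongruent (P i) thPentagon := by
  obtain ⟨F, hF⟩ := exists_fan_of_trisection hT hP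
  obtain ⟨g, hg, -⟩ := F.exists_latticeSym i
  refine ⟨g.iso.symm, ?_⟩
  rw [hF, hg, ← IsometryEquiv.image_convexHull, ← thPentagon_eq, Set.image_image]
  simp

theorem samePiece_of_trisection {T : Finset Cell} (hT : IsHeptiamond T) {P : Fin 3 → Set Plane}
    (hP : IsPentagonTrisection (region T) P) : SamePiece T windmill ∨ SamePiece T ship :=
  let ⟨F, _⟩ := exists_fan_of_trisection hT hP
  F.samePiece hT.1

/-! ### Trisections of the windmill and of the ship -/

theorem IsCyclic.convexIndependent {ε : ℝ} {v : Fin 5 → Plane} (h : IsCyclic ε v) :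
    ConvexIndependent ℝ v := by
  intro s k hk
  by_contra hks
  -- the line through the neighbours of a vertex separates it from the other vertices
  have h1 := h.pos k (i := 0) (j := 1) (k := 4) (by decide) (by decide)
  have h2 := h.pos k (i := 1) (j := 2) (k := 4) (by decide) (by decide)
  have h3 := h.pos k (i := 1) (j := 3) (k := 4) (by decide) (by decide)
  simp only [add_comm _ k, add_zero] at h1 h2 h3
  have hne : v (k + 4) ≠ v (k + 1) := h.injective.ne ((by decide : ∀ k : Fin 5, k + 4 ≠ k + 1) k)
  have haff : IsAff fun z => ε * cr (v (k + 4)) (v (k + 1)) z :=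
    (isAff_cr hne).const_mul h.eps_ne
  have h4 := haff.nonneg_of_mem_convexHull (s := v '' s) (by
    rintro _ ⟨j, hj, rfl⟩
    rcases (by decide : ∀ k j : Fin 5, j ≠ k → j = k + 1 ∨ j = k + 2 ∨ j = k + 3 ∨ j = k + 4) k j
      (fun h => hks (h ▸ hj)) with rfl | rfl | rfl | rfl
    · simp
    · rw [← cr_rot]
      exact h2.le
    · rw [← cr_rot]
      exact h3.le
    · simp) hk
  rw [← cr_rot, cr_swap] at h4
  linarith

theorem IsConvexPentagon.image {S : Set Plane} (h : IsConvexPentagon S) (e : Plane ≃ᵢ Plane) :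
    IsConvexPentagon (e '' S) := by
  obtain ⟨v, hv, rfl⟩ := h
  refine ⟨e ∘ v, fun s k hk => hv s k ?_, ?_⟩
  · rw [Set.image_comp, ← IsometryEquiv.image_convexHull] at hk
    obtain ⟨z, hz, he⟩ := hk
    rwa [← e.injective he]
  · rw [IsometryEquiv.image_convexHull, Set.range_comp]

theorem isConvexPentagon_thPentagon : IsConvexPentagon thPentagon :=
  ⟨thVertex, isCyclic_thVertex.convexIndependent, thPentagon_eq⟩

theorem IsPentagonTrisection.image {R : Set Plane} {P : Fin 3 → Set Plane}
    (h : IsPentagonTrisection R P) (e : Plane ≃ᵢ Plane) :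
    IsPentagonTrisection (e '' R) fun i => e '' P i where
  pentagon i := (h.pentagon i).image e
  congruent i j := by
    obtain ⟨f, hf⟩ := h.congruent i j
    refine ⟨(e.symm.trans f).trans e, ?_⟩
    rw [← hf, Set.image_image, Set.image_image]
    simp
  disjoint i j hij := by
    have : ∀ S, interior (e '' S) = e '' interior S := fun S =>
      (e.toHomeomorph.image_interior S).symm
    rw [this, this]
    exact (Set.disjoint_image_iff e.injective).2 (h.disjoint i j hij)
  cover := by rw [← Set.image_iUnion, h.cover]

theorem SamePiece.image_region {T T' : Finset Cell} (h : SamePiece T T') :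
    ∃ e : Plane ≃ᵢ Plane, e '' region T = region T' := by
  obtain ⟨e, he⟩ := samePiece_iff.1 h
  have key : ∀ T : Finset Cell, region T = ⋃₀ (Cell.triangle '' (T : Set Cell)) := fun T => by
    rw [Set.sUnion_image]
    rfl
  refine ⟨e, ?_⟩
  rw [key, key, ← he, Set.image_sUnion]

/-- The barycentric coordinates with respect to the corners of the cell `(0, 0, false)`. -/
def bary : Fin 3 → Plane → ℝ := ![fun z => Y z, fun z => 1 - X z - Y z, fun z => X z]

/-- Three TH-pentagons that divide the cell `(0, 0, false)` into three equal parts, and whose other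
cells are different, form a trisection of the figure consisting of these cells. The hypothesis `hb`
says that the part belonging to the pentagon `i` is where the coordinate `bary i` is least. -/
theorem isPentagonTrisection_of_arms {T : Finset Cell} (g : Fin 3 → LatticeSym)
    (hc : ∀ i, (g i).cell (0, -1, true) = (0, 0, false))
    (hb : ∀ i z, (0 ≤ X z + 2 * Y z ∧ X z - Y z ≤ 1) ↔
      ∀ j, bary i ((g i).iso z) ≤ bary j ((g i).iso z))
    (hinj : ∀ i j, i ≠ j → ∀ a ∈ [((0, 0, false) : Cell), (-1, 0, true)],
      ∀ b ∈ [((0, 0, false) : Cell), (-1, 0, true)], (g i).cell a ≠ (g j).cell b)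
    (hT : ∀ d, d ∈ T ↔ d = (0, 0, false) ∨
      ∃ i, d = (g i).cell (0, 0, false) ∨ d = (g i).cell (-1, 0, true)) :
    IsPentagonTrisection (region T) fun i => (g i).iso '' thPentagon := by
  have hcell : ∀ (g : LatticeSym) (c : Cell) z, g.iso.symm z ∈ c.triangle ↔
      z ∈ (g.cell c).triangle := fun g c z => by
    rw [← g.image_triangle]
    exact ⟨fun h => ⟨_, h, g.iso.apply_symm_apply z⟩, by
      rintro ⟨w, hw, rfl⟩
      rwa [g.iso.symm_apply_apply]⟩
  have hmem : ∀ i z, z ∈ (g i).iso '' thPentagon ↔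
      z ∈ ((g i).cell (0, 0, false)).triangle ∨ z ∈ ((g i).cell (-1, 0, true)).triangle ∨
        z ∈ Cell.triangle (0, 0, false) ∧ ∀ j, bary i z ≤ bary j z := by
    intro i z
    have h1 : z ∈ (g i).iso '' thPentagon ↔ (g i).iso.symm z ∈ thPentagon :=
      ⟨by
        rintro ⟨w, hw, rfl⟩
        rwa [(g i).iso.symm_apply_apply], fun h => ⟨_, h, (g i).iso.apply_symm_apply z⟩⟩
    rw [h1, mem_thPentagon_iff_cells, hcell, hcell, hcell, hb i, hc,
      (g i).iso.apply_symm_apply]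
  constructor
  · exact fun i => isConvexPentagon_thPentagon.image _
  · intro i j
    refine ⟨(g i).iso.symm.trans (g j).iso, ?_⟩
    rw [Set.image_image]
    simp
  · -- two of the pentagons have only points on the tiling or on a line through the centre of the
    -- central cell in common, so the intersection of their interiors is an open null set
    intro i j hij
    rw [Set.disjoint_iff_inter_eq_empty]
    refine ((isOpen_interior.inter isOpen_interior).measure_eq_zero_iff (volume : Measure Plane)).1
      (measure_mono_null (t := {z | OnGrid z} ∪ {z | bary i z - bary j z = 0}) ?_
        (measure_union_null null_onGrid (null_line ?_)))
    · rintro z ⟨hi, hj⟩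
      by_contra hz
      simp only [Set.mem_union, not_or] at hz
      obtain ⟨hz1, hz2⟩ := hz
      have hne : ∀ k, ∀ a ∈ [((0, 0, false) : Cell), (-1, 0, true)],
          (g k).cell a ≠ (0, 0, false) := fun k a ha h => by
        rw [← hc k, (g k).cell.injective.eq_iff] at h
        subst h
        revert ha
        decide
      have hd : ∀ a ∈ [((0, 0, false) : Cell), (-1, 0, true)],
          ∀ b ∈ [((0, 0, false) : Cell), (-1, 0, true)], z ∈ ((g i).cell a).triangle →
            z ∉ ((g j).cell b).triangle := fun a ha b hb h1 h2 =>
        hinj i j hij a ha b hb (Cell.eq_of_mem hz1 h1 h2)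
      have hd' : ∀ k, ∀ a ∈ [((0, 0, false) : Cell), (-1, 0, true)],
          z ∈ ((g k).cell a).triangle → z ∉ Cell.triangle (0, 0, false) := fun k a ha h1 h2 =>
        hne k a ha (Cell.eq_of_mem hz1 h1 h2)
      have m1 : ((0, 0, false) : Cell) ∈ [((0, 0, false) : Cell), (-1, 0, true)] := by decide
      have m2 : ((-1, 0, true) : Cell) ∈ [((0, 0, false) : Cell), (-1, 0, true)] := by decide
      rcases (hmem i z).1 (interior_subset hi) with hi | hi | ⟨hi, hi'⟩ <;>
        rcases (hmem j z).1 (interior_subset hj) with hj | hj | ⟨hj, hj'⟩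
      exacts [hd _ m1 _ m1 hi hj, hd _ m1 _ m2 hi hj, hd' _ _ m1 hi hj, hd _ m2 _ m1 hi hj,
        hd _ m2 _ m2 hi hj, hd' _ _ m2 hi hj, hd' _ _ m1 hj hi, hd' _ _ m2 hj hi,
        hz2 (sub_eq_zero.2 (le_antisymm (hi' j) (hj' i)))]
    · fin_cases i <;> fin_cases j <;> first | exact absurd rfl hij | skip
      · exact ⟨1, 2, -1, by simp, fun z => by simp [bary]; ring⟩
      · exact ⟨-1, 1, 0, by simp, fun z => by simp [bary]; ring⟩
      · exact ⟨-1, -2, 1, by simp, fun z => by simp [bary]; ring⟩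
      · exact ⟨-2, -1, 1, by simp, fun z => by simp [bary]; ring⟩
      · exact ⟨1, -1, 0, by simp, fun z => by simp [bary]; ring⟩
      · exact ⟨2, 1, -1, by simp, fun z => by simp [bary]; ring⟩
  · ext z
    simp only [Set.mem_iUnion, hmem, region, exists_prop, hT]
    constructor
    · rintro ⟨i, h | h | ⟨h, -⟩⟩
      · exact ⟨_, Or.inr ⟨i, Or.inl rfl⟩, h⟩
      · exact ⟨_, Or.inr ⟨i, Or.inr rfl⟩, h⟩
      · exact ⟨_, Or.inl rfl, h⟩
    · rintro ⟨d, rfl | ⟨i, rfl | rfl⟩, h⟩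
      · obtain ⟨i, hi⟩ := Finite.exists_min fun i => bary i z
        exact ⟨i, Or.inr (Or.inr ⟨h, hi⟩)⟩
      · exact ⟨i, Or.inl h⟩
      · exact ⟨i, Or.inr (Or.inl h)⟩

/-- Rotation by 120 degrees about the centre of the cell `(0, 0, false)`. -/
def turn : LatticeSym := (LatticeSym.rot.trans LatticeSym.rot).trans (LatticeSym.shift 1 0)

/-- The reflection in the line of the tiling through the origin and `(1, 0)`. -/
def reflection : LatticeSym := LatticeSym.rot.trans LatticeSym.swap

/-- The point reflection in the midpoint of the edge from the origin to `(1, 0)`. -/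
def halfTurn : LatticeSym :=
  ((LatticeSym.rot.trans LatticeSym.rot).trans LatticeSym.rot).trans (LatticeSym.shift 1 0)

theorem turn_iso (z : Plane) : turn.iso z = pt (1 - X z - Y z) (X z) := by
  refine ext_XY ?_ ?_ <;>
    simp [turn, LatticeSym.rot_iso, LatticeSym.shift_iso]
  ring

theorem reflection_iso (z : Plane) : reflection.iso z = pt (X z + Y z) (-Y z) := by
  refine ext_XY ?_ ?_ <;> simp [reflection, LatticeSym.rot_iso, LatticeSym.swap_iso]

theorem halfTurn_iso (z : Plane) : halfTurn.iso z = pt (1 - X z) (-Y z) := by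
  refine ext_XY ?_ ?_ <;>
    simp [halfTurn, LatticeSym.rot_iso, LatticeSym.shift_iso]
  ring

theorem exists_trisection_windmill :
    ∃ P : Fin 3 → Set Plane, IsPentagonTrisection (region windmill) P := by
  refine ⟨_, isPentagonTrisection_of_arms
    ![reflection, reflection.trans turn, (reflection.trans turn).trans turn] ?_ ?_ ?_ ?_⟩
  · decide +kernel
  · intro i z
    fin_cases i <;>
      simp [Fin.forall_fin_succ, bary, turn_iso, reflection_iso] <;>
      constructor <;> rintro ⟨h1, h2⟩ <;> constructor <;> linarith
  · decide +kernel
  · have : windmill = {(0, 0, false)} ∪ Finset.univ.biUnion fun i : Fin 3 =>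
        {(![reflection, reflection.trans turn, (reflection.trans turn).trans turn] i).cell
          (0, 0, false), (![reflection, reflection.trans turn,
            (reflection.trans turn).trans turn] i).cell (-1, 0, true)} := by decide +kernel
    intro d
    rw [this]
    simp only [Finset.mem_union, Finset.mem_singleton, Finset.mem_biUnion, Finset.mem_univ,
      true_and, Finset.mem_insert]

theorem exists_trisection_ship :
    ∃ P : Fin 3 → Set Plane, IsPentagonTrisection (region ship) P := by
  refine ⟨_, isPentagonTrisection_of_arms
    ![reflection, halfTurn.trans turn, (reflection.trans turn).trans turn] ?_ ?_ ?_ ?_⟩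
  · decide +kernel
  · intro i z
    fin_cases i <;>
      simp [Fin.forall_fin_succ, bary, turn_iso, reflection_iso, halfTurn_iso] <;>
      constructor <;> rintro ⟨h1, h2⟩ <;> constructor <;> linarith
  · decide +kernel
  · have : ship = {(0, 0, false)} ∪ Finset.univ.biUnion fun i : Fin 3 =>
        {(![reflection, halfTurn.trans turn, (reflection.trans turn).trans turn] i).cell
          (0, 0, false), (![reflection, halfTurn.trans turn,
            (reflection.trans turn).trans turn] i).cell (-1, 0, true)} := by decide +kernel
    intro d
    rw [this]
    simp only [Finset.mem_union, Finset.mem_singleton, Finset.mem_biUnion, Finset.mem_univ,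
      true_and, Finset.mem_insert]

theorem exists_trisection_of_samePiece {T T' : Finset Cell} (h : SamePiece T T')
    (h' : ∃ P : Fin 3 → Set Plane, IsPentagonTrisection (region T') P) :
    ∃ P : Fin 3 → Set Plane, IsPentagonTrisection (region T) P := by
  obtain ⟨e, he⟩ := h.symm.image_region
  obtain ⟨P, hP⟩ := h'
  rw [← he]
  exact ⟨_, hP.image e⟩

end Polyiamond

end

theorem mainTheorem5 :
    -- there are 24 heptiamonds up to congruence
    Nat.card FreeHeptiamond = 24 ∧
    -- any trisection of a heptiamond into congruent convex pentagons yields the TH-pentagon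
    (∀ T : Finset Cell, IsHeptiamond T →
      ∀ P : Fin 3 → Set Plane, IsPentagonTrisection (region T) P →
        ∀ i, FigureCongruent (P i) thPentagon) ∧
    -- the windmill and the ship are two different heptiamonds
    (IsHeptiamond windmill ∧ IsHeptiamond ship ∧ ¬ SamePiece windmill ship) ∧
    -- they, and no other heptiamond, admit such a trisection
    (∀ T : Finset Cell, IsHeptiamond T →
      ((∃ P : Fin 3 → Set Plane, IsPentagonTrisection (region T) P) ↔
        SamePiece T windmill ∨ SamePiece T ship)) := by
  exact ⟨card_freeHeptiamond, fun _ hT _ hP => figureCongruent_thPentagon hT hP,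
    ⟨isHeptiamond_windmill, isHeptiamond_ship, not_samePiece_windmill_ship⟩, fun _ hT =>
      ⟨fun ⟨_, hP⟩ => samePiece_of_trisection hT hP, fun h => h.elim
        (fun h => exists_trisection_of_samePiece h exists_trisection_windmill)
        fun h => exists_trisection_of_samePiece h exists_trisection_ship⟩⟩
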